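/- **Theorem 1.1 (Three lines variational problem).** Let $\gamma>2$. Define $$M_\gamma=\inf_{m_1,m_2}\Big\{\big(\|m_1\|_{L^2(\mathbb R_+,ds/s)}\,\|m_2\|_{L^2(\mathbb R_+,ds/s)}\big)^{\gamma-2}\int_0^\infty |(m_1\star m_2)(t)-t|^2\,t^{-\gamma}\,\frac{dt}{t}\Big\},$$ where the infimum is over complex-valued $m_1,m_2\in L^2(\mathbb R_+,ds/s)$, $\mathbb R_+=(0,\infty)$, $(m_1\star m_2)(t)=\int_0^\infty m_1(t/s)\,m_2(s)\,\frac{ds}{s}$, and the expression is read as $+\infty$ whenever the last integral is infinite. Let $S=\{x+iy:0<y<1\}$ and $S_-=\{x-iy:0<y<1\}$, and write $h_y(x)=h(x+iy)$. A holomorphic $h:S\to\mathbb C$ belongs to $\mathbb H^{\infty,2}(S)$ if $$\sup_{0<y<1}\ \inf_{\substack{f+g=h_y\\ f\in L^\infty(\mathbb R),\,g\in L^2(\mathbb R)}}\Big(\tfrac1{1-y}\|f\|_{L^\infty(\mathbb R)}+\tfrac1y\|g\|_{L^2(\mathbb R)}\Big)<\infty,$$ and a holomorphic $h:S_-\to\mathbb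 C$ belongs to $\mathbb H^{\infty,2}(S_-)$ if $z\mapsto\overline{h(\bar z)}$ belongs to $\mathbb H^{\infty,2}(S)$. Every $h\in\mathbb H^{\infty,2}(S_-)$ has boundary values $h_0\in L^\infty(\mathbb R)$ and $h_{-1}\in L^2(\mathbb R)$, in the sense that $\lim_{y\uparrow 0}\langle h_y,\varphi\rangle=\langle h_0,\varphi\rangle$ and $\lim_{y\downarrow -1}\langle h_y,\varphi\rangle=\langle h_{-1},\varphi\rangle$ for all Schwartz functions $\varphi$, where $\langle u,\varphi\rangle=\int_{\mathbb R}\overline{u}\,\varphi\,dx$. With these, $$M_\gamma=16\pi\,\frac{(\gamma-2)^{\gamma-2}}{\gamma^{\gamma+1}}\left(\max_{0\ne h\in\mathbb H^{\infty,2}(S_-)}\frac{\|h_{-2/\gamma}\|_{L^\infty(\mathbb R)}}{\|h_0\|_{L^\infty(\mathbb R)}^{1-2/\gamma}\,\|h_{-1}\|_{L^2(\mathbb R)}^{2/\gamma}}\right)^{\gamma},$$ where the maximum is finite and attained. Moreover, the maximizer is unique up to symmetries: if $h$ is a maximizer, then the maximizers are exactly the functions $z\mapsto\beta\,h(z-\alpha)\,e^{i\omega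 z}$ with $\alpha,\omega\in\mathbb R$ and $\beta\in\mathbb C\setminus\{0\}$. -/

import Mathlib

open MeasureTheory Set Filter Topology
open scoped ENNReal NNReal SchwartzMap ComplexConjugate

noncomputable section

/-- The Haar measure `ds / s` of the multiplicative group `(0, ∞)`, as a measure on `ℝ`
concentrated on `(0, ∞)`. -/
def mulHaar : Measure ℝ :=
  (volume.restrict (Ioi (0 : ℝ))).withDensity fun s => ENNReal.ofReal s⁻¹

/-- Multiplicative convolution `(m₁ ⋆ m₂)(t) = ∫₀^∞ m₁(t/s) m₂(s) ds/s`. -/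
def mulConv (m₁ m₂ : ℝ → ℂ) (t : ℝ) : ℂ :=
  ∫ s, m₁ (t / s) * m₂ s ∂mulHaar

/-- The error term `∫₀^∞ |(m₁ ⋆ m₂)(t) - t|² t^{-γ} dt/t`, with values in `[0, ∞]`. -/
def primalError (γ : ℝ) (m₁ m₂ : ℝ → ℂ) : ℝ≥0∞ :=
  ∫⁻ t, ‖mulConv m₁ m₂ t - (t : ℂ)‖ₑ ^ 2 * ENNReal.ofReal (t ^ (-γ)) ∂mulHaar

/-- The constant `M_γ`: the infimum, over `m₁, m₂ ∈ L²((0,∞), ds/s)`, of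
`(‖m₁‖ ‖m₂‖)^{γ-2} ∫₀^∞ |(m₁ ⋆ m₂)(t) - t|² t^{-γ} dt/t`.
A pair with infinite error term has the value `+∞` and does not compete; it is left out because
`0 * ∞ = 0` in `[0, ∞]`, which would matter for `m₁ = 0` or `m₂ = 0`. -/
def primalConst (γ : ℝ) : ℝ≥0∞ :=
  ⨅ (m₁ : ℝ → ℂ) (m₂ : ℝ → ℂ) (_ : MemLp m₁ 2 mulHaar) (_ : MemLp m₂ 2 mulHaar)
    (_ : primalError γ m₁ m₂ ≠ ∞),
    (eLpNorm m₁ 2 mulHaar * eLpNorm m₂ 2 mulHaar) ^ (γ - 2) * primalError γ m₁ m₂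

/-- The strip `S = {0 < Im z < 1}`. -/
def upperStrip : Set ℂ := {z | 0 < z.im ∧ z.im < 1}

/-- The strip `S_- = {-1 < Im z < 0}`. -/
def lowerStrip : Set ℂ := {z | -1 < z.im ∧ z.im < 0}

/-- The restriction `h_y(x) = h(x + i y)` of `h` to a horizontal line. -/
def onLine (h : ℂ → ℂ) (y : ℝ) (x : ℝ) : ℂ := h ((x : ℂ) + (y : ℂ) * Complex.I)

/-- The norm of `ℍ^{p,q}(S)`, with values in `[0, ∞]`. -/
def hardyNorm (p q : ℝ≥0∞) (h : ℂ → ℂ) : ℝ≥0∞ :=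
  ⨆ y ∈ Ioo (0 : ℝ) 1,
    ⨅ (f : ℝ → ℂ) (g : ℝ → ℂ) (_ : MemLp f p volume) (_ : MemLp g q volume)
      (_ : f + g =ᵐ[volume] onLine h y),
      ENNReal.ofReal (1 / (1 - y)) * eLpNorm f p volume
        + ENNReal.ofReal (1 / y) * eLpNorm g q volume

/-- The space `ℍ^{p,q}(S)`. Functions on the strip are represented by functions on `ℂ`
whose values off the strip are irrelevant. -/
def hardyUpper (p q : ℝ≥0∞) : Set (ℂ → ℂ) :=
  {h | DifferentiableOn ℂ h upperStrip ∧ hardyNorm p q h < ∞}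

/-- The space `ℍ^{p,q}(S_-)`. -/
def hardyLower (p q : ℝ≥0∞) : Set (ℂ → ℂ) :=
  {h | DifferentiableOn ℂ h lowerStrip ∧ (fun z => conj (h (conj z))) ∈ hardyUpper p q}

/-- `v ∈ L^p(ℝ)` is the boundary value of `h` as the height `y` of the line tends along `l`:
`⟨h_y, φ⟩ → ⟨v, φ⟩` for every Schwartz function `φ`. -/
def IsBoundaryValue (p : ℝ≥0∞) (h : ℂ → ℂ) (l : Filter ℝ) (v : ℝ → ℂ) : Prop :=
  MemLp v p volume ∧
    ∀ φ : 𝓢(ℝ, ℂ), Tendsto (fun y => ∫ x, conj (onLine h y x) * φ x) l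
      (𝓝 (∫ x, conj (v x) * φ x))

/-- A boundary value is determined almost everywhere. -/
theorem IsBoundaryValue.ae_eq {p : ℝ≥0∞} (hp : 1 ≤ p) {h : ℂ → ℂ} {l : Filter ℝ} [l.NeBot]
    {v w : ℝ → ℂ} (hv : IsBoundaryValue p h l v) (hw : IsBoundaryValue p h l w) :
    v =ᵐ[volume] w := by
  have hli : ∀ {u : ℝ → ℂ}, MemLp u p volume →
      LocallyIntegrable (fun x => conj (u x)) volume := by
    intro u hu
    exact (MemLp.star hu).locallyIntegrable hp
  have key : (fun x => conj (v x)) =ᵐ[volume] fun x => conj (w x) := by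
    refine ae_eq_of_integral_contDiff_smul_eq (hli hv.1) (hli hw.1) ?_
    intro g hg hgc
    have hg' : ContDiff ℝ ((⊤ : ℕ∞) : WithTop ℕ∞) (fun x => (g x : ℂ)) := Complex.ofRealCLM.contDiff.comp hg
    have hgc' : HasCompactSupport (fun x => (g x : ℂ)) :=
      hgc.comp_left (g := fun r : ℝ => (r : ℂ)) (by simp)
    have := tendsto_nhds_unique (hv.2 (hgc'.toSchwartzMap hg'))
      (hw.2 (hgc'.toSchwartzMap hg'))
    simpa [mul_comm] using this
  filter_upwards [key] with x hx
  exact (starRingEnd ℂ).injective hx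

open Classical in
/-- The boundary value of `h` in `L^p(ℝ)` along `l` (zero if there is none). -/
def boundaryValue (p : ℝ≥0∞) (h : ℂ → ℂ) (l : Filter ℝ) : ℝ → ℂ :=
  if H : ∃ v, IsBoundaryValue p h l v then H.choose else 0

/-- The functional
`‖h_{-2/γ}‖_∞ / (‖h_0‖_∞^{1-2/γ} ‖h_{-1}‖_2^{2/γ})` of the three lines problem. -/
def threeLinesRatio (γ : ℝ) (h : ℂ → ℂ) : ℝ≥0∞ :=
  eLpNorm (onLine h (-(2 / γ))) ∞ volume /
    (eLpNorm (boundaryValue ∞ h (𝓝[<] (0 : ℝ))) ∞ volume ^ (1 - 2 / γ) *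
      eLpNorm (boundaryValue 2 h (𝓝[>] (-1 : ℝ))) 2 volume ^ (2 / γ))

/-- The competitors of the three lines problem: the nonzero elements of `ℍ^{∞,2}(S_-)`. -/
def threeLinesDomain : Set (ℂ → ℂ) :=
  {h | h ∈ hardyLower ∞ 2 ∧ ∃ z ∈ lowerStrip, h z ≠ 0}

/-- `h` is a maximizer of the three lines problem. -/
def IsThreeLinesMaximizer (γ : ℝ) (h : ℂ → ℂ) : Prop :=
  h ∈ threeLinesDomain ∧ IsMaxOn (threeLinesRatio γ) threeLinesDomain h

end

/-! Put θ = 2/γ. One zero-free function H governs both problems. It is holomorphic slightly beyond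
the closed strip, has modulus 1 on ℝ, and on ℝ − i its squared modulus is the harmonic density seen
from −iθ, normalised to mass 1 (`exists_isExtremal`). Let K = |H(−iθ)|; this is the maximum of the
three lines functional.

Three lines. Divide h by H, translate by a, modulate by e^{iωz}, and apply the residue theorem with
the Cauchy kernel of the strip with pole at −iθ (`HasBoundary.poisson`). On ℝ the resulting kernel
has the harmonic density as its modulus, with mass 1 − θ. On ℝ − i the choice of |H|² turns
density/H into θ times the conjugate of H, so that integral is an L² pairing of h_{-1} with a unit
vector u_{a,ω}, a modulated translate of H_{-1}. Hence |h(a − iθ)| e^{ωθ} ≤ K ((1 − θ)‖h_0‖_∞ + θ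
e^ω |⟨h_{-1}, u_{a,ω}⟩|). Cauchy-Schwarz and the best ω give the sharp inequality
(`HasBoundary.norm_le`), and H attains it. For a maximizer take e^ω = ‖h_0‖_∞/‖h_{-1}‖_2. The
pairing tends to 0 as |a| → ∞, so the supremum of |h| on the line is attained at some a
(`HasBoundary.exists_norm_eq`). There Cauchy-Schwarz is an equality, h_{-1} is a multiple of
u_{a,ω}, and h_{-1} determines h; so h lies in the orbit of H.

Primal problem. With t = e^{2πθu} one approximates e^{2πθu} by 2πθ n₁ * n₂ in L² with weight
e^{-4πu}. For decaying holomorphic g, g(−iθ) is the integral of e^{2πθu} 𝓕g_0(u). Replacing the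
exponential by the convolution costs a pairing of the error with 𝓕g_{-1}
(`IsStripDecaying.norm_le`). Gaussian-damped modulations of H yield K e^{ωθ} ≤ N + e^ω R for every
ω, where N is 2πθ‖n₁‖‖n₂‖ and R² is the error; optimising in ω bounds N^{γ−2}R² from below.
Conversely, the residue identity for 1/H says that if 2πθ n₁ * n₂ is H(−iθ) times the inverse
Fourier transform of the kernel on ℝ, then the error is explicit. Factoring this kernel into two
functions of equal modulus gives N = K(1 − θ) and R = Kθ, the case of equality
(`IsExtremal.exists_competitors`).

Boundary values rest on a quadratic weight: h/(z − 2i)² is bounded in L¹ and L² along the lines, its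
Fourier transforms there are G(ξ)e^{-2πyξ} with one G, and dominated convergence gives L² limits at
both edges. -/

open scoped FourierTransform

/-! ### The Fourier transform on `L¹ ∩ L²` -/

/-- On `L¹ ∩ L²` the Fourier integral agrees with the Fourier transform of `L²`. -/
theorem fourier_ae_eq_fourier_toLp {f : ℝ → ℂ} (h1 : Integrable f) (h2 : MemLp f 2) :
    𝓕 f =ᵐ[volume] (𝓕 (h2.toLp f) : Lp ℂ 2 (volume : Measure ℝ)) := by
  have hc : Continuous (𝓕 f) :=
    VectorFourier.fourierIntegral_continuous Real.continuous_fourierChar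
      (by exact continuous_inner) h1
  -- Against a test function both transforms move onto it: the L² one by its definition on tempered
  -- distributions, the integral one by Fubini.
  refine ae_eq_of_integral_contDiff_smul_eq hc.locallyIntegrable
    ((Lp.memLp _).locallyIntegrable (by norm_num)) ?_
  intro g hg hgc
  have hg' : ContDiff ℝ ((⊤ : ℕ∞) : WithTop ℕ∞) (fun x => (g x : ℂ)) :=
    Complex.ofRealCLM.contDiff.comp hg
  have hgc' : HasCompactSupport (fun x => (g x : ℂ)) :=
    hgc.comp_left (g := fun r : ℝ => (r : ℂ)) (by simp)
  set φ : 𝓢(ℝ, ℂ) := hgc'.toSchwartzMap hg' with hφ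
  have e1 := congrArg (fun T => T φ) (Lp.fourier_toTemperedDistribution_eq (h2.toLp f))
  simp only [TemperedDistribution.fourier_apply, Lp.toTemperedDistribution_apply] at e1
  have e2 : ∫ x, φ x • (𝓕 f) x = ∫ x, (𝓕 φ) x • f x := by
    have := VectorFourier.integral_fourierIntegral_smul_eq_flip (μ := (volume : Measure ℝ))
      (ν := (volume : Measure ℝ)) (f := (φ : ℝ → ℂ)) (g := f) (L := innerₗ ℝ)
      Real.continuous_fourierChar
      (by exact continuous_inner) φ.integrable h1
    rw [flip_innerₗ] at this
    rw [SchwartzMap.fourier_coe]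
    exact this.symm
  have e3 : ∫ x, (𝓕 φ) x • (h2.toLp f) x = ∫ x, (𝓕 φ) x • f x := by
    refine integral_congr_ae ?_
    filter_upwards [h2.coeFn_toLp] with x hx
    rw [hx]
  have e4 : ∀ x, φ x = (g x : ℂ) := fun x => rfl
  rw [e3, ← e2] at e1
  simpa [e4] using e1

theorem memLp_fourier {f : ℝ → ℂ} (h1 : Integrable f) (h2 : MemLp f 2) :
    MemLp (𝓕 f) 2 :=
  (memLp_congr_ae (fourier_ae_eq_fourier_toLp h1 h2)).2 (Lp.memLp _)

/-- Plancherel's theorem on `L¹ ∩ L²`. -/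
theorem eLpNorm_fourier {f : ℝ → ℂ} (h1 : Integrable f) (h2 : MemLp f 2) :
    eLpNorm (𝓕 f) 2 volume = eLpNorm f 2 volume := by
  rw [eLpNorm_congr_ae (fourier_ae_eq_fourier_toLp h1 h2),
    ← eLpNorm_congr_ae h2.coeFn_toLp]
  have := Lp.norm_fourier_eq (h2.toLp f)
  rw [Lp.norm_def, Lp.norm_def] at this
  exact (ENNReal.toReal_eq_toReal_iff' (Lp.memLp _).2.ne (Lp.memLp _).2.ne).1 this

/-- Parseval's identity on `L¹ ∩ L²`. -/
theorem integral_fourier_mul_conj {f g : ℝ → ℂ} (hf1 : Integrable f) (hf2 : MemLp f 2)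
    (hg1 : Integrable g) (hg2 : MemLp g 2) :
    ∫ x, 𝓕 f x * conj (𝓕 g x) = ∫ x, f x * conj (g x) := by
  have := Lp.inner_fourier_eq (hg2.toLp g) (hf2.toLp f)
  rw [L2.inner_def, L2.inner_def] at this
  simp only [RCLike.inner_apply] at this
  rw [integral_congr_ae, this, integral_congr_ae]
  · filter_upwards [hf2.coeFn_toLp, hg2.coeFn_toLp] with x hx hy
    rw [hx, hy]
  · filter_upwards [fourier_ae_eq_fourier_toLp hf1 hf2, fourier_ae_eq_fourier_toLp hg1 hg2]
      with x hx hy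
    rw [hx, hy]

/-! ### Convergence in `L²` -/

section L2

variable {α ι : Type*} [MeasurableSpace α] {μ : Measure α}

theorem norm_integral_mul_le {f g : α → ℂ} (hf : MemLp f 2 μ) (hg : MemLp g 2 μ) :
    ‖∫ x, f x * g x ∂μ‖ ≤ (eLpNorm f 2 μ).toReal * (eLpNorm g 2 μ).toReal := by
  have h : eLpNorm (f * g) 1 μ ≤ eLpNorm f 2 μ * eLpNorm g 2 μ := by
    have := eLpNorm_smul_le_mul_eLpNorm (r := 1) (p := 2) (q := 2) hg.1 hf.1
    simpa [Pi.smul_def', smul_eq_mul, Pi.mul_def] using this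
  rw [← ENNReal.toReal_mul]
  calc ‖∫ x, f x * g x ∂μ‖ = (‖∫ x, f x * g x ∂μ‖ₑ).toReal := by simp
    _ ≤ _ := by
      refine ENNReal.toReal_mono (ENNReal.mul_ne_top hf.2.ne hg.2.ne) ?_
      refine (enorm_integral_le_lintegral_enorm _).trans ?_
      rw [← eLpNorm_one_eq_lintegral_enorm]
      exact h

theorem tendsto_integral_mul_of_tendsto_eLpNorm {l : Filter ι} {f g : ι → α → ℂ} {f₀ g₀ : α → ℂ}
    (hf : ∀ᶠ n in l, MemLp (f n) 2 μ) (hg : ∀ᶠ n in l, MemLp (g n) 2 μ)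
    (hf₀ : MemLp f₀ 2 μ) (hg₀ : MemLp g₀ 2 μ)
    (hfl : Tendsto (fun n => eLpNorm (fun x => f n x - f₀ x) 2 μ) l (𝓝 0))
    (hgl : Tendsto (fun n => eLpNorm (fun x => g n x - g₀ x) 2 μ) l (𝓝 0)) :
    Tendsto (fun n => ∫ x, f n x * g n x ∂μ) l (𝓝 (∫ x, f₀ x * g₀ x ∂μ)) := by
  have hF : Tendsto (fun n => (eLpNorm (fun x => f n x - f₀ x) 2 μ).toReal) l (𝓝 0) := by
    simpa [Function.comp_def] using (ENNReal.tendsto_toReal ENNReal.zero_ne_top).comp hfl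
  have hG : Tendsto (fun n => (eLpNorm (fun x => g n x - g₀ x) 2 μ).toReal) l (𝓝 0) := by
    simpa [Function.comp_def] using (ENNReal.tendsto_toReal ENNReal.zero_ne_top).comp hgl
  rw [tendsto_iff_norm_sub_tendsto_zero]
  refine squeeze_zero' (Eventually.of_forall fun n => norm_nonneg _) ?_
    (g := fun n => (eLpNorm (fun x => f n x - f₀ x) 2 μ).toReal *
      (eLpNorm (fun x => g n x - g₀ x) 2 μ).toReal +
      (eLpNorm (fun x => f n x - f₀ x) 2 μ).toReal * (eLpNorm g₀ 2 μ).toReal +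
      (eLpNorm f₀ 2 μ).toReal * (eLpNorm (fun x => g n x - g₀ x) 2 μ).toReal) ?_
  · filter_upwards [hf, hg] with n hfn hgn
    have a1 : MemLp (fun x => f n x - f₀ x) 2 μ := hfn.sub hf₀
    have a2 : MemLp (fun x => g n x - g₀ x) 2 μ := hgn.sub hg₀
    have i1 : Integrable (fun x => (f n x - f₀ x) * (g n x - g₀ x)) μ := a1.integrable_mul a2
    have i2 : Integrable (fun x => (f n x - f₀ x) * g₀ x) μ := a1.integrable_mul hg₀
    have i3 : Integrable (fun x => f₀ x * (g n x - g₀ x)) μ := hf₀.integrable_mul a2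
    have i4 : Integrable (fun x => f₀ x * g₀ x) μ := hf₀.integrable_mul hg₀
    have : ∫ x, f n x * g n x ∂μ - ∫ x, f₀ x * g₀ x ∂μ =
        ∫ x, (f n x - f₀ x) * (g n x - g₀ x) ∂μ + ∫ x, (f n x - f₀ x) * g₀ x ∂μ +
          ∫ x, f₀ x * (g n x - g₀ x) ∂μ := by
      have e := integral_add (i1.add i2) i3
      have e' := integral_sub (hfn.integrable_mul hgn) i4
      simp only [Pi.add_apply, Pi.mul_apply] at e e'
      rw [← integral_add i1 i2, ← e, ← e']
      congr 1; ext x; ring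
    rw [this]
    refine (norm_add₃_le).trans ?_
    gcongr
    · exact norm_integral_mul_le a1 a2
    · exact norm_integral_mul_le a1 hg₀
    · exact norm_integral_mul_le hf₀ a2
  · have := ((hF.mul hG).add (hF.mul_const (eLpNorm g₀ 2 μ).toReal)).add
      (hG.const_mul (eLpNorm f₀ 2 μ).toReal)
    simpa using this

/-- Dominated convergence in `L²`. -/
theorem tendsto_eLpNorm_sub_of_dominated {l : Filter ι} [l.IsCountablyGenerated]
    {f : ι → α → ℂ} {f₀ : α → ℂ} {b : α → ℝ}
    (hfm : ∀ᶠ n in l, AEStronglyMeasurable (f n) μ) (hf₀ : AEStronglyMeasurable f₀ μ)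
    (hb : MemLp b 2 μ) (hfb : ∀ᶠ n in l, ∀ᵐ x ∂μ, ‖f n x‖ ≤ b x)
    (hfb₀ : ∀ᵐ x ∂μ, ‖f₀ x‖ ≤ b x)
    (h : ∀ᵐ x ∂μ, Tendsto (fun n => f n x) l (𝓝 (f₀ x))) :
    Tendsto (fun n => eLpNorm (fun x => f n x - f₀ x) 2 μ) l (𝓝 0) := by
  have key : Tendsto (fun n => ∫⁻ x, ‖f n x - f₀ x‖ₑ ^ (2 : ℝ) ∂μ) l (𝓝 (∫⁻ _, 0 ∂μ)) := by
    refine tendsto_lintegral_filter_of_dominated_convergence'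
      (fun x => (2 * ‖b x‖ₑ) ^ (2 : ℝ)) ?_ ?_ ?_ ?_
    · filter_upwards [hfm] with n hn
      exact ((hn.sub hf₀).enorm).pow_const _
    · filter_upwards [hfb] with n hn
      filter_upwards [hn, hfb₀] with x h1 h2
      gcongr
      refine (enorm_sub_le).trans ?_
      rw [two_mul]
      gcongr <;> rw [enorm_le_iff_norm_le]
      · exact h1.trans (le_abs_self _)
      · exact h2.trans (le_abs_self _)
    · have := hb.eLpNorm_lt_top
      rw [eLpNorm_lt_top_iff_lintegral_rpow_enorm_lt_top (by norm_num) (by norm_num)] at this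
      simp only [ENNReal.toReal_ofNat] at this
      simp_rw [ENNReal.mul_rpow_of_nonneg _ _ (zero_le_two : (0 : ℝ) ≤ 2)]
      rw [lintegral_const_mul' _ _ (by simp)]
      exact ENNReal.mul_ne_top (by simp) this.ne
    · filter_upwards [h] with x hx
      have := ((hx.sub_const (f₀ x)).enorm)
      simp only [sub_self, enorm_zero] at this
      have := (ENNReal.continuous_rpow_const (y := 2)).tendsto 0 |>.comp this
      simpa [Function.comp_def] using this
  have h2 := (ENNReal.continuous_rpow_const (y := 1 / 2)).tendsto 0 |>.comp
    (by simpa using key)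
  simp only [eLpNorm_eq_lintegral_rpow_enorm_toReal (two_ne_zero : (2 : ℝ≥0∞) ≠ 0)
    (by norm_num : (2 : ℝ≥0∞) ≠ ∞), ENNReal.toReal_ofNat]
  simpa [Function.comp_def] using h2

end L2

/-! ### Shifting horizontal contours -/

theorem onLine_apply (h : ℂ → ℂ) (y x : ℝ) : onLine h y x = h (x + y * Complex.I) := rfl

theorem continuous_onLine {G : ℂ → ℂ} {s : Set ℝ} (hc : ContinuousOn G {z | z.im ∈ s}) {y : ℝ}
    (hy : y ∈ s) : Continuous (onLine G y) := by
  rw [← continuousOn_univ]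
  refine hc.comp (f := fun x : ℝ => (x : ℂ) + (y : ℂ) * Complex.I) (by fun_prop) ?_
  intro x _
  simpa using hy

/-- Bounds are imposed only on |x| > 1 because the kernels used below have a pole on the imaginary
axis: their tails are bounded uniformly over all lines, including the one through the pole.
Continuity takes care of [−1, 1]. -/
theorem integrable_of_lintegral_tail {f : ℝ → ℂ} (hf : Continuous f) {M : ℝ≥0∞} (hM : M ≠ ∞)
    (hb : ∫⁻ x in {x : ℝ | 1 < |x|}, ‖f x‖ₑ ≤ M) : Integrable f := by
  have h1 : IntegrableOn f {x : ℝ | 1 < |x|} :=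
    ⟨hf.aestronglyMeasurable, lt_of_le_of_lt hb hM.lt_top⟩
  have h2 : IntegrableOn f (Icc (-1) 1) := hf.continuousOn.integrableOn_Icc
  have := h1.union h2
  rw [← integrableOn_univ]
  refine this.mono_set ?_
  intro x _
  by_cases hx : 1 < |x|
  · exact Or.inl hx
  · exact Or.inr (abs_le.1 (not_lt.1 hx))

/-- Here t R will be the size of the vertical sides of a rectangle. An integrable t cannot stay
above δ, so good values of R exist although no pointwise decay is known. -/
theorem frequently_lintegral_lt {t : ℝ → ℝ≥0∞} (ht : ∫⁻ R in Ioi (1 : ℝ), t R ≠ ∞) {δ : ℝ≥0∞}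
    (hδ : 0 < δ) : ∃ᶠ R in atTop, t R < δ := by
  intro h
  obtain ⟨R₀, hR₀⟩ := eventually_atTop.1 h
  apply ht
  have : ∫⁻ R in Ioi (max R₀ 1), δ ≤ ∫⁻ R in Ioi (1 : ℝ), t R := by
    refine (setLIntegral_mono_ae' measurableSet_Ioi (g := t) ?_).trans
      (lintegral_mono_set (Ioi_subset_Ioi (le_max_right _ _)))
    refine Eventually.of_forall fun R hR => not_lt.1 (hR₀ R ((le_max_left _ _).trans hR.le))
  rw [setLIntegral_const, Real.volume_Ioi, ENNReal.mul_top hδ.ne'] at this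
  exact top_le_iff.1 this

/-- Cauchy's theorem on a horizontal strip: the integrals of a holomorphic function along the two
boundary lines agree, provided that its `L¹` norms along the lines are uniformly bounded. -/
theorem integral_onLine_eq_of_differentiableOn {G : ℂ → ℂ} {a b : ℝ} (hab : a ≤ b)
    (hc : ContinuousOn G {z | z.im ∈ Icc a b}) (hd : DifferentiableOn ℂ G {z | z.im ∈ Ioo a b})
    {M : ℝ≥0∞} (hM : M ≠ ∞)
    (hb : ∀ y ∈ Icc a b, ∫⁻ x in {x : ℝ | 1 < |x|}, ‖onLine G y x‖ₑ ≤ M) :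
    ∫ x, onLine G a x = ∫ x, onLine G b x := by
  have hia : Integrable (onLine G a) := integrable_of_lintegral_tail
    (continuous_onLine hc (left_mem_Icc.2 hab)) hM (hb a (left_mem_Icc.2 hab))
  have hib : Integrable (onLine G b) := integrable_of_lintegral_tail
    (continuous_onLine hc (right_mem_Icc.2 hab)) hM (hb b (right_mem_Icc.2 hab))
  set t : ℝ → ℝ → ℝ≥0∞ := fun R y => ‖onLine G y R‖ₑ + ‖onLine G y (-R)‖ₑ with ht
  have hcont : ContinuousOn (Function.uncurry t) (univ ×ˢ Icc a b) := by
    have h1 : ContinuousOn (fun p : ℝ × ℝ => G ((p.1 : ℂ) + (p.2 : ℂ) * Complex.I))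
        (univ ×ˢ Icc a b) := by
      refine hc.comp (by fun_prop) ?_
      intro p hp
      simpa using hp.2
    have h2 : ContinuousOn (fun p : ℝ × ℝ => G (((-p.1 : ℝ) : ℂ) + (p.2 : ℂ) * Complex.I))
        (univ ×ˢ Icc a b) := by
      refine hc.comp (by fun_prop) ?_
      intro p hp
      simpa using hp.2
    exact h1.enorm.add h2.enorm
  -- By Tonelli, the L¹ bounds on horizontal lines bound the integral over R of the contributions of
  -- the vertical sides; so these are small for arbitrarily large R.
  have htop : ∫⁻ R in Ioi (1 : ℝ), (∫⁻ y in Icc a b, t R y) ≠ ∞ := by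
    rw [lintegral_lintegral_swap]
    · refine ne_of_lt (lt_of_le_of_lt (b := ∫⁻ y in Icc a b, 2 * M) ?_ ?_)
      · refine setLIntegral_mono_ae' measurableSet_Icc (Eventually.of_forall fun y hy => ?_)
        have hcy := continuous_onLine hc hy
        have e1 : ∫⁻ R in Ioi (1 : ℝ), ‖onLine G y R‖ₑ ≤ M := by
          refine (lintegral_mono_set ?_).trans (hb y hy)
          intro R hR
          exact lt_of_lt_of_le hR (le_abs_self R)
        have e2 : ∫⁻ R in Ioi (1 : ℝ), ‖onLine G y (-R)‖ₑ ≤ M := by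
          have hmp := (Measure.measurePreserving_neg (volume : Measure ℝ)).restrict_preimage
            (measurableSet_Iio (a := (-1 : ℝ)))
          have := hmp.lintegral_comp (f := fun R => ‖onLine G y R‖ₑ) hcy.measurable.enorm
          have e3 : (Neg.neg ⁻¹' Iio (-1 : ℝ)) = Ioi 1 := by ext x; simp
          rw [e3] at this
          rw [this]
          refine (lintegral_mono_set ?_).trans (hb y hy)
          intro R hR
          have : R < -1 := hR
          exact lt_of_lt_of_le (by linarith) (neg_le_abs R)
        simp only [ht]
        rw [lintegral_add_left hcy.measurable.enorm, two_mul]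
        exact add_le_add e1 e2
      · rw [setLIntegral_const]
        exact ENNReal.mul_lt_top (ENNReal.mul_lt_top (by simp) hM.lt_top) (by simp)
    · rw [Measure.prod_restrict]
      exact (hcont.mono (by intro p hp; exact ⟨mem_univ _, hp.2⟩)).aemeasurable
        (measurableSet_Ioi.prod measurableSet_Icc)
  have hlim : Tendsto (fun R : ℝ => (∫ x in (-R)..R, onLine G a x) - ∫ x in (-R)..R, onLine G b x)
      atTop (𝓝 ((∫ x, onLine G a x) - ∫ x, onLine G b x)) :=
    (intervalIntegral_tendsto_integral hia tendsto_neg_atTop_atBot tendsto_id).sub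
      (intervalIntegral_tendsto_integral hib tendsto_neg_atTop_atBot tendsto_id)
  have key : ∀ R : ℝ, ‖(∫ x in (-R)..R, onLine G a x) - ∫ x in (-R)..R, onLine G b x‖ₑ ≤
      ∫⁻ y in Icc a b, t R y := by
    intro R
    have h := Complex.integral_boundary_rect_eq_zero_of_continuousOn_of_differentiableOn G
      (((-R : ℝ) : ℂ) + (a : ℂ) * Complex.I) ((R : ℂ) + (b : ℂ) * Complex.I)
      (hc.mono (by intro z hz; simpa [uIcc_of_le hab] using hz.2))
      (hd.mono (by intro z hz; simpa [hab] using hz.2))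
    simp only [Complex.add_re, Complex.ofReal_re, Complex.mul_re, Complex.I_re, mul_zero,
      Complex.ofReal_im, Complex.I_im, mul_one, sub_self, add_zero, Complex.add_im,
      Complex.mul_im, zero_add] at h
    have h' : (∫ x in (-R)..R, onLine G a x) - ∫ x in (-R)..R, onLine G b x =
        Complex.I • (∫ y in a..b, onLine G y (-R)) - Complex.I • (∫ y in a..b, onLine G y R) := by
      simp only [onLine_apply]
      linear_combination h
    have hy : ∀ R : ℝ, ContinuousOn (fun y => onLine G y R) (Icc a b) := by
      intro R
      refine hc.comp (f := fun y : ℝ => (R : ℂ) + (y : ℂ) * Complex.I) (by fun_prop) ?_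
      intro y hy
      simpa using hy
    have hs : ∀ R : ℝ, ‖Complex.I • (∫ y in a..b, onLine G y R)‖ₑ ≤
        ∫⁻ y in Icc a b, ‖onLine G y R‖ₑ := by
      intro R
      rw [enorm_smul, intervalIntegral.integral_of_le hab, ← restrict_Ioc_eq_restrict_Icc]
      simpa [← ofReal_norm] using
        enorm_integral_le_lintegral_enorm (μ := volume.restrict (Ioc a b)) (fun y => onLine G y R)
    rw [h']
    refine (enorm_sub_le).trans ?_
    simp only [ht]
    rw [lintegral_add_left' ((hy R).aemeasurable measurableSet_Icc).enorm, add_comm]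
    exact add_le_add (hs R) (hs (-R))
  by_contra hne
  have hpos : 0 < ‖(∫ x, onLine G a x) - ∫ x, onLine G b x‖ₑ := by
    rw [enorm_pos]
    exact sub_ne_zero.2 hne
  obtain ⟨δ, hδ0, hδ⟩ := exists_between hpos
  have hev := hlim.enorm.eventually (lt_mem_nhds hδ)
  obtain ⟨R, h1, h2⟩ := ((frequently_lintegral_lt htop hδ0).and_eventually hev).exists
  exact absurd (lt_of_lt_of_le h2 (key R)) (not_lt.2 h1.le)

/-! ### The Poisson kernel of the strip -/

theorem integrable_exp_neg_mul_abs {a : ℝ} (ha : 0 < a) :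
    Integrable (fun x : ℝ => Real.exp (-a * |x|)) := by
  have h1 : IntegrableOn (fun x : ℝ => Real.exp (-a * |x|)) (Ioi 0) := by
    refine (integrableOn_exp_mul_Ioi (neg_lt_zero.2 ha) 0).congr_fun (fun x hx => ?_)
      measurableSet_Ioi
    simp only [abs_of_pos (mem_Ioi.1 hx)]
  have h2 : IntegrableOn (fun x : ℝ => Real.exp (-a * |x|)) (Iic 0) := by
    refine (integrableOn_exp_mul_Iic ha 0).congr_fun (fun x hx => ?_) measurableSet_Iic
    simp only [abs_of_nonpos (mem_Iic.1 hx)]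
    ring_nf
  simpa using (h2.union h1)

theorem memLp_two_exp_neg_mul_abs {a : ℝ} (ha : 0 < a) :
    MemLp (fun x : ℝ => Real.exp (-a * |x|)) 2 := by
  rw [memLp_two_iff_integrable_sq (by fun_prop)]
  refine (integrable_exp_neg_mul_abs (mul_pos two_pos ha)).congr (Eventually.of_forall fun x => ?_)
  simp only [← Real.exp_nat_mul]
  congr 1; push_cast; ring

/-- The density of the harmonic measure of the strip on the line at distance `1 - θ`. -/
noncomputable def stripDensity (θ x : ℝ) : ℝ :=
  Real.sin (Real.pi * θ) / 2 / (Real.cosh (Real.pi * x) + Real.cos (Real.pi * θ))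

/-- The Cauchy kernel of the strip `-1 < Im z < 0` with pole at `-iθ`. -/
noncomputable def stripKernel (θ : ℝ) (z : ℂ) : ℂ :=
  Real.sin (Real.pi * θ) / 2 / (Complex.cosh (Real.pi * z) - Real.cos (Real.pi * θ))

/-! ### Mass and decay of the harmonic density -/

section Density

variable {θ : ℝ}

theorem sin_pi_mul_pos (hθ : θ ∈ Ioo (0 : ℝ) 1) : 0 < Real.sin (Real.pi * θ) :=
  Real.sin_pos_of_pos_of_lt_pi (mul_pos Real.pi_pos hθ.1)
    (by nlinarith [Real.pi_pos, hθ.2])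

theorem abs_cos_pi_mul_lt_one (hθ : θ ∈ Ioo (0 : ℝ) 1) : |Real.cos (Real.pi * θ)| < 1 := by
  rw [← sq_lt_one_iff_abs_lt_one]
  nlinarith [Real.sin_sq_add_cos_sq (Real.pi * θ), sin_pi_mul_pos hθ]

theorem one_sub_mem_Ioo (hθ : θ ∈ Ioo (0 : ℝ) 1) : 1 - θ ∈ Ioo (0 : ℝ) 1 :=
  ⟨by linarith [hθ.2], by linarith [hθ.1]⟩

theorem cosh_add_cos_pos (hθ : θ ∈ Ioo (0 : ℝ) 1) (x : ℝ) :
    0 < Real.cosh (Real.pi * x) + Real.cos (Real.pi * θ) := by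
  have := (abs_lt.1 (abs_cos_pi_mul_lt_one hθ)).1
  linarith [Real.one_le_cosh (Real.pi * x)]

theorem stripDensity_pos (hθ : θ ∈ Ioo (0 : ℝ) 1) (x : ℝ) : 0 < stripDensity θ x :=
  div_pos (half_pos (sin_pi_mul_pos hθ)) (cosh_add_cos_pos hθ x)

theorem continuous_stripDensity (hθ : θ ∈ Ioo (0 : ℝ) 1) : Continuous (stripDensity θ) := by
  unfold stripDensity
  refine Continuous.div (by fun_prop) (by fun_prop) fun x => (cosh_add_cos_pos hθ x).ne'

theorem exp_abs_le_two_mul_cosh (x : ℝ) : Real.exp |x| ≤ 2 * Real.cosh x := by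
  rw [← Real.cosh_abs, Real.cosh_eq]
  linarith [Real.exp_pos (-|x|)]

theorem stripDensity_le (hθ : θ ∈ Ioo (0 : ℝ) 1) :
    ∃ C : ℝ, 0 < C ∧ ∀ x, stripDensity θ x ≤ C * Real.exp (-Real.pi * |x|) := by
  have hc := abs_cos_pi_mul_lt_one hθ
  have hs := sin_pi_mul_pos hθ
  set c := |Real.cos (Real.pi * θ)| with hcdef
  refine ⟨Real.sin (Real.pi * θ) / (1 - c), div_pos hs (by linarith), fun x => ?_⟩
  have h1 : (1 - c) * Real.exp (Real.pi * |x|) / 2 ≤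
      Real.cosh (Real.pi * x) + Real.cos (Real.pi * θ) := by
    have e := exp_abs_le_two_mul_cosh (Real.pi * x)
    rw [abs_mul, abs_of_pos Real.pi_pos] at e
    have := neg_abs_le (Real.cos (Real.pi * θ))
    nlinarith [Real.one_le_cosh (Real.pi * x), abs_nonneg (Real.cos (Real.pi * θ))]
  have h2 : 0 < (1 - c) * Real.exp (Real.pi * |x|) / 2 := by
    have := Real.exp_pos (Real.pi * |x|)
    have : 0 < 1 - c := by linarith
    positivity
  unfold stripDensity
  calc _ ≤ Real.sin (Real.pi * θ) / 2 / ((1 - c) * Real.exp (Real.pi * |x|) / 2) := by gcongr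
    _ = _ := by
      rw [neg_mul, Real.exp_neg]
      have : 1 - c ≠ 0 := by linarith
      field_simp

theorem integrable_stripDensity (hθ : θ ∈ Ioo (0 : ℝ) 1) : Integrable (stripDensity θ) := by
  obtain ⟨C, _, hC⟩ := stripDensity_le hθ
  refine ((integrable_exp_neg_mul_abs Real.pi_pos).const_mul C).mono'
    (continuous_stripDensity hθ).aestronglyMeasurable (Eventually.of_forall fun x => ?_)
  rw [Real.norm_of_nonneg (stripDensity_pos hθ x).le]
  exact hC x

/-- A primitive is arctan((e^{πx} + cos πθ)/sin πθ)/π. It tends to 1/2 at +∞ and to 1/2 − θ at −∞,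
the latter because arctan(cot πθ) = π/2 − πθ for 0 < θ < 1. -/
theorem integral_stripDensity (hθ : θ ∈ Ioo (0 : ℝ) 1) : ∫ x, stripDensity θ x = θ := by
  have hs := sin_pi_mul_pos hθ
  set s := Real.sin (Real.pi * θ) with hsdef
  set c := Real.cos (Real.pi * θ) with hcdef
  have hsc : s ^ 2 + c ^ 2 = 1 := Real.sin_sq_add_cos_sq _
  have hderiv : ∀ x, HasDerivAt
      (fun x => 1 / Real.pi * Real.arctan ((Real.exp (Real.pi * x) + c) / s))
      (stripDensity θ x) x := by
    intro x
    have h1 : HasDerivAt (fun x => (Real.exp (Real.pi * x) + c) / s)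
        (Real.exp (Real.pi * x) * (Real.pi * 1) / s) x :=
      ((((hasDerivAt_id x).const_mul Real.pi).exp).add_const c).div_const s
    have h2 := h1.arctan.const_mul (1 / Real.pi)
    refine h2.congr_deriv (Eq.symm ?_)
    have hD := cosh_add_cos_pos hθ x
    rw [Real.cosh_eq, ← hcdef] at hD
    have hE := Real.exp_pos (Real.pi * x)
    have hq : 0 < 1 + ((Real.exp (Real.pi * x) + c) / s) ^ 2 := by positivity
    unfold stripDensity
    rw [Real.cosh_eq, ← hsdef, ← hcdef]
    rw [Real.exp_neg] at hD ⊢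
    set E := Real.exp (Real.pi * x)
    have hq' : s ^ 2 + (E + c) ^ 2 ≠ 0 := by positivity
    have hD' : E ^ 2 + 1 + 2 * c * E ≠ 0 := by
      have : E ^ 2 + 1 + 2 * c * E = ((E + E⁻¹) / 2 + c) * (2 * E) := by field_simp
      rw [this]; positivity
    have hpi := Real.pi_ne_zero
    have hsne := hs.ne'
    field_simp
    rw [div_eq_one_iff_eq (by convert hD' using 1; ring)]
    linear_combination hsc
  have htop : Tendsto (fun x => 1 / Real.pi * Real.arctan ((Real.exp (Real.pi * x) + c) / s))
      atTop (𝓝 (1 / Real.pi * (Real.pi / 2))) := by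
    refine Tendsto.const_mul _ ((tendsto_nhds_of_tendsto_nhdsWithin Real.tendsto_arctan_atTop).comp ?_)
    refine Tendsto.atTop_div_const hs (tendsto_atTop_add_const_right _ _ ?_)
    exact Real.tendsto_exp_atTop.comp (tendsto_id.const_mul_atTop Real.pi_pos)
  have hbot : Tendsto (fun x => 1 / Real.pi * Real.arctan ((Real.exp (Real.pi * x) + c) / s))
      atBot (𝓝 (1 / Real.pi * (Real.pi / 2 - Real.pi * θ))) := by
    have e : Real.pi / 2 - Real.pi * θ = Real.arctan ((0 + c) / s) := by
      rw [zero_add, hcdef, hsdef, ← inv_div (Real.sin _), ← Real.tan_eq_sin_div_cos, ← Real.tan_pi_div_two_sub,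
        Real.arctan_tan]
      · nlinarith [Real.pi_pos, hθ.2]
      · nlinarith [Real.pi_pos, hθ.1]
    rw [e]
    refine Tendsto.const_mul _ ((Real.continuous_arctan.tendsto _).comp ?_)
    refine Tendsto.div_const (Tendsto.add_const _ ?_) _
    exact Real.tendsto_exp_atBot.comp (tendsto_id.const_mul_atBot Real.pi_pos)
  rw [integral_of_hasDerivAt_of_tendsto hderiv (integrable_stripDensity hθ) hbot htop]
  have := Real.pi_ne_zero
  field_simp
  ring

end Density

/-! ### Pole, decay and residue of the Cauchy kernel -/

section Kernel

variable {θ : ℝ}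

theorem cosh_ofReal_add_neg_one_mul_I (x : ℝ) :
    Complex.cosh (Real.pi * (x + ((-1 : ℝ) : ℂ) * Complex.I)) = -Real.cosh (Real.pi * x) := by
  have : (Real.pi * (x + ((-1 : ℝ) : ℂ) * Complex.I) : ℂ) =
      (Real.pi * x : ℂ) - Real.pi * Complex.I := by push_cast; ring
  rw [this, Complex.cosh_sub, Complex.cosh_mul_I, Complex.sinh_mul_I]
  simp

theorem stripKernel_onLine_zero (x : ℝ) :
    onLine (stripKernel θ) 0 x = stripDensity (1 - θ) x := by
  have h1 : Real.pi * (1 - θ) = Real.pi - Real.pi * θ := by ring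
  simp only [onLine_apply, stripKernel, stripDensity, h1, Real.sin_pi_sub, Real.cos_pi_sub]
  push_cast
  simp [sub_eq_add_neg]

theorem stripKernel_onLine_neg_one (x : ℝ) :
    onLine (stripKernel θ) (-1) x = -stripDensity θ x := by
  simp only [onLine_apply, stripKernel, stripDensity, cosh_ofReal_add_neg_one_mul_I]
  push_cast
  rw [← div_neg]
  congr 1
  ring

/-- The equation cosh πz = cos πθ forces z = i(2k ± θ) with k an integer, and of these points only
−iθ has imaginary part in [−1, 0]. -/
theorem cosh_sub_cos_ne_zero (hθ : θ ∈ Ioo (0 : ℝ) 1) {z : ℂ} (hz : z.im ∈ Icc (-1 : ℝ) 0)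
    (hne : z ≠ -θ * Complex.I) :
    Complex.cosh (Real.pi * z) - Real.cos (Real.pi * θ) ≠ 0 := by
  intro h
  rw [sub_eq_zero, ← Complex.cos_mul_I, Complex.ofReal_cos, Complex.cos_eq_cos_iff] at h
  obtain ⟨k, h | h⟩ := h
  · have h' : (θ : ℂ) = 2 * k + z * Complex.I := by
      have : (Real.pi : ℂ) ≠ 0 := by exact_mod_cast Real.pi_ne_zero
      apply mul_left_cancel₀ this
      push_cast at h
      linear_combination h
    have hr := congrArg Complex.re h'
    have hi := congrArg Complex.im h'
    simp at hr hi
    have hk : k = 0 := by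
      have h1 : (k : ℝ) < 1 := by linarith [hz.1, hz.2, hθ.1, hθ.2]
      have h2 : (-1 : ℝ) < k := by linarith [hz.1, hz.2, hθ.1, hθ.2]
      have h1' : k < 1 := by exact_mod_cast h1
      have h2' : -1 < k := by exact_mod_cast h2
      omega
    subst hk
    apply hne
    apply Complex.ext <;> simp <;> [exact hi.symm; skip]
    push_cast at hr
    linarith
  · have h' : (θ : ℂ) = 2 * k - z * Complex.I := by
      have : (Real.pi : ℂ) ≠ 0 := by exact_mod_cast Real.pi_ne_zero
      apply mul_left_cancel₀ this
      push_cast at h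
      linear_combination h
    have hr := congrArg Complex.re h'
    simp at hr
    have h1 : (k : ℝ) < 1 := by linarith [hz.1, hz.2, hθ.1, hθ.2]
    have h2 : (0 : ℝ) < k := by linarith [hz.1, hz.2, hθ.1, hθ.2]
    have h1' : k < 1 := by exact_mod_cast h1
    have h2' : 0 < k := by exact_mod_cast h2
    omega

theorem sinh_abs_le_norm_cosh (z : ℂ) : Real.sinh |z.re| ≤ ‖Complex.cosh z‖ := by
  have h : ∀ z : ℂ, Real.sinh z.re ≤ ‖Complex.cosh z‖ := by
    intro z
    rw [Real.sinh_eq, Complex.cosh, norm_div]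
    have := norm_sub_norm_le (Complex.exp z) (-Complex.exp (-z))
    rw [sub_neg_eq_add, norm_neg, Complex.norm_exp, Complex.norm_exp, Complex.neg_re] at this
    simp only [Complex.norm_ofNat]
    gcongr
  rcases abs_cases z.re with ⟨h1, _⟩ | ⟨h1, _⟩
  · rw [h1]; exact h z
  · rw [h1, ← Complex.neg_re, ← Complex.cosh_neg]; exact h (-z)

theorem norm_stripKernel_le (hθ : θ ∈ Ioo (0 : ℝ) 1) {z : ℂ} (hz : 1 < |z.re|) :
    ‖stripKernel θ z‖ ≤ 2 * Real.exp (-Real.pi * |z.re|) := by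
  have h1 := sinh_abs_le_norm_cosh (Real.pi * z)
  rw [Complex.re_ofReal_mul, abs_mul, abs_of_pos Real.pi_pos] at h1
  set E := Real.exp (Real.pi * |z.re|) with hE
  -- Any bound E ≥ 6 suffices for (E − 1)/2 − 1 ≥ E/4, which is the estimate of the denominator
  -- below.
  have hE8 : 8 ≤ E := by
    have a1 : Real.exp 3 ≤ E := Real.exp_le_exp.2 (by nlinarith [Real.pi_gt_three])
    have a2 : (3 : ℝ) = 1 + 1 + 1 := by norm_num
    rw [a2, Real.exp_add, Real.exp_add] at a1
    have := Real.exp_one_gt_d9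
    nlinarith
  have hEinv : Real.exp (-(Real.pi * |z.re|)) = E⁻¹ := by rw [Real.exp_neg]
  have hE0 : 0 < E := by linarith
  have hEi : E⁻¹ ≤ 1 := inv_le_one_of_one_le₀ (by linarith)
  rw [Real.sinh_eq, ← hE, hEinv] at h1
  have h2 : E / 4 ≤ ‖Complex.cosh (Real.pi * z) - Real.cos (Real.pi * θ)‖ := by
    have := norm_sub_norm_le (Complex.cosh (Real.pi * z)) (Real.cos (Real.pi * θ) : ℂ)
    rw [Complex.norm_real, Real.norm_eq_abs] at this
    have := abs_cos_pi_mul_lt_one hθ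
    linarith
  have hs := sin_pi_mul_pos hθ
  rw [neg_mul, hEinv, stripKernel, norm_div, norm_div, Complex.norm_real,
    Real.norm_of_nonneg hs.le, Complex.norm_ofNat]
  calc _ ≤ 1 / 2 / (E / 4) := by gcongr; exact Real.sin_le_one _
    _ = _ := by field_simp; norm_num

theorem lintegral_tail_le {f : ℝ → ℂ} {g : ℝ → ℝ}
    (h : ∀ x, 1 < |x| → ‖f x‖ ≤ g x) :
    ∫⁻ x in {x : ℝ | 1 < |x|}, ‖f x‖ₑ ≤ ∫⁻ x, ‖g x‖ₑ := by
  refine (setLIntegral_mono_ae' ?_ (g := fun x => ‖g x‖ₑ)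
    (Eventually.of_forall fun x hx => ?_)).trans (setLIntegral_le_lintegral _ _)
  · exact measurableSet_lt measurable_const (by fun_prop)
  · rw [enorm_le_iff_norm_le]
    exact (h x hx).trans (le_abs_self _)

theorem continuousOn_stripKernel (hθ : θ ∈ Ioo (0 : ℝ) 1) {s : Set ℂ}
    (hs : s ⊆ {z | z.im ∈ Icc (-1 : ℝ) 0}) (hw : -θ * Complex.I ∉ s) :
    ContinuousOn (stripKernel θ) s := by
  unfold stripKernel
  refine ContinuousOn.div (by fun_prop) (by fun_prop) fun z hz => ?_
  exact cosh_sub_cos_ne_zero hθ (hs hz) (by rintro rfl; exact hw hz)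

theorem differentiableOn_stripKernel (hθ : θ ∈ Ioo (0 : ℝ) 1) {s : Set ℂ}
    (hs : s ⊆ {z | z.im ∈ Icc (-1 : ℝ) 0}) (hw : -θ * Complex.I ∉ s) :
    DifferentiableOn ℂ (stripKernel θ) s := by
  unfold stripKernel
  refine DifferentiableOn.div (by fun_prop) (by fun_prop) fun z hz => ?_
  exact cosh_sub_cos_ne_zero hθ (hs hz) (by rintro rfl; exact hw hz)

theorem lintegral_exp_neg_pi_ne_top :
    ∫⁻ x : ℝ, ‖2 * Real.exp (-Real.pi * |x|)‖ₑ ≠ ∞ :=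
  ((integrable_exp_neg_mul_abs Real.pi_pos).const_mul 2).2.ne

theorem lintegral_stripKernel_tail_le (hθ : θ ∈ Ioo (0 : ℝ) 1) (y : ℝ) :
    ∫⁻ x in {x : ℝ | 1 < |x|}, ‖onLine (stripKernel θ) y x‖ₑ ≤
      ∫⁻ x : ℝ, ‖2 * Real.exp (-Real.pi * |x|)‖ₑ := by
  refine lintegral_tail_le fun x hx => ?_
  have := norm_stripKernel_le (z := x + y * Complex.I) hθ (by simpa using hx)
  simpa [onLine_apply] using this

theorem integrable_stripKernel (hθ : θ ∈ Ioo (0 : ℝ) 1) {y : ℝ} (hy : y ∈ Icc (-1 : ℝ) 0)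
    (hne : y ≠ -θ) : Integrable (onLine (stripKernel θ) y) := by
  refine integrable_of_lintegral_tail ?_ lintegral_exp_neg_pi_ne_top
    (lintegral_stripKernel_tail_le hθ y)
  refine continuous_onLine (s := {y}) (continuousOn_stripKernel hθ ?_ ?_) rfl
  · intro z hz
    have : z.im = y := hz
    simpa [this] using hy
  · simpa using hne.symm

/-- Above the pole the contour can be moved up to ℝ, where the kernel is the density for 1 − θ.
Below the pole it moves down to ℝ − i, where the kernel is minus the density for θ. The jump across
the pole is therefore 1. -/
theorem integral_stripKernel_of_gt (hθ : θ ∈ Ioo (0 : ℝ) 1) {b : ℝ} (h1 : -θ < b) (h2 : b ≤ 0) :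
    ∫ x, onLine (stripKernel θ) b x = 1 - θ := by
  rw [integral_onLine_eq_of_differentiableOn h2 _ _ lintegral_exp_neg_pi_ne_top
    (fun y _ => lintegral_stripKernel_tail_le hθ y)]
  · simp_rw [stripKernel_onLine_zero]
    rw [integral_complex_ofReal, integral_stripDensity (one_sub_mem_Ioo hθ)]
    push_cast; rfl
  · refine continuousOn_stripKernel hθ ?_ ?_
    · intro z hz; exact ⟨by linarith [hz.1, hθ.2], hz.2⟩
    · simp; intro h; linarith
  · refine differentiableOn_stripKernel hθ ?_ ?_
    · intro z hz; exact ⟨by linarith [hz.1, hθ.2], hz.2.le⟩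
    · simp; intro h; linarith

theorem integral_stripKernel_of_lt (hθ : θ ∈ Ioo (0 : ℝ) 1) {a : ℝ} (h1 : -1 ≤ a) (h2 : a < -θ) :
    ∫ x, onLine (stripKernel θ) a x = -θ := by
  rw [← integral_onLine_eq_of_differentiableOn h1 _ _ lintegral_exp_neg_pi_ne_top
    (fun y _ => lintegral_stripKernel_tail_le hθ y)]
  · simp_rw [stripKernel_onLine_neg_one]
    rw [integral_neg, integral_complex_ofReal, integral_stripDensity hθ]
  · refine continuousOn_stripKernel hθ ?_ ?_
    · intro z hz; exact ⟨hz.1, by linarith [hz.2, hθ.1]⟩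
    · simp; intro h; linarith
  · refine differentiableOn_stripKernel hθ ?_ ?_
    · intro z hz; exact ⟨hz.1.le, by linarith [hz.2, hθ.1]⟩
    · simp; intro h; linarith

/-- The residue theorem for the Cauchy kernel of the strip. -/
theorem integral_mul_stripKernel (hθ : θ ∈ Ioo (0 : ℝ) 1) {Φ : ℂ → ℂ} {a b : ℝ}
    (ha : -1 ≤ a) (haθ : a < -θ) (hbθ : -θ < b) (hb : b ≤ 0)
    (hc : ContinuousOn Φ {z | z.im ∈ Icc a b}) (hd : DifferentiableOn ℂ Φ {z | z.im ∈ Ioo a b})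
    {M : ℝ≥0∞} (hM : M ≠ ∞)
    (hbd : ∀ y ∈ Icc a b, ∫⁻ x in {x : ℝ | 1 < |x|},
      ‖onLine (fun z => Φ z * stripKernel θ z) y x‖ₑ ≤ M) :
    (∫ x, onLine (fun z => Φ z * stripKernel θ z) b x) -
      ∫ x, onLine (fun z => Φ z * stripKernel θ z) a x = Φ (-θ * Complex.I) := by
  set w : ℂ := -θ * Complex.I with hw
  have hwim : w.im = -θ := by simp [hw]
  set q : ℂ → ℂ := fun z => Complex.cosh (Real.pi * z) with hq
  have hqw : q w = Real.cos (Real.pi * θ) := by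
    simp only [hq, hw]
    rw [show (Real.pi * (-θ * Complex.I) : ℂ) = (-(Real.pi * θ) : ℂ) * Complex.I by ring,
      Complex.cosh_mul_I, Complex.cos_neg]
    push_cast; rfl
  have hqd : HasDerivAt q (Complex.sinh (Real.pi * w) * (Real.pi * 1)) w :=
    ((hasDerivAt_id w).const_mul (Real.pi : ℂ)).ccosh
  have hq' : deriv q w ≠ 0 := by
    rw [hqd.deriv, hw, show (Real.pi * (-θ * Complex.I) : ℂ) = (-(Real.pi * θ) : ℂ) * Complex.I by ring,
      Complex.sinh_mul_I, Complex.sin_neg]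
    have := (sin_pi_mul_pos hθ).ne'
    have h1 : Complex.sin (Real.pi * θ) ≠ 0 := by exact_mod_cast this
    have h2 : (Real.pi : ℂ) ≠ 0 := by exact_mod_cast Real.pi_ne_zero
    simp [h1, h2]
  have hopen : IsOpen {z : ℂ | z.im ∈ Ioo a b} := isOpen_Ioo.preimage Complex.continuous_im
  have hwI : w ∈ {z : ℂ | z.im ∈ Ioo a b} := by simp [hwim, haθ, hbθ]
  have hnhds : {z : ℂ | z.im ∈ Ioo a b} ∈ 𝓝 w := hopen.mem_nhds hwI
  have hsub : {z : ℂ | z.im ∈ Ioo a b} ⊆ {z : ℂ | z.im ∈ Icc a b} := fun z hz => ⟨hz.1.le, hz.2.le⟩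
  have hnhds' : {z : ℂ | z.im ∈ Icc a b} ∈ 𝓝 w := mem_of_superset hnhds hsub
  -- Quotient of two `dslope`s: it extends (Φ − Φ(w)) times the kernel holomorphically across w, so
  -- its integrals along the two lines agree. The constant Φ(w) is left to contribute with the
  -- factor (1 − θ) − (−θ) = 1.
  set Ψ : ℂ → ℂ := fun z => Real.sin (Real.pi * θ) / 2 * (dslope Φ w z / dslope q w z) with hΨ
  have hΨeq : ∀ z, z ≠ w → Ψ z = (Φ z - Φ w) * stripKernel θ z := by
    intro z hz
    have h1 : z - w ≠ 0 := sub_ne_zero.2 hz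
    simp only [hΨ, stripKernel]
    rw [dslope_of_ne _ hz, dslope_of_ne _ hz, slope_def_field, slope_def_field, hqw,
      div_div_div_cancel_right₀ h1]
    ring
  have hqne : ∀ z : ℂ, z.im ∈ Icc a b → dslope q w z ≠ 0 := by
    intro z hz
    by_cases h : z = w
    · rw [h, dslope_same]; exact hq'
    · rw [dslope_of_ne _ h, slope_def_field, hqw]
      exact div_ne_zero (cosh_sub_cos_ne_zero hθ ⟨ha.trans hz.1, hz.2.trans hb⟩ h)
        (sub_ne_zero.2 h)
  have hqdiff : Differentiable ℂ q := by simp only [hq]; fun_prop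
  have hΨc : ContinuousOn Ψ {z | z.im ∈ Icc a b} := by
    refine continuousOn_const.mul (ContinuousOn.div ?_ ?_ fun z hz => hqne z hz)
    · exact (continuousOn_dslope hnhds').2 ⟨hc, hd.differentiableAt hnhds⟩
    · exact (continuousOn_dslope hnhds').2 ⟨hqdiff.continuous.continuousOn, hqdiff w⟩
  have hΨd : DifferentiableOn ℂ Ψ {z | z.im ∈ Ioo a b} := by
    refine (DifferentiableOn.div ?_ ?_ fun z hz => hqne z (hsub hz)).const_mul _
    · exact (Complex.differentiableOn_dslope hnhds).2 hd
    · exact (Complex.differentiableOn_dslope hnhds).2 hqdiff.differentiableOn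
  have hmeas : MeasurableSet {x : ℝ | 1 < |x|} :=
    measurableSet_lt measurable_const (by fun_prop)
  have hne : ∀ (x y : ℝ), x ≠ 0 ∨ y ≠ -θ → (x + y * Complex.I : ℂ) ≠ w := by
    intro x y h e
    have h1 := congrArg Complex.re e
    have h2 := congrArg Complex.im e
    simp [hw] at h1 h2
    tauto
  have hΨM : ∀ y ∈ Icc a b, ∫⁻ x in {x : ℝ | 1 < |x|}, ‖onLine Ψ y x‖ₑ ≤
      M + ‖Φ w‖ₑ * ∫⁻ x : ℝ, ‖2 * Real.exp (-Real.pi * |x|)‖ₑ := by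
    intro y hy
    have hcy : Continuous (fun x => ‖onLine Ψ y x‖ₑ) :=
      (continuous_onLine hΨc hy).enorm
    calc ∫⁻ x in {x : ℝ | 1 < |x|}, ‖onLine Ψ y x‖ₑ
        ≤ ∫⁻ x in {x : ℝ | 1 < |x|}, (‖onLine (fun z => Φ z * stripKernel θ z) y x‖ₑ +
          ‖Φ w‖ₑ * ‖onLine (stripKernel θ) y x‖ₑ) := by
          refine setLIntegral_mono_ae' hmeas (Eventually.of_forall fun x hx => ?_)
          have hx0 : x ≠ 0 := by
            rintro rfl
            simp at hx
            linarith
          rw [onLine_apply, hΨeq _ (hne x y (Or.inl hx0)), sub_mul, onLine_apply, onLine_apply,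
            ← enorm_mul]
          exact enorm_sub_le
      _ = (∫⁻ x in {x : ℝ | 1 < |x|}, ‖onLine (fun z => Φ z * stripKernel θ z) y x‖ₑ) +
          ‖Φ w‖ₑ * ∫⁻ x in {x : ℝ | 1 < |x|}, ‖onLine (stripKernel θ) y x‖ₑ := by
          have hm : AEMeasurable (fun x : ℝ => ‖onLine (stripKernel θ) y x‖ₑ)
              (volume.restrict {x : ℝ | 1 < |x|}) := by
            apply Measurable.aemeasurable
            unfold onLine stripKernel
            fun_prop
          rw [lintegral_add_right' _ (hm.const_mul _), lintegral_const_mul'' _ hm]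
      _ ≤ _ :=
          add_le_add (hbd y hy) (mul_le_mul_right (lintegral_stripKernel_tail_le hθ y) _)
  have hab : a ≤ b := by linarith
  have key := integral_onLine_eq_of_differentiableOn hab hΨc hΨd
    (ENNReal.add_ne_top.2 ⟨hM, ENNReal.mul_ne_top enorm_ne_top lintegral_exp_neg_pi_ne_top⟩) hΨM
  have hline : ∀ y ∈ Icc a b, y ≠ -θ →
      ∫ x, onLine Ψ y x = (∫ x, onLine (fun z => Φ z * stripKernel θ z) y x) -
        Φ w * ∫ x, onLine (stripKernel θ) y x := by
    intro y hy hyne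
    have hI : y ∈ Icc (-1 : ℝ) 0 := ⟨ha.trans hy.1, hy.2.trans hb⟩
    have hk := integrable_stripKernel hθ hI hyne
    have hΦk : Integrable (onLine (fun z => Φ z * stripKernel θ z) y) := by
      refine integrable_of_lintegral_tail ?_ hM (hbd y hy)
      refine continuous_onLine (s := {y}) (ContinuousOn.mul (hc.mono ?_)
        (continuousOn_stripKernel hθ ?_ ?_)) rfl
      · intro z hz
        have : z.im = y := hz
        simpa [this] using hy
      · intro z hz
        have : z.im = y := hz
        simpa [this] using hI
      · simpa using hyne.symm
    rw [← integral_const_mul, ← integral_sub hΦk (hk.const_mul _)]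
    congr 1; ext x
    rw [onLine_apply, hΨeq _ (hne x y (Or.inr hyne)), onLine_apply, onLine_apply]
    ring
  rw [hline a (left_mem_Icc.2 hab) haθ.ne, hline b (right_mem_Icc.2 hab) hbθ.ne',
    integral_stripKernel_of_gt hθ hbθ hb, integral_stripKernel_of_lt hθ ha haθ] at key
  linear_combination -key

end Kernel

/-! ### Primitives on star-shaped domains -/

/-- A holomorphic function on an open set that is star-shaped about `0` has a primitive. -/
theorem hasDerivAt_mul_integral_of_starConvex {U : Set ℂ} (hU : IsOpen U) (hs : StarConvex ℝ 0 U)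
    {f : ℂ → ℂ} (hf : DifferentiableOn ℂ f U) {z : ℂ} (hz : z ∈ U) :
    HasDerivAt (fun z => z * ∫ t in (0 : ℝ)..1, f (t * z)) (f z) z := by
  have hmul : ∀ z ∈ U, ∀ t : ℝ, t ∈ Icc (0 : ℝ) 1 → (t : ℂ) * z ∈ U := by
    intro z hz t ht
    have := hs hz (sub_nonneg.2 ht.2) ht.1 (by ring)
    simpa using this
  have hf' : ContinuousOn (deriv f) U := (hf.deriv hU).continuousOn
  obtain ⟨ε, hε, hball⟩ := Metric.nhds_basis_closedBall.mem_iff.1 (hU.mem_nhds hz)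
  set K : Set ℂ := (fun p : ℝ × ℂ => (p.1 : ℂ) * p.2) '' (Icc (0 : ℝ) 1 ×ˢ Metric.closedBall z ε)
    with hK
  have hKc : IsCompact K := (isCompact_Icc.prod (isCompact_closedBall z ε)).image (by fun_prop)
  have hKU : K ⊆ U := by
    rintro _ ⟨⟨t, u⟩, ⟨ht, hu⟩, rfl⟩
    exact hmul u (hball hu) t ht
  obtain ⟨C, hC⟩ := hKc.exists_bound_of_continuousOn (hf'.mono hKU)
  have hcont : ∀ u ∈ U, ContinuousOn (fun t : ℝ => f (t * u)) (Icc 0 1) := fun u hu =>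
    hf.continuousOn.comp (by fun_prop) (fun t ht => hmul u hu t ht)
  have hcont' : ∀ u ∈ U, ContinuousOn (fun t : ℝ => deriv f (t * u)) (Icc 0 1) := fun u hu =>
    hf'.comp (by fun_prop) (fun t ht => hmul u hu t ht)
  have hder : ∀ u ∈ U, ∀ t ∈ Icc (0 : ℝ) 1,
      HasDerivAt (fun u => f (t * u)) (t * deriv f (t * u)) u := by
    intro u hu t ht
    have h1 := (hf.differentiableAt (hU.mem_nhds (hmul u hu t ht))).hasDerivAt
    have h2 := h1.comp u ((hasDerivAt_id u).const_mul (t : ℂ))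
    simpa [Function.comp_def, mul_comm] using h2
  have main := (intervalIntegral.hasDerivAt_integral_of_dominated_loc_of_deriv_le
    (μ := volume) (F := fun (u : ℂ) (t : ℝ) => f (t * u))
    (F' := fun (u : ℂ) (t : ℝ) => t * deriv f (t * u)) (bound := fun _ => C)
    (a := 0) (b := 1) (x₀ := z) (s := Metric.ball z ε) (Metric.ball_mem_nhds z hε)
    ?_ ?_ ?_ ?_ ?_ ?_).2
  · have hmain := (hasDerivAt_id z).mul main
    refine hmain.congr_deriv ?_
    simp only [id, one_mul]
    have hcz : ContinuousOn (fun t : ℝ => (t : ℂ) * deriv f (t * z)) (Icc 0 1) :=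
      (by fun_prop : ContinuousOn (fun t : ℝ => (t : ℂ)) (Icc 0 1)).mul (hcont' z hz)
    have i1 : IntervalIntegrable (fun t : ℝ => f (t * z)) volume 0 1 :=
      (hcont z hz).intervalIntegrable_of_Icc zero_le_one
    have i2 : IntervalIntegrable (fun t : ℝ => z * ((t : ℂ) * deriv f (t * z))) volume 0 1 :=
      (hcz.const_mul z).intervalIntegrable_of_Icc zero_le_one
    rw [← intervalIntegral.integral_const_mul, ← intervalIntegral.integral_add i1 i2]
    -- The integrand f(tz) + z t f'(tz) is the t-derivative of t f(tz), so it integrates to f(z).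
    have hftc : ∀ t ∈ uIcc (0 : ℝ) 1, HasDerivAt (fun t : ℝ => (t : ℂ) * f (t * z))
        (f (t * z) + z * ((t : ℂ) * deriv f (t * z))) t := by
      intro t ht
      rw [uIcc_of_le zero_le_one] at ht
      have h1 := (hf.differentiableAt (hU.mem_nhds (hmul z hz t ht))).hasDerivAt
      have h3 : HasDerivAt (fun t : ℝ => (t : ℂ) * z) (1 * z) t :=
        (Complex.ofRealCLM.hasDerivAt (x := t)).mul_const z
      have h2 := h1.comp t h3
      have h4 := (Complex.ofRealCLM.hasDerivAt (x := t)).mul h2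
      refine h4.congr_deriv ?_
      simp
      ring
    rw [intervalIntegral.integral_eq_sub_of_hasDerivAt hftc (i1.add i2)]
    simp
  · filter_upwards [Metric.ball_mem_nhds z hε] with u hu
    rw [uIoc_of_le zero_le_one]
    exact ((hcont u (hball (Metric.ball_subset_closedBall hu))).mono
      Ioc_subset_Icc_self).aestronglyMeasurable measurableSet_Ioc
  · exact (hcont z hz).intervalIntegrable_of_Icc zero_le_one
  · rw [uIoc_of_le zero_le_one]
    exact (((by fun_prop : ContinuousOn (fun t : ℝ => (t : ℂ)) (Icc 0 1)).mul (hcont' z hz)).mono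
      Ioc_subset_Icc_self).aestronglyMeasurable measurableSet_Ioc
  · refine Eventually.of_forall fun t ht u hu => ?_
    rw [uIoc_of_le zero_le_one] at ht
    have h1 := hC (t * u) ⟨(t, u), ⟨Ioc_subset_Icc_self ht, Metric.ball_subset_closedBall hu⟩, rfl⟩
    rw [norm_mul, Complex.norm_real, Real.norm_of_nonneg ht.1.le]
    calc t * ‖deriv f (t * u)‖ ≤ 1 * ‖deriv f (t * u)‖ := by gcongr; exact ht.2
      _ ≤ C := by rwa [one_mul]
  · simp
  · refine Eventually.of_forall fun t ht u hu => ?_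
    rw [uIoc_of_le zero_le_one] at ht
    exact hder u (hball (Metric.ball_subset_closedBall hu)) t (Ioc_subset_Icc_self ht)

/-! ### The function `(πz/2) coth(πz/2)` -/

/-- The function `(πz/2) coth(πz/2)`, holomorphic for `|Im z| < 2`. -/
noncomputable def zCoth (z : ℂ) : ℂ :=
  Complex.cosh (Real.pi / 2 * z) / dslope Complex.sinh 0 (Real.pi / 2 * z)

theorem sinh_ne_zero_of_abs_im_lt {z : ℂ} (hz : |z.im| < 2) (h0 : z ≠ 0) :
    Complex.sinh (Real.pi / 2 * z) ≠ 0 := by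
  intro h
  have h1 : Complex.sin (Real.pi / 2 * z * Complex.I) = 0 := by
    rw [Complex.sin_mul_I, h, zero_mul]
  obtain ⟨k, hk⟩ := Complex.sin_eq_zero_iff.1 h1
  have hpi : (Real.pi : ℂ) ≠ 0 := by exact_mod_cast Real.pi_ne_zero
  have h2 : z * Complex.I = 2 * k := by
    apply mul_left_cancel₀ hpi
    linear_combination 2 * hk
  have hr := congrArg Complex.re h2
  have hi := congrArg Complex.im h2
  simp at hr hi
  rw [abs_lt] at hz
  have hk0 : k = 0 := by
    have a1 : (k : ℝ) < 1 := by linarith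
    have a2 : (-1 : ℝ) < k := by linarith
    have a1' : k < 1 := by exact_mod_cast a1
    have a2' : -1 < k := by exact_mod_cast a2
    omega
  subst hk0
  apply h0
  apply Complex.ext
  · simpa using hi
  · simpa using hr

theorem zCoth_eq {z : ℂ} (h0 : z ≠ 0) :
    zCoth z = Real.pi / 2 * z * (Complex.cosh (Real.pi / 2 * z) / Complex.sinh (Real.pi / 2 * z)) := by
  have hpi : (Real.pi : ℂ) ≠ 0 := by exact_mod_cast Real.pi_ne_zero
  have h : (Real.pi / 2 * z : ℂ) ≠ 0 := by simp [h0, hpi]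
  rw [zCoth, dslope_of_ne _ h, slope_def_field, Complex.sinh_zero, sub_zero, sub_zero,
    div_div_eq_mul_div]
  ring

theorem dslope_sinh_ne_zero {z : ℂ} (hz : |z.im| < 2) :
    dslope Complex.sinh 0 (Real.pi / 2 * z) ≠ 0 := by
  have hpi : (Real.pi : ℂ) ≠ 0 := by exact_mod_cast Real.pi_ne_zero
  by_cases h0 : z = 0
  · subst h0
    simp
  · have h : (Real.pi / 2 * z : ℂ) ≠ 0 := by simp [h0, hpi]
    rw [dslope_of_ne _ h, slope_def_field, Complex.sinh_zero, sub_zero, sub_zero]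
    exact div_ne_zero (sinh_ne_zero_of_abs_im_lt hz h0) h

theorem differentiableOn_zCoth : DifferentiableOn ℂ zCoth {z | |z.im| < 2} := by
  have h : Differentiable ℂ (dslope Complex.sinh 0) := by
    rw [← differentiableOn_univ]
    exact (Complex.differentiableOn_dslope univ_mem).2 Complex.differentiable_sinh.differentiableOn
  unfold zCoth
  refine DifferentiableOn.div (by fun_prop) ?_ fun z hz => dslope_sinh_ne_zero hz
  exact (h.comp (by fun_prop : Differentiable ℂ fun z : ℂ => (Real.pi / 2 * z : ℂ))).differentiableOn

theorem zCoth_conj (z : ℂ) : zCoth (conj z) = conj (zCoth z) := by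
  by_cases h0 : z = 0
  · subst h0; simp [zCoth]
  · have h0' : conj z ≠ 0 := by simpa using h0
    have e : (Real.pi / 2 * conj z : ℂ) = conj (Real.pi / 2 * z : ℂ) := by simp [map_ofNat]
    rw [zCoth_eq h0, zCoth_eq h0', e, Complex.cosh_conj, Complex.sinh_conj]
    simp

theorem zCoth_neg (z : ℂ) : zCoth (-z) = zCoth z := by
  by_cases h0 : z = 0
  · subst h0; simp
  · rw [zCoth_eq h0, zCoth_eq (neg_ne_zero.2 h0), mul_neg, Complex.cosh_neg, Complex.sinh_neg]
    rw [div_neg]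
    ring

/-- The factor coth(πz/2) has period 2i, so only the linear prefactor changes. This
quasi-periodicity makes the phase elementary on ℝ − i. -/
theorem zCoth_add_two_mul_I {z : ℂ} (h0 : z ≠ 0) (h2 : z + 2 * Complex.I ≠ 0) :
    zCoth (z + 2 * Complex.I) = zCoth z +
      Real.pi * Complex.I * (Complex.cosh (Real.pi / 2 * z) / Complex.sinh (Real.pi / 2 * z)) := by
  rw [zCoth_eq h0, zCoth_eq h2]
  have e : (Real.pi / 2 * (z + 2 * Complex.I) : ℂ) = Real.pi / 2 * z + Real.pi * Complex.I := by ring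
  rw [e, Complex.cosh_add, Complex.sinh_add, Complex.cosh_mul_I, Complex.sinh_mul_I]
  simp
  ring

/-- The difference is πz/(e^{πz} − 1), which is bounded on a compact set by continuity and small for
large Re z. It controls the extremal function at infinity. -/
theorem exists_norm_zCoth_sub_le {r : ℝ} (hr : r < 2) :
    ∃ C : ℝ, 0 ≤ C ∧ ∀ z : ℂ, 0 ≤ z.re → |z.im| ≤ r → ‖zCoth z - Real.pi / 2 * z‖ ≤ C := by
  have hcomp : IsCompact (Icc (0 : ℝ) 1 ×ℂ Icc (-r) r) := isCompact_Icc.reProdIm isCompact_Icc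
  have hcont : ContinuousOn (fun z => zCoth z - Real.pi / 2 * z) (Icc (0 : ℝ) 1 ×ℂ Icc (-r) r) := by
    refine ContinuousOn.sub (differentiableOn_zCoth.continuousOn.mono ?_) (by fun_prop)
    intro z hz
    exact lt_of_le_of_lt (abs_le.2 hz.2) hr
  obtain ⟨C, hC⟩ := hcomp.exists_bound_of_continuousOn hcont
  -- The 3 serves Re z > 1: there π|z| ≤ π(Re z + 2) ≤ 3π Re z, and π Re z ≤ |e^{πz} − 1|.
  refine ⟨max C 3, le_max_of_le_right (by norm_num), fun z hz hi => ?_⟩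
  by_cases h1 : z.re ≤ 1
  · exact (hC z ⟨⟨hz, h1⟩, abs_le.1 hi⟩).trans (le_max_left _ _)
  · push Not at h1
    refine le_trans ?_ (le_max_right _ _)
    have h0 : z ≠ 0 := by rintro rfl; simp at h1; linarith
    have hsinh := sinh_ne_zero_of_abs_im_lt (lt_of_le_of_lt hi hr) h0
    have hden : Complex.exp (Real.pi * z) - 1 ≠ 0 := by
      intro h
      apply hsinh
      have e : Complex.exp (Real.pi / 2 * z) * Complex.exp (Real.pi / 2 * z) = 1 := by
        rw [← Complex.exp_add, ← sub_eq_zero, ← h]; ring_nf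
      rw [Complex.sinh, Complex.exp_neg, ← eq_inv_of_mul_eq_one_left e, sub_self, zero_div]
    have key : zCoth z - Real.pi / 2 * z = Real.pi * z / (Complex.exp (Real.pi * z) - 1) := by
      rw [zCoth_eq h0, eq_div_iff hden]
      have e : Complex.exp (Real.pi * z) =
          (Complex.cosh (Real.pi / 2 * z) + Complex.sinh (Real.pi / 2 * z)) ^ 2 := by
        rw [Complex.cosh_add_sinh, ← Complex.exp_nat_mul]; congr 1; push_cast; ring
      have hcs := Complex.cosh_sq (Real.pi / 2 * z)
      rw [e]
      generalize Complex.cosh (Real.pi / 2 * z) = c at *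
      generalize Complex.sinh (Real.pi / 2 * z) = s at *
      field_simp
      linear_combination (c + s) * hcs
    rw [key, norm_div, norm_mul, Complex.norm_real, Real.norm_of_nonneg Real.pi_pos.le]
    have hz2 : ‖z‖ ≤ z.re + 2 := by
      have := Complex.norm_le_abs_re_add_abs_im z
      rw [abs_of_nonneg hz] at this
      linarith
    have hexp : Real.pi * z.re ≤ ‖Complex.exp (Real.pi * z) - 1‖ := by
      have := norm_sub_norm_le (Complex.exp (Real.pi * z)) 1
      rw [Complex.norm_exp, Complex.re_ofReal_mul, norm_one] at this
      linarith [Real.add_one_le_exp (Real.pi * z.re)]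
    have hp : 0 < Real.pi * z.re := mul_pos Real.pi_pos (by linarith)
    rw [div_le_iff₀ (lt_of_lt_of_le hp hexp)]
    calc Real.pi * ‖z‖ ≤ Real.pi * (z.re + 2) := by gcongr
      _ ≤ 3 * (Real.pi * z.re) := by nlinarith [Real.pi_pos]
      _ ≤ _ := by gcongr

/-- The odd primitive of `zCoth`. -/
noncomputable def zCothPrimitive (z : ℂ) : ℂ := z * ∫ t in (0 : ℝ)..1, zCoth (t * z)

theorem isOpen_abs_im_lt (r : ℝ) : IsOpen {z : ℂ | |z.im| < r} :=
  isOpen_lt (by fun_prop) continuous_const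

theorem hasDerivAt_zCothPrimitive {z : ℂ} (hz : |z.im| < 2) :
    HasDerivAt zCothPrimitive (zCoth z) z := by
  refine hasDerivAt_mul_integral_of_starConvex (isOpen_abs_im_lt 2) ?_ differentiableOn_zCoth hz
  intro u hu a b ha hb hab
  have hu' : |u.im| < 2 := hu
  have : |(a • (0 : ℂ) + b • u).im| ≤ |u.im| := by
    simp only [smul_zero, zero_add, Complex.smul_im, smul_eq_mul]
    rw [abs_mul, abs_of_nonneg hb]
    exact mul_le_of_le_one_left (abs_nonneg _) (by linarith)
  exact lt_of_le_of_lt this hu'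

theorem zCothPrimitive_conj (z : ℂ) : zCothPrimitive (conj z) = conj (zCothPrimitive z) := by
  simp only [zCothPrimitive, map_mul]
  congr 1
  rw [intervalIntegral.integral_of_le zero_le_one, intervalIntegral.integral_of_le zero_le_one,
    ← integral_conj]
  congr 1; ext t
  rw [← zCoth_conj]
  simp

theorem zCothPrimitive_neg (z : ℂ) : zCothPrimitive (-z) = -zCothPrimitive z := by
  simp only [zCothPrimitive, mul_neg, zCoth_neg, neg_mul]

/-! ### The extremal function -/

/-- The zero-free function `H` on `|Im z| < s` is extremal for the three lines problem: it has
modulus `1` on `ℝ`, and `|H|²` is the normalised density of harmonic measure on `ℝ - i`. -/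
structure IsExtremal (θ : ℝ) (H : ℂ → ℂ) (s C : ℝ) : Prop where
  one_lt : 1 < s
  C_pos : 0 < C
  diff : DifferentiableOn ℂ H {z | |z.im| < s}
  norm_onLine_zero : ∀ x : ℝ, ‖onLine H 0 x‖ = 1
  norm_onLine_neg_one : ∀ x : ℝ, ‖onLine H (-1) x‖ ^ 2 = stripDensity θ x / θ
  le : ∀ z : ℂ, |z.im| < s → ‖H z‖ ≤ C * Real.exp (Real.pi / 2 * z.im * |z.re|)
  ge : ∀ z : ℂ, |z.im| < s → Real.exp (Real.pi / 2 * z.im * |z.re|) ≤ C * ‖H z‖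

/-- Twice the argument of the extremal function. -/
noncomputable def extremalPhase (θ : ℝ) (z : ℂ) : ℂ :=
  zCothPrimitive (z - θ * Complex.I) + zCothPrimitive (z + θ * Complex.I)

/-! ### Growth and boundary moduli of the extremal function -/

section Extremal

variable {θ : ℝ}

theorem abs_im_sub_lt (hθ : θ ∈ Ioo (0 : ℝ) 1) {z : ℂ} {s : ℝ} (hz : |z.im| < s) :
    |(z - θ * Complex.I).im| < s + θ ∧ |(z + θ * Complex.I).im| < s + θ := by
  rw [abs_lt] at hz
  simp only [Complex.sub_im, Complex.add_im, Complex.mul_im, Complex.ofReal_re, Complex.I_im,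
    mul_one, Complex.ofReal_im, Complex.I_re, mul_zero, add_zero]
  have := hθ.1
  constructor <;> rw [abs_lt] <;> constructor <;> linarith

theorem hasDerivAt_extremalPhase (hθ : θ ∈ Ioo (0 : ℝ) 1) {z : ℂ} (hz : |z.im| < 2 - θ) :
    HasDerivAt (extremalPhase θ) (zCoth (z - θ * Complex.I) + zCoth (z + θ * Complex.I)) z := by
  have h := abs_im_sub_lt hθ hz
  rw [sub_add_cancel] at h
  have h1 := (hasDerivAt_zCothPrimitive h.1).comp z ((hasDerivAt_id z).sub_const (θ * Complex.I))
  have h2 := (hasDerivAt_zCothPrimitive h.2).comp z ((hasDerivAt_id z).add_const (θ * Complex.I))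
  have := h1.add h2
  simpa [extremalPhase, Function.comp_def] using! this

theorem extremalPhase_conj (z : ℂ) : extremalPhase θ (conj z) = conj (extremalPhase θ z) := by
  simp only [extremalPhase, map_add]
  rw [← zCothPrimitive_conj, ← zCothPrimitive_conj]
  simp [add_comm, sub_eq_add_neg]

theorem extremalPhase_neg (z : ℂ) : extremalPhase θ (-z) = -extremalPhase θ z := by
  simp only [extremalPhase]
  rw [neg_add, ← zCothPrimitive_neg, ← zCothPrimitive_neg, add_comm]
  congr 2 <;> ring

theorem extremalPhase_ofReal_im (x : ℝ) : (extremalPhase θ x).im = 0 := by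
  have := extremalPhase_conj (θ := θ) x
  rw [Complex.conj_ofReal] at this
  exact Complex.conj_eq_iff_im.1 this.symm

/-- On Re u ≥ 0 the primitive minus πu²/4 has bounded derivative. Comparing z with Re z, where the
phase is real, leaves Im (π/2)z² = π Re z Im z up to a bounded error. The symmetry z ↦ −conj z
covers the other half. -/
theorem exists_abs_extremalPhase_im_sub_le (hθ : θ ∈ Ioo (0 : ℝ) 1) {s : ℝ} (hs : s < 2 - θ) :
    ∃ C : ℝ, ∀ z : ℂ, |z.im| < s →
      |(extremalPhase θ z).im - Real.pi * z.im * (|z.re|)| ≤ C := by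
  obtain ⟨C, hC0, hC⟩ := exists_norm_zCoth_sub_le (r := s + θ) (by linarith)
  have hpos : ∀ z : ℂ, 0 ≤ z.re → |z.im| < s →
      |(extremalPhase θ z).im - Real.pi * z.im * z.re| ≤ 2 * (C * s) := by
    intro z hz0 hz
    set V : Set ℂ := {u | 0 ≤ u.re ∧ |u.im| < s + θ} with hV
    have hVc : Convex ℝ V := by
      have : V = {u : ℂ | 0 ≤ u.re} ∩ Complex.imLm ⁻¹' (Ioo (-(s + θ)) (s + θ)) := by
        ext u; simp [hV, abs_lt]
      rw [this]
      exact (convex_halfSpace_re_ge 0).inter ((convex_Ioo _ _).linear_preimage Complex.imLm)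
    have hder : ∀ u ∈ V, HasDerivWithinAt (fun u => zCothPrimitive u - Real.pi / 4 * u ^ 2)
        (zCoth u - Real.pi / 2 * u) V u := by
      intro u hu
      have h1 := hasDerivAt_zCothPrimitive (z := u) (hu.2.trans (by linarith))
      have h2 := ((hasDerivAt_id u).pow 2).const_mul (Real.pi / 4 : ℂ)
      refine ((h1.sub h2).congr_deriv ?_).hasDerivWithinAt
      simp
      ring
    have hmv : ∀ u ∈ V, ∀ v ∈ V, ‖(zCothPrimitive v - Real.pi / 4 * v ^ 2) -
        (zCothPrimitive u - Real.pi / 4 * u ^ 2)‖ ≤ C * ‖v - u‖ := fun u hu v hv =>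
      Convex.norm_image_sub_le_of_norm_hasDerivWithin_le hder
        (fun u hu => hC u hu.1 hu.2.le) hVc hu hv
    have hs0 : 0 < s := (abs_nonneg _).trans_lt hz
    have hx : |((z.re : ℂ)).im| < s := by simpa using hs0
    have a1 := abs_im_sub_lt hθ hz
    have a2 := abs_im_sub_lt hθ hx
    have b1 := hmv (z.re - θ * Complex.I) ⟨by simpa using hz0, a2.1⟩ (z - θ * Complex.I)
      ⟨by simpa using hz0, a1.1⟩
    have b2 := hmv (z.re + θ * Complex.I) ⟨by simpa using hz0, a2.2⟩ (z + θ * Complex.I)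
      ⟨by simpa using hz0, a1.2⟩
    have hnorm : ‖z - z.re‖ ≤ s := by
      have : z - z.re = z.im * Complex.I := by
        apply Complex.ext <;> simp
      rw [this]
      simpa using hz.le
    rw [sub_sub_sub_cancel_right] at b1
    rw [add_sub_add_right_eq_sub] at b2
    set D := ((zCothPrimitive (z - θ * Complex.I) - Real.pi / 4 * (z - θ * Complex.I) ^ 2) -
        (zCothPrimitive (z.re - θ * Complex.I) - Real.pi / 4 * (z.re - θ * Complex.I) ^ 2)) +
      ((zCothPrimitive (z + θ * Complex.I) - Real.pi / 4 * (z + θ * Complex.I) ^ 2) -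
        (zCothPrimitive (z.re + θ * Complex.I) - Real.pi / 4 * (z.re + θ * Complex.I) ^ 2)) with hD
    have hDn : ‖D‖ ≤ 2 * (C * s) := by
      refine (norm_add_le _ _).trans ?_
      have : C * ‖z - z.re‖ ≤ C * s := by gcongr
      linarith
    have hDeq : D = extremalPhase θ z - extremalPhase θ z.re -
        ((Real.pi / 2 : ℝ) : ℂ) * (z ^ 2 - (z.re : ℂ) ^ 2) := by
      rw [hD]
      simp only [extremalPhase]
      push_cast
      ring
    have hDim : D.im = (extremalPhase θ z).im - Real.pi * z.im * z.re := by
      rw [hDeq, Complex.sub_im, Complex.sub_im, extremalPhase_ofReal_im, Complex.im_ofReal_mul,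
        Complex.sub_im, ← Complex.ofReal_pow, Complex.ofReal_im, pow_two, Complex.mul_im]
      ring
    rw [← hDim]
    exact (Complex.abs_im_le_norm D).trans hDn
  refine ⟨2 * (C * s), fun z hz => ?_⟩
  rcases le_total 0 z.re with h | h
  · rw [abs_of_nonneg h]; exact hpos z h hz
  · have := hpos (-conj z) (by simpa using h) (by simpa using hz)
    rw [extremalPhase_neg, extremalPhase_conj] at this
    rw [abs_of_nonpos h]
    simpa using this

/-- The two arguments are u = x − i − iθ and the conjugate of u + 2i. Since `zCoth` commutes with
conjugation, the imaginary parts of zCoth(u) cancel and only the quasi-period term πi coth(πu/2)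
remains; here coth(πu/2) = tanh(π(x − iθ)/2). -/
theorem deriv_extremalPhase_im (hθ : θ ∈ Ioo (0 : ℝ) 1) (x : ℝ) :
    (zCoth (x + ((-1 : ℝ) : ℂ) * Complex.I - θ * Complex.I) +
      zCoth (x + ((-1 : ℝ) : ℂ) * Complex.I + θ * Complex.I)).im =
      -(Real.pi * Real.sinh (Real.pi * x) /
        (Real.cosh (Real.pi * x) + Real.cos (Real.pi * θ))) := by
  set u : ℂ := x + ((-1 : ℝ) : ℂ) * Complex.I - θ * Complex.I with hu
  have huim : u.im = -1 - θ := by simp [hu]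
  have e1 : (x + ((-1 : ℝ) : ℂ) * Complex.I + θ * Complex.I : ℂ) = conj (u + 2 * Complex.I) := by
    apply Complex.ext <;> simp [hu, map_ofNat]
    ring
  have h0 : u ≠ 0 := by
    intro h; rw [h] at huim; simp at huim; linarith [hθ.1]
  have h2 : u + 2 * Complex.I ≠ 0 := by
    intro h
    have := congrArg Complex.im h
    simp [huim] at this
    linarith [hθ.2]
  rw [e1, zCoth_conj, zCoth_add_two_mul_I h0 h2, Complex.add_im, Complex.conj_im, Complex.add_im]
  set v : ℂ := Real.pi / 2 * (x - θ * Complex.I) with hv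
  set v' : ℂ := Real.pi / 2 * (x + θ * Complex.I) with hv'
  have e2 : (Real.pi / 2 * u : ℂ) = v - Real.pi / 2 * Complex.I := by
    rw [hu, hv]; push_cast; ring
  have hcos : Complex.cosh (Real.pi / 2 * Complex.I) = 0 := by
    rw [Complex.cosh_mul_I]; exact Complex.cos_pi_div_two
  have hsin : Complex.sinh (Real.pi / 2 * Complex.I) = Complex.I := by
    rw [Complex.sinh_mul_I, Complex.sin_pi_div_two, one_mul]
  have e3 : Complex.cosh (Real.pi / 2 * u) / Complex.sinh (Real.pi / 2 * u) =
      Complex.sinh v / Complex.cosh v := by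
    rw [e2, Complex.cosh_sub, Complex.sinh_sub, hcos, hsin]
    have : Complex.I ≠ 0 := Complex.I_ne_zero
    simp only [mul_zero, zero_sub]
    rw [neg_div_neg_eq, mul_div_mul_right _ _ this]
  have hadd : v + v' = Real.pi * x := by rw [hv, hv']; ring
  have hsub : v - v' = (-(Real.pi * θ) : ℂ) * Complex.I := by rw [hv, hv']; ring
  have e4 : Complex.cosh v * Complex.cosh v' =
      ((Real.cosh (Real.pi * x) + Real.cos (Real.pi * θ) : ℝ) : ℂ) / 2 := by
    have a := Complex.cosh_add v v'
    have b := Complex.cosh_sub v v'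
    rw [hadd] at a
    rw [hsub, Complex.cosh_mul_I, Complex.cos_neg] at b
    push_cast
    linear_combination -a / 2 - b / 2
  have e5 : Complex.sinh v * Complex.cosh v' =
      (((Real.sinh (Real.pi * x) : ℝ) : ℂ) - (Real.sin (Real.pi * θ) : ℝ) * Complex.I) / 2 := by
    have a := Complex.sinh_add v v'
    have b := Complex.sinh_sub v v'
    rw [hadd] at a
    rw [hsub, Complex.sinh_mul_I, Complex.sin_neg] at b
    push_cast
    linear_combination -a / 2 - b / 2
  have hpos := cosh_add_cos_pos hθ x
  have hne : Complex.cosh v * Complex.cosh v' ≠ 0 := by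
    rw [e4]
    exact div_ne_zero (by exact_mod_cast hpos.ne') two_ne_zero
  have e6 : Complex.sinh v / Complex.cosh v =
      (((Real.sinh (Real.pi * x) : ℝ) : ℂ) - (Real.sin (Real.pi * θ) : ℝ) * Complex.I) /
        ((Real.cosh (Real.pi * x) + Real.cos (Real.pi * θ) : ℝ) : ℂ) := by
    rw [← mul_div_mul_right _ _ (right_ne_zero_of_mul hne), e4, e5,
      div_div_div_cancel_right₀ two_ne_zero]
  rw [e3, e6]
  have e7 : (Real.pi * Complex.I * ((((Real.sinh (Real.pi * x) : ℝ) : ℂ) -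
      (Real.sin (Real.pi * θ) : ℝ) * Complex.I) /
        ((Real.cosh (Real.pi * x) + Real.cos (Real.pi * θ) : ℝ) : ℂ))).im =
      Real.pi * Real.sinh (Real.pi * x) / (Real.cosh (Real.pi * x) + Real.cos (Real.pi * θ)) := by
    rw [← mul_div_assoc, Complex.div_ofReal_im]
    congr 1
    simp [-Complex.ofReal_sinh, -Complex.ofReal_sin]
  rw [e7]
  ring

/-- The derivative just computed is minus the logarithmic derivative of cosh πx + cos πθ. -/
theorem exists_extremalPhase_im_onLine (hθ : θ ∈ Ioo (0 : ℝ) 1) : ∃ c : ℝ, ∀ x : ℝ,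
    (onLine (extremalPhase θ) (-1) x).im =
      c - Real.log (Real.cosh (Real.pi * x) + Real.cos (Real.pi * θ)) := by
  set f : ℝ → ℝ := fun x => (onLine (extremalPhase θ) (-1) x).im +
    Real.log (Real.cosh (Real.pi * x) + Real.cos (Real.pi * θ)) with hf
  have hd : ∀ x, HasDerivAt f 0 x := by
    intro x
    have hz : |((x : ℂ) + ((-1 : ℝ) : ℂ) * Complex.I).im| < 2 - θ := by
      simp; linarith [hθ.2]
    have h1 := hasDerivAt_extremalPhase hθ hz
    have h2 : HasDerivAt (fun x : ℝ => (x : ℂ) + ((-1 : ℝ) : ℂ) * Complex.I) 1 x :=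
      (Complex.ofRealCLM.hasDerivAt (x := x)).add_const _
    have h3 := h1.comp x h2
    have h4 := Complex.imCLM.hasFDerivAt.comp_hasDerivAt x h3
    have h5 : HasDerivAt (fun x : ℝ => Real.cosh (Real.pi * x) + Real.cos (Real.pi * θ))
        (Real.sinh (Real.pi * x) * (Real.pi * 1)) x :=
      (((hasDerivAt_id x).const_mul Real.pi).cosh).add_const _
    have h6 := h4.add (h5.log (cosh_add_cos_pos hθ x).ne')
    refine h6.congr_deriv ?_
    simp only [Complex.imCLM_apply, mul_one]
    rw [deriv_extremalPhase_im hθ x]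
    ring
  refine ⟨f 0, fun x => ?_⟩
  have := is_const_of_deriv_eq_zero (fun x => (hd x).differentiableAt) (fun x => (hd x).deriv) x 0
  rw [← this, hf]
  simp

/-- For H = exp(−(i/2)(phase − az)) one has |H|² = exp(Im phase − a Im z). The phase is real on ℝ,
which gives modulus 1 there; on ℝ − i the logarithm exponentiates to a multiple of 1/(cosh πx + cos
πθ), and the real parameter a fixes the multiple without disturbing ℝ. The phase is holomorphic for
|Im z| < 2 − θ, and s lies strictly between 1 and 2 − θ. -/
theorem exists_isExtremal (hθ : θ ∈ Ioo (0 : ℝ) 1) :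
    ∃ (H : ℂ → ℂ) (s C : ℝ), IsExtremal θ H s C := by
  obtain ⟨c, hc⟩ := exists_extremalPhase_im_onLine hθ
  set s : ℝ := 1 + (1 - θ) / 2 with hs
  have hs2 : s < 2 - θ := by rw [hs]; linarith [hθ.2]
  obtain ⟨C, hC⟩ := exists_abs_extremalPhase_im_sub_le hθ hs2
  set a : ℝ := Real.log (Real.sin (Real.pi * θ) / (2 * θ)) - c with ha
  set H : ℂ → ℂ := fun z => Complex.exp (-(Complex.I / 2) * (extremalPhase θ z - a * z)) with hH
  have hHn : ∀ z, ‖H z‖ = Real.exp ((extremalPhase θ z).im / 2 - a * z.im / 2) := by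
    intro z
    rw [hH, Complex.norm_exp]
    congr 1
    simp
    ring
  have hs1 : 1 < s := by rw [hs]; linarith [hθ.2]
  have hest : ∀ z : ℂ, |z.im| < s → |((extremalPhase θ z).im / 2 - a * z.im / 2) -
      Real.pi / 2 * z.im * (|z.re|)| ≤ C / 2 + |a| * s / 2 := by
    intro z hz
    have h1 := hC z hz
    have h2 : |a * z.im| ≤ |a| * s := by rw [abs_mul]; gcongr
    rw [abs_le] at h1 h2 ⊢
    constructor <;> linarith
  refine ⟨H, s, Real.exp (C / 2 + |a| * s / 2), ⟨hs1, Real.exp_pos _, ?_, ?_, ?_, ?_, ?_⟩⟩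
  · intro z hz
    have := (hasDerivAt_extremalPhase hθ (lt_trans hz hs2)).differentiableAt
    exact ((this.sub (differentiableAt_id.const_mul (a : ℂ))).const_mul
      (-(Complex.I / 2))).cexp.differentiableWithinAt
  · intro x
    rw [onLine_apply, hHn]
    simp [extremalPhase_ofReal_im]
  · intro x
    have := hc x
    rw [onLine_apply] at this ⊢
    have hpos := cosh_add_cos_pos hθ x
    have hsp := sin_pi_mul_pos hθ
    have hθ0 := hθ.1
    rw [hHn, this, ← Real.exp_nat_mul]
    simp only [Complex.add_im, Complex.ofReal_im, Complex.mul_im, Complex.ofReal_re,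
      Complex.I_im, Complex.I_re]
    rw [show ((2 : ℕ) : ℝ) * ((c - Real.log (Real.cosh (Real.pi * x) + Real.cos (Real.pi * θ))) / 2 -
        a * (0 + (-1 * 1 + 0 * 0)) / 2) = Real.log (Real.sin (Real.pi * θ) / (2 * θ)) -
        Real.log (Real.cosh (Real.pi * x) + Real.cos (Real.pi * θ)) by rw [ha]; push_cast; ring,
      Real.exp_sub, Real.exp_log hpos, Real.exp_log (by positivity), stripDensity]
    field_simp
  · intro z hz
    rw [hHn, ← Real.exp_add]
    have := hest z hz
    rw [abs_le] at this
    exact Real.exp_le_exp.2 (by linarith)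
  · intro z hz
    rw [hHn, ← Real.exp_add]
    have := hest z hz
    rw [abs_le] at this
    exact Real.exp_le_exp.2 (by linarith)

end Extremal

/-! ### Holomorphic functions on the strip with uniformly bounded norms along the lines -/

theorem isOpen_lowerStrip : IsOpen lowerStrip := isOpen_Ioo.preimage Complex.continuous_im

theorem continuous_onLine_of_lowerStrip {F : ℂ → ℂ} (hF : DifferentiableOn ℂ F lowerStrip) {y : ℝ}
    (hy : y ∈ Ioo (-1 : ℝ) 0) : Continuous (onLine F y) :=
  continuous_onLine (s := Ioo (-1) 0) hF.continuousOn hy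

/-- Contour shift for F(z)e^{-2πiξz}: the exponential is bounded by e^{2π|ξ|} on the strip, so the
L¹ bounds survive. -/
theorem fourier_onLine_eq {F : ℂ → ℂ} (hF : DifferentiableOn ℂ F lowerStrip) {M : ℝ≥0∞}
    (hM : M ≠ ∞) (hb : ∀ y ∈ Ioo (-1 : ℝ) 0, eLpNorm (onLine F y) 1 volume ≤ M)
    {a b : ℝ} (ha : a ∈ Ioo (-1 : ℝ) 0) (hb' : b ∈ Ioo (-1 : ℝ) 0) (hab : a ≤ b) (ξ : ℝ) :
    𝓕 (onLine F a) ξ * Real.exp (2 * Real.pi * a * ξ) =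
      𝓕 (onLine F b) ξ * Real.exp (2 * Real.pi * b * ξ) := by
  set Q : ℂ → ℂ := fun z => F z * Complex.exp (-2 * Real.pi * Complex.I * ξ * z) with hQ
  have hsub : {z : ℂ | z.im ∈ Icc a b} ⊆ lowerStrip := fun z hz =>
    ⟨lt_of_lt_of_le ha.1 hz.1, lt_of_le_of_lt hz.2 hb'.2⟩
  have hQd : DifferentiableOn ℂ Q lowerStrip := hF.mul (by fun_prop)
  have hline : ∀ y : ℝ, ∫ x, onLine Q y x = 𝓕 (onLine F y) ξ * Real.exp (2 * Real.pi * y * ξ) := by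
    intro y
    rw [Real.fourier_eq', ← integral_mul_const]
    congr 1; ext x
    simp only [onLine_apply, hQ, smul_eq_mul]
    rw [mul_comm (Complex.exp _) (F _), mul_assoc (F _), Complex.ofReal_exp, ← Complex.exp_add]
    congr 2
    simp only [RCLike.inner_apply, conj_trivial]
    push_cast
    linear_combination (-2 * Real.pi * ξ * y : ℂ) * Complex.I_sq
  have hQb : ∀ y ∈ Icc a b, ∫⁻ x in {x : ℝ | 1 < |x|}, ‖onLine Q y x‖ₑ ≤
      M * ENNReal.ofReal (Real.exp (2 * Real.pi * |ξ|)) := by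
    intro y hy
    have hy' : y ∈ Ioo (-1 : ℝ) 0 := ⟨lt_of_lt_of_le ha.1 hy.1, lt_of_le_of_lt hy.2 hb'.2⟩
    refine (setLIntegral_le_lintegral _ _).trans ?_
    calc ∫⁻ x, ‖onLine Q y x‖ₑ ≤
        ∫⁻ x, ‖onLine F y x‖ₑ * ENNReal.ofReal (Real.exp (2 * Real.pi * |ξ|)) := by
          refine lintegral_mono fun x => ?_
          rw [onLine_apply, hQ, enorm_mul, onLine_apply]
          refine mul_le_mul_right ?_ _
          rw [← ofReal_norm, Complex.norm_exp]
          refine ENNReal.ofReal_le_ofReal (Real.exp_le_exp.2 ?_)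
          have e : (-2 * (Real.pi : ℂ) * Complex.I * ξ * (x + y * Complex.I)).re =
              2 * Real.pi * (ξ * y) := by
            simp
            ring
          rw [e]
          have : ξ * y ≤ |ξ| := by
            refine (le_abs_self _).trans ?_
            rw [abs_mul]
            refine mul_le_of_le_one_right (abs_nonneg _) (abs_le.2 ⟨?_, ?_⟩) <;>
              linarith [hy'.1, hy'.2]
          have := Real.pi_pos
          gcongr
      _ ≤ _ := by
          rw [lintegral_mul_const' _ _ ENNReal.ofReal_ne_top, ← eLpNorm_one_eq_lintegral_enorm]
          gcongr
          exact hb y hy'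
  rw [← hline, ← hline]
  exact integral_onLine_eq_of_differentiableOn hab (hQd.continuousOn.mono hsub)
    (hQd.mono fun z hz => hsub ⟨hz.1.le, hz.2.le⟩)
    (ENNReal.mul_ne_top hM ENNReal.ofReal_ne_top) hQb

/-- Weak form of Fatou's lemma for `L²` norms. -/
theorem eLpNorm_le_of_tendsto {f : ℕ → ℝ → ℂ} {g : ℝ → ℂ} {M : ℝ≥0∞}
    (hf : ∀ n, AEStronglyMeasurable (f n) volume) (hM : ∀ n, eLpNorm (f n) 2 volume ≤ M)
    (h : ∀ᵐ x, Tendsto (fun n => f n x) atTop (𝓝 (g x))) : eLpNorm g 2 volume ≤ M :=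
  (Lp.eLpNorm_lim_le_liminf_eLpNorm hf g h).trans
    ((liminf_le_liminf (Eventually.of_forall hM)).trans (by simp))

theorem exists_tendsto_of_tendsto_fourier {ι : Type*} {l : Filter ι} {F : ι → ℝ → ℂ} {G : ℝ → ℂ}
    (h1 : ∀ᶠ i in l, Integrable (F i)) (h2 : ∀ᶠ i in l, MemLp (F i) 2) (hG : MemLp G 2)
    (h : Tendsto (fun i => eLpNorm (fun x => 𝓕 (F i) x - G x) 2 volume) l (𝓝 0)) :
    ∃ u : ℝ → ℂ, MemLp u 2 ∧
      Tendsto (fun i => eLpNorm (fun x => F i x - u x) 2 volume) l (𝓝 0) ∧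
      (u =ᵐ[volume] 0 → G =ᵐ[volume] 0) := by
  set U : Lp ℂ 2 (volume : Measure ℝ) := 𝓕⁻ (hG.toLp G) with hU
  have hFU : 𝓕 U = hG.toLp G := FourierTransform.fourier_fourierInv_eq _
  refine ⟨U, Lp.memLp U, ?_, ?_⟩
  · refine (tendsto_congr' ?_).1 h
    filter_upwards [h1, h2] with i hi1 hi2
    have e1 : eLpNorm (fun x => 𝓕 (F i) x - G x) 2 volume =
        ‖𝓕 (hi2.toLp (F i)) - hG.toLp G‖ₑ := by
      rw [Lp.enorm_def]
      refine eLpNorm_congr_ae ?_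
      filter_upwards [fourier_ae_eq_fourier_toLp hi1 hi2, hG.coeFn_toLp,
        Lp.coeFn_sub (𝓕 (hi2.toLp (F i))) (hG.toLp G)] with x a b c
      rw [c, Pi.sub_apply, a, b]
    have e2 : eLpNorm (fun x => F i x - U x) 2 volume = ‖hi2.toLp (F i) - U‖ₑ := by
      rw [Lp.enorm_def]
      refine eLpNorm_congr_ae ?_
      filter_upwards [hi2.coeFn_toLp, Lp.coeFn_sub (hi2.toLp (F i)) U] with x a c
      rw [c, Pi.sub_apply, a]
    have e3 : 𝓕 (hi2.toLp (F i) - U) = 𝓕 (hi2.toLp (F i)) - 𝓕 U :=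
      map_sub (Lp.fourierTransformₗᵢ ℝ ℂ) _ _
    rw [e1, e2, ← hFU, ← e3, ← ofReal_norm, ← ofReal_norm, Lp.norm_fourier_eq]
  · intro hu
    have : U = 0 := by
      rw [Lp.eq_zero_iff_ae_eq_zero]; exact hu
    rw [this] at hFU
    have h0 : 𝓕 (0 : Lp ℂ 2 (volume : Measure ℝ)) = 0 := map_zero (Lp.fourierTransformₗᵢ ℝ ℂ)
    rw [h0] at hFU
    have := hG.coeFn_toLp
    rw [← hFU] at this
    exact this.symm.trans (Lp.coeFn_zero _ _ _)

/-- A holomorphic function on the strip whose `L¹` and `L²` norms along the lines are bounded has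
boundary values in the sense of `L²` convergence, and vanishes if one boundary value does. -/
theorem exists_boundary_of_bounded {F : ℂ → ℂ} (hF : DifferentiableOn ℂ F lowerStrip)
    {M₁ M₂ : ℝ≥0∞} (hM₁ : M₁ ≠ ∞) (hM₂ : M₂ ≠ ∞)
    (hb₁ : ∀ y ∈ Ioo (-1 : ℝ) 0, eLpNorm (onLine F y) 1 volume ≤ M₁)
    (hb₂ : ∀ y ∈ Ioo (-1 : ℝ) 0, eLpNorm (onLine F y) 2 volume ≤ M₂) :
    ∃ u₀ u₁ : ℝ → ℂ, MemLp u₀ 2 ∧ MemLp u₁ 2 ∧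
      Tendsto (fun y => eLpNorm (fun x => onLine F y x - u₀ x) 2 volume) (𝓝[<] 0) (𝓝 0) ∧
      Tendsto (fun y => eLpNorm (fun x => onLine F y x - u₁ x) 2 volume) (𝓝[>] (-1)) (𝓝 0) ∧
      (u₁ =ᵐ[volume] 0 → ∀ z ∈ lowerStrip, F z = 0) := by
  have hcont : ∀ y ∈ Ioo (-1 : ℝ) 0, Continuous (onLine F y) := fun y hy =>
    continuous_onLine_of_lowerStrip hF hy
  have hi1 : ∀ y ∈ Ioo (-1 : ℝ) 0, Integrable (onLine F y) := fun y hy =>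
    memLp_one_iff_integrable.1 ⟨(hcont y hy).aestronglyMeasurable, (hb₁ y hy).trans_lt hM₁.lt_top⟩
  have hi2 : ∀ y ∈ Ioo (-1 : ℝ) 0, MemLp (onLine F y) 2 := fun y hy =>
    ⟨(hcont y hy).aestronglyMeasurable, (hb₂ y hy).trans_lt hM₂.lt_top⟩
  set m : ℝ := -1 / 2 with hm
  have hmI : m ∈ Ioo (-1 : ℝ) 0 := by constructor <;> norm_num [hm]
  set G : ℝ → ℂ := fun ξ => 𝓕 (onLine F m) ξ * Real.exp (2 * Real.pi * m * ξ) with hG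
  have hGc : Continuous G := by
    have : Continuous (𝓕 (onLine F m)) :=
      VectorFourier.fourierIntegral_continuous Real.continuous_fourierChar
        (by exact continuous_inner) (hi1 m hmI)
    simp only [hG]
    fun_prop
  have hFG : ∀ y ∈ Ioo (-1 : ℝ) 0, ∀ ξ, 𝓕 (onLine F y) ξ =
      G ξ * Real.exp (-(2 * Real.pi * y * ξ)) := by
    intro y hy ξ
    have e : 𝓕 (onLine F y) ξ * Real.exp (2 * Real.pi * y * ξ) = G ξ := by
      rcases le_total y m with h | h
      · exact fourier_onLine_eq hF hM₁ hb₁ hy hmI h ξ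
      · exact (fourier_onLine_eq hF hM₁ hb₁ hmI hy h ξ).symm
    rw [← e, mul_assoc, ← Complex.ofReal_mul, ← Real.exp_add]
    simp
  -- Plancherel bounds G(ξ)e^{-2πyξ} in L² for interior y; Fatou's lemma carries the bound to y = 0
  -- and y = −1.
  have hend : ∀ y : ℝ, y ∈ Icc (-1 : ℝ) 0 →
      eLpNorm (fun ξ => G ξ * Real.exp (-(2 * Real.pi * y * ξ))) 2 volume ≤ M₂ := by
    intro y hy
    have hy' : y ∈ closure (Ioo (-1 : ℝ) 0) := by
      rw [closure_Ioo (by norm_num)]; exact hy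
    obtain ⟨s, hs, hlim⟩ := mem_closure_iff_seq_limit.1 hy'
    refine eLpNorm_le_of_tendsto (f := fun n ξ => G ξ * Real.exp (-(2 * Real.pi * s n * ξ)))
      (fun n => ?_) (fun n => ?_) (Eventually.of_forall fun ξ => ?_)
    · exact Continuous.aestronglyMeasurable (by fun_prop)
    · have : (fun ξ => G ξ * Real.exp (-(2 * Real.pi * s n * ξ))) = 𝓕 (onLine F (s n)) := by
        ext ξ; rw [hFG _ (hs n)]
      rw [this, eLpNorm_fourier (hi1 _ (hs n)) (hi2 _ (hs n))]
      exact hb₂ _ (hs n)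
    · refine Tendsto.const_mul _ ((Complex.continuous_ofReal.tendsto _).comp
        ((Real.continuous_exp.tendsto _).comp ?_))
      exact ((hlim.const_mul _).mul_const _).neg
  have hmem : ∀ y : ℝ, y ∈ Icc (-1 : ℝ) 0 →
      MemLp (fun ξ => G ξ * Real.exp (-(2 * Real.pi * y * ξ))) 2 := fun y hy =>
    ⟨Continuous.aestronglyMeasurable (by fun_prop), (hend y hy).trans_lt hM₂.lt_top⟩
  have hbd : MemLp (fun ξ => ‖G ξ * Real.exp (-(2 * Real.pi * 0 * ξ))‖ +
      ‖G ξ * Real.exp (-(2 * Real.pi * (-1) * ξ))‖) 2 :=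
    (hmem 0 (by simp)).norm.add (hmem (-1) (by simp)).norm
  -- For fixed ξ the exponential is monotone in y, so the sum of the two endpoint functions is a
  -- square-integrable majorant for all lines at once.
  have hdom : ∀ y : ℝ, y ∈ Icc (-1 : ℝ) 0 → ∀ ξ, ‖G ξ * Real.exp (-(2 * Real.pi * y * ξ))‖ ≤
      ‖G ξ * Real.exp (-(2 * Real.pi * 0 * ξ))‖ +
      ‖G ξ * Real.exp (-(2 * Real.pi * (-1) * ξ))‖ := by
    intro y hy ξ
    simp only [norm_mul, Complex.norm_real, Real.norm_of_nonneg (Real.exp_pos _).le]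
    rw [← mul_add]
    refine mul_le_mul_of_nonneg_left ?_ (norm_nonneg _)
    have hpi := Real.pi_pos
    rcases le_total 0 ξ with h | h
    · refine le_add_of_nonneg_of_le (Real.exp_pos _).le (Real.exp_le_exp.2 ?_)
      have : -y * ξ ≤ 1 * ξ := by gcongr; linarith [hy.1]
      nlinarith
    · refine le_add_of_le_of_nonneg (Real.exp_le_exp.2 ?_) (Real.exp_pos _).le
      have : 0 ≤ y * ξ := mul_nonneg_of_nonpos_of_nonpos hy.2 h
      nlinarith
  have hlim : ∀ (y₀ : ℝ) (l : Filter ℝ), y₀ ∈ Icc (-1 : ℝ) 0 → l ≤ 𝓝 y₀ → l.IsCountablyGenerated →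
      (∀ᶠ y in l, y ∈ Ioo (-1 : ℝ) 0) →
      Tendsto (fun y => eLpNorm (fun ξ => 𝓕 (onLine F y) ξ -
        G ξ * Real.exp (-(2 * Real.pi * y₀ * ξ))) 2 volume) l (𝓝 0) := by
    intro y₀ l hy₀ hl _ hev
    refine (tendsto_congr' ?_).1 (tendsto_eLpNorm_sub_of_dominated
      (f := fun y ξ => G ξ * Real.exp (-(2 * Real.pi * y * ξ)))
      (f₀ := fun ξ => G ξ * Real.exp (-(2 * Real.pi * y₀ * ξ))) (l := l) ?_ ?_ hbd ?_ ?_ ?_)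
    · filter_upwards [hev] with y hy
      congr 1; ext ξ; rw [hFG y hy]
    · exact Eventually.of_forall fun y => Continuous.aestronglyMeasurable (by fun_prop)
    · exact Continuous.aestronglyMeasurable (by fun_prop)
    · filter_upwards [hev] with y hy
      exact Eventually.of_forall fun ξ => hdom y ⟨hy.1.le, hy.2.le⟩ ξ
    · exact Eventually.of_forall fun ξ => hdom y₀ hy₀ ξ
    · refine Eventually.of_forall fun ξ => ?_
      have : Continuous fun y : ℝ => G ξ * Real.exp (-(2 * Real.pi * y * ξ)) := by fun_prop
      exact (this.tendsto y₀).mono_left hl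
  have hev0 : ∀ᶠ y in 𝓝[<] (0 : ℝ), y ∈ Ioo (-1 : ℝ) 0 := Ioo_mem_nhdsLT (by norm_num)
  have hev1 : ∀ᶠ y in 𝓝[>] (-1 : ℝ), y ∈ Ioo (-1 : ℝ) 0 := Ioo_mem_nhdsGT (by norm_num)
  obtain ⟨u₀, hu₀, hl₀, -⟩ := exists_tendsto_of_tendsto_fourier
    (F := fun y => onLine F y) (hev0.mono hi1) (hev0.mono hi2) (hmem 0 (by simp))
    (hlim 0 _ (by simp) nhdsWithin_le_nhds inferInstance hev0)
  obtain ⟨u₁, hu₁, hl₁, hz⟩ := exists_tendsto_of_tendsto_fourier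
    (F := fun y => onLine F y) (hev1.mono hi1) (hev1.mono hi2) (hmem (-1) (by simp))
    (hlim (-1) _ (by simp) nhdsWithin_le_nhds inferInstance hev1)
  refine ⟨u₀, u₁, hu₀, hu₁, hl₀, hl₁, fun h => ?_⟩
  have hG0 : ∀ᵐ ξ, G ξ = 0 := by
    filter_upwards [hz h] with ξ hξ
    simpa [Real.exp_ne_zero] using hξ
  intro z hzs
  have hy : z.im ∈ Ioo (-1 : ℝ) 0 := hzs
  have : eLpNorm (onLine F z.im) 2 volume = 0 := by
    rw [← eLpNorm_fourier (hi1 _ hy) (hi2 _ hy)]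
    refine (eLpNorm_eq_zero_iff (memLp_fourier (hi1 _ hy) (hi2 _ hy)).1 (by norm_num)).2 ?_
    filter_upwards [hG0] with ξ hξ
    rw [hFG _ hy, hξ, zero_mul, Pi.zero_apply]
  rw [eLpNorm_eq_zero_iff (hcont _ hy).aestronglyMeasurable (by norm_num)] at this
  have h0 := (hcont _ hy).ae_eq_iff_eq (μ := volume) continuous_zero |>.1 this
  have := congrFun h0 z.re
  rw [onLine_apply, Complex.re_add_im] at this
  exact this

/-! ### Boundary values in the Hardy space -/

/-- A weight without zeros in the lower half plane. -/
noncomputable def stripWeight (z : ℂ) : ℂ := (z - 2 * Complex.I) ^ 2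

theorem norm_stripWeight (x y : ℝ) :
    ‖stripWeight (x + y * Complex.I)‖ = x ^ 2 + (2 - y) ^ 2 := by
  rw [stripWeight, norm_pow, ← Complex.normSq_eq_norm_sq, Complex.normSq_apply]
  simp
  ring

theorem one_add_sq_le_norm_stripWeight {y : ℝ} (hy : y ≤ 0) (x : ℝ) :
    1 + x ^ 2 ≤ ‖stripWeight (x + y * Complex.I)‖ := by
  rw [norm_stripWeight]; nlinarith

theorem norm_stripWeight_le {y : ℝ} (hy : y ∈ Icc (-1 : ℝ) 0) (x : ℝ) :
    ‖stripWeight (x + y * Complex.I)‖ ≤ x ^ 2 + 9 := by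
  rw [norm_stripWeight]; nlinarith [hy.1, hy.2]

theorem stripWeight_ne_zero {z : ℂ} (hz : z.im ≤ 0) : stripWeight z ≠ 0 := by
  have := one_add_sq_le_norm_stripWeight hz z.re
  rw [Complex.re_add_im] at this
  rw [← norm_pos_iff]
  nlinarith [sq_nonneg z.re]

theorem differentiable_stripWeight : Differentiable ℂ stripWeight := by
  unfold stripWeight; fun_prop

theorem continuous_stripWeight : Continuous stripWeight := differentiable_stripWeight.continuous

theorem continuous_onLine_stripWeight (y : ℝ) : Continuous (onLine stripWeight y) := by
  unfold onLine stripWeight; fun_prop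

theorem memLp_one_add_sq_inv {p : ℝ≥0∞} (hp : p = 1 ∨ p = 2 ∨ p = ∞) :
    MemLp (fun x : ℝ => (1 + x ^ 2)⁻¹) p := by
  have hc : Continuous (fun x : ℝ => (1 + x ^ 2)⁻¹) :=
    Continuous.inv₀ (by fun_prop) fun x => by positivity
  have hle : ∀ x : ℝ, (1 + x ^ 2)⁻¹ ≤ 1 := fun x =>
    inv_le_one_of_one_le₀ (by nlinarith [sq_nonneg x])
  have h1 : MemLp (fun x : ℝ => (1 + x ^ 2)⁻¹) 1 :=
    memLp_one_iff_integrable.2 integrable_inv_one_add_sq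
  rcases hp with rfl | rfl | rfl
  · exact h1
  · rw [memLp_two_iff_integrable_sq hc.aestronglyMeasurable]
    refine (memLp_one_iff_integrable.1 h1).mono' (by fun_prop) (Eventually.of_forall fun x => ?_)
    have := hle x
    have h0 : 0 ≤ (1 + x ^ 2)⁻¹ := by positivity
    rw [Real.norm_of_nonneg (by positivity)]
    nlinarith
  · refine memLp_top_of_bound hc.aestronglyMeasurable 1 (Eventually.of_forall fun x => ?_)
    rw [Real.norm_of_nonneg (by positivity)]
    exact hle x

/-- Hölder, with |weight| ≥ 1 + x². The triples (∞,1,1), (2,2,1), (∞,2,2), (2,∞,2) place both the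
bounded and the square-integrable part of h into L¹ and L² after division; this is the purpose of
the weight. -/
theorem eLpNorm_div_stripWeight_le {p q r : ℝ≥0∞} [ENNReal.HolderTriple p q r] {y : ℝ}
    (hy : y ≤ 0) {f : ℝ → ℂ} (hf : AEStronglyMeasurable f volume) :
    eLpNorm (fun x => f x / onLine stripWeight y x) r volume ≤
      eLpNorm f p volume * eLpNorm (fun x : ℝ => (1 + x ^ 2)⁻¹) q volume := by
  have hc : Continuous fun x => (onLine stripWeight y x)⁻¹ :=
    (continuous_onLine_stripWeight y).inv₀ fun x => stripWeight_ne_zero (by simpa using hy)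
  have h1 := eLpNorm_smul_le_mul_eLpNorm (p := p) (q := q) (r := r)
    (f := fun x => (onLine stripWeight y x)⁻¹) hc.aestronglyMeasurable hf
  refine (le_of_eq ?_).trans (h1.trans (mul_le_mul_right ?_ _))
  · congr 1
  · refine eLpNorm_mono fun x => ?_
    rw [norm_inv, Real.norm_of_nonneg (by positivity)]
    exact inv_anti₀ (by positivity) (one_add_sq_le_norm_stripWeight hy x)

/-- The defining decomposition of functions in `ℍ^{∞,2}(S_-)`. -/
theorem exists_decomposition {h : ℂ → ℂ} (hh : h ∈ hardyLower ∞ 2) :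
    ∃ C : ℝ≥0∞, C ≠ ∞ ∧ ∀ y ∈ Ioo (-1 : ℝ) 0, ∃ f g : ℝ → ℂ,
      AEStronglyMeasurable f volume ∧ AEStronglyMeasurable g volume ∧
      eLpNorm f ∞ volume ≤ ENNReal.ofReal (1 + y) * C ∧
      eLpNorm g 2 volume ≤ ENNReal.ofReal (-y) * C ∧
      ∀ᵐ x, onLine h y x = f x + g x := by
  have hlt : hardyNorm ∞ 2 (fun z => conj (h (conj z))) < ∞ := hh.2.2
  -- The infimum need not be attained; the added 1 makes it strictly smaller than the constant, so
  -- an actual splitting exists.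
  refine ⟨hardyNorm ∞ 2 (fun z => conj (h (conj z))) + 1, by finiteness, fun y hy => ?_⟩
  set C := hardyNorm ∞ 2 (fun z => conj (h (conj z))) + 1 with hC
  have hy' : -y ∈ Ioo (0 : ℝ) 1 := ⟨by linarith [hy.2], by linarith [hy.1]⟩
  have h1 := le_iSup₂ (f := fun (y : ℝ) (_ : y ∈ Ioo (0 : ℝ) 1) =>
    ⨅ (f : ℝ → ℂ) (g : ℝ → ℂ) (_ : MemLp f ∞ volume) (_ : MemLp g 2 volume)
      (_ : f + g =ᵐ[volume] onLine (fun z => conj (h (conj z))) y),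
      ENNReal.ofReal (1 / (1 - y)) * eLpNorm f ∞ volume
        + ENNReal.ofReal (1 / y) * eLpNorm g 2 volume) (-y) hy'
  have h2 := lt_of_le_of_lt h1 (ENNReal.lt_add_right hlt.ne one_ne_zero)
  simp only [iInf_lt_iff] at h2
  obtain ⟨f, g, hf, hg, hfg, hlt'⟩ := h2
  change _ < C at hlt'
  have aux : ∀ {r : ℝ} {a : ℝ≥0∞}, 0 < r → ENNReal.ofReal (1 / r) * a ≤ C →
      a ≤ ENNReal.ofReal r * C := by
    intro r a hr h
    calc a = ENNReal.ofReal r * (ENNReal.ofReal (1 / r) * a) := by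
          rw [← mul_assoc, ← ENNReal.ofReal_mul hr.le, mul_one_div_cancel hr.ne',
            ENNReal.ofReal_one, one_mul]
      _ ≤ _ := by gcongr
  refine ⟨fun x => conj (f x), fun x => conj (g x), ?_, ?_, ?_, ?_, ?_⟩
  · exact (MemLp.star hf).1
  · exact (MemLp.star hg).1
  · have e : eLpNorm (fun x => conj (f x)) ∞ volume = eLpNorm f ∞ volume :=
      eLpNorm_congr_norm_ae (Eventually.of_forall fun x => by simp)
    rw [e]
    refine aux (by linarith [hy.1]) ((le_trans ?_ le_self_add).trans hlt'.le)
    rw [sub_neg_eq_add]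
  · have e : eLpNorm (fun x => conj (g x)) 2 volume = eLpNorm g 2 volume :=
      eLpNorm_congr_norm_ae (Eventually.of_forall fun x => by simp)
    rw [e]
    exact aux (by linarith [hy.2]) (le_add_self.trans hlt'.le)
  · filter_upwards [hfg] with x hx
    rw [← map_add, ← Pi.add_apply, hx, onLine_apply, onLine_apply]
    simp

/-- `h` has the boundary values `v₀` on `ℝ` and `v₁` on `ℝ - i`, in the sense of weighted `L²`
convergence. -/
structure HasBoundary (h : ℂ → ℂ) (v₀ v₁ : ℝ → ℂ) : Prop where
  diff : DifferentiableOn ℂ h lowerStrip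
  mem₀ : MemLp v₀ ∞
  mem₁ : MemLp v₁ 2
  bound₁ : ∃ M : ℝ≥0∞, M ≠ ∞ ∧ ∀ y ∈ Ioo (-1 : ℝ) 0,
    eLpNorm (onLine (fun z => h z / stripWeight z) y) 1 volume ≤ M
  bound₂ : ∃ M : ℝ≥0∞, M ≠ ∞ ∧ ∀ y ∈ Ioo (-1 : ℝ) 0,
    eLpNorm (onLine (fun z => h z / stripWeight z) y) 2 volume ≤ M
  tendsto₀ : Tendsto (fun y => eLpNorm (fun x => onLine (fun z => h z / stripWeight z) y x -
    v₀ x / onLine stripWeight 0 x) 2 volume) (𝓝[<] 0) (𝓝 0)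
  tendsto₁ : Tendsto (fun y => eLpNorm (fun x => onLine (fun z => h z / stripWeight z) y x -
    v₁ x / onLine stripWeight (-1) x) 2 volume) (𝓝[>] (-1)) (𝓝 0)

/-- L² convergence gives convergence almost everywhere along a subsequence; there the weight can be
undone, and Fatou passes the bound to the limit. Used with p = ∞ at ℝ and p = 2 at ℝ − i. -/
theorem eLpNorm_mul_stripWeight_le_of_tendsto {p : ℝ≥0∞} {s : ℕ → ℝ} {y₀ : ℝ}
    (hs : ∀ n, s n ≤ 0) (hlim : Tendsto s atTop (𝓝 y₀)) {a : ℕ → ℝ → ℂ} {u : ℝ → ℂ} {M : ℝ≥0∞}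
    (ha : ∀ n, AEStronglyMeasurable (a n) volume) (haM : ∀ n, eLpNorm (a n) p volume ≤ M)
    (hu : AEStronglyMeasurable u volume)
    (h : Tendsto (fun n => eLpNorm (fun x => a n x / onLine stripWeight (s n) x - u x) 2 volume)
      atTop (𝓝 0)) :
    eLpNorm (fun x => u x * onLine stripWeight y₀ x) p volume ≤ M := by
  have hc : ∀ n, Continuous fun x => (onLine stripWeight (s n) x)⁻¹ := fun n =>
    (continuous_onLine_stripWeight (s n)).inv₀ fun x => stripWeight_ne_zero (by simpa using hs n)
  have hm := tendstoInMeasure_of_tendsto_eLpNorm (p := 2) (by norm_num)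
    (f := fun n x => a n x / onLine stripWeight (s n) x) (g := u) (fun n => by
      simp only [div_eq_mul_inv]
      exact (ha n).mul (hc n).aestronglyMeasurable) hu h
  obtain ⟨ns, hns, hae⟩ := hm.exists_seq_tendsto_ae
  refine (Lp.eLpNorm_lim_le_liminf_eLpNorm (f := fun n => a (ns n)) (fun n => ha _) _ ?_).trans
    ((liminf_le_liminf (Eventually.of_forall fun n => haM (ns n))).trans (by simp))
  filter_upwards [hae] with x hx
  have h2 : Tendsto (fun n => onLine stripWeight (s (ns n)) x) atTop
      (𝓝 (onLine stripWeight y₀ x)) := by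
    have : Continuous fun y : ℝ => onLine stripWeight y x := by
      unfold onLine stripWeight; fun_prop
    exact (this.tendsto y₀).comp (hlim.comp hns.tendsto_atTop)
  refine (hx.mul h2).congr fun n => ?_
  exact div_mul_cancel₀ _ (stripWeight_ne_zero (by simpa using hs (ns n)))

theorem tendsto_neg_inv_add_two :
    Tendsto (fun n : ℕ => -((n : ℝ) + 2)⁻¹) atTop (𝓝[<] 0) := by
  rw [tendsto_nhdsWithin_iff]
  refine ⟨?_, Eventually.of_forall fun n => ?_⟩
  · have : Tendsto (fun n : ℕ => ((n : ℝ) + 2)⁻¹) atTop (𝓝 0) :=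
      tendsto_inv_atTop_zero.comp (tendsto_atTop_add_const_right _ _ tendsto_natCast_atTop_atTop)
    simpa using this.neg
  · have : (0 : ℝ) < ((n : ℝ) + 2)⁻¹ := by positivity
    simpa using this

theorem neg_inv_add_two_mem (n : ℕ) : -((n : ℝ) + 2)⁻¹ ∈ Ioo (-1 : ℝ) 0 := by
  have h1 : (0 : ℝ) < ((n : ℝ) + 2)⁻¹ := by positivity
  have h2 : ((n : ℝ) + 2)⁻¹ < 1 := inv_lt_one_of_one_lt₀ (by linarith [(Nat.cast_nonneg n : (0 : ℝ) ≤ n)])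
  exact ⟨by linarith, by linarith⟩

theorem tendsto_neg_one_sub :
    Tendsto (fun n : ℕ => -1 - (-((n : ℝ) + 2)⁻¹)) atTop (𝓝[>] (-1)) := by
  have h := tendsto_nhdsWithin_iff.1 tendsto_neg_inv_add_two
  rw [tendsto_nhdsWithin_iff]
  refine ⟨?_, h.2.mono fun n hn => ?_⟩
  · simpa using h.1.const_sub (-1)
  · have : -((n : ℝ) + 2)⁻¹ < 0 := hn
    rw [mem_Ioi]
    linarith

/-- Near ℝ the L² part has norm at most −yC, so the weighted limit comes from the bounded parts
alone and inherits their L^∞ bound. Near ℝ − i the bounded part has norm at most (1 + y)C, and the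
roles are exchanged. -/
theorem exists_hasBoundary {h : ℂ → ℂ} (hh : h ∈ hardyLower ∞ 2) :
    ∃ v₀ v₁, HasBoundary h v₀ v₁ := by
  obtain ⟨C, hC, hdec⟩ := exists_decomposition hh
  choose! f g hfm hgm hf hg hfg using hdec
  have hd : DifferentiableOn ℂ (fun z => h z / stripWeight z) lowerStrip :=
    hh.1.div differentiable_stripWeight.differentiableOn fun z hz => stripWeight_ne_zero hz.2.le
  have hsplit : ∀ y ∈ Ioo (-1 : ℝ) 0, ∀ᵐ x, onLine (fun z => h z / stripWeight z) y x =
      f y x / onLine stripWeight y x + g y x / onLine stripWeight y x := by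
    intro y hy
    filter_upwards [hfg y hy] with x hx
    rw [← add_div, ← hx]
    rfl
  have hwm : ∀ y : ℝ, y ≤ 0 → ∀ {q : ℝ → ℂ}, AEStronglyMeasurable q volume →
      AEStronglyMeasurable (fun x => q x / onLine stripWeight y x) volume := by
    intro y hy q hq
    simp only [div_eq_mul_inv]
    exact hq.mul ((continuous_onLine_stripWeight y).inv₀ fun x =>
      stripWeight_ne_zero (by simpa using hy)).aestronglyMeasurable
  have hofR : ∀ y ∈ Ioo (-1 : ℝ) 0, ENNReal.ofReal (1 + y) ≤ 1 ∧ ENNReal.ofReal (-y) ≤ 1 := by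
    intro y hy
    simp only [ENNReal.ofReal_le_one]
    exact ⟨by linarith [hy.2], by linarith [hy.1]⟩
  have hfC : ∀ y ∈ Ioo (-1 : ℝ) 0, eLpNorm (f y) ∞ volume ≤ C := fun y hy =>
    (hf y hy).trans (mul_le_of_le_one_left' (hofR y hy).1)
  have hgC : ∀ y ∈ Ioo (-1 : ℝ) 0, eLpNorm (g y) 2 volume ≤ C := fun y hy =>
    (hg y hy).trans (mul_le_of_le_one_left' (hofR y hy).2)
  set ρ : ℝ≥0∞ → ℝ≥0∞ := fun q => eLpNorm (fun x : ℝ => (1 + x ^ 2)⁻¹) q volume with hρ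
  have hρ1 : ρ 1 ≠ ∞ := (memLp_one_add_sq_inv (Or.inl rfl)).2.ne
  have hρ2 : ρ 2 ≠ ∞ := (memLp_one_add_sq_inv (Or.inr (Or.inl rfl))).2.ne
  have hρt : ρ ∞ ≠ ∞ := (memLp_one_add_sq_inv (Or.inr (Or.inr rfl))).2.ne
  have hb1 : ∀ y ∈ Ioo (-1 : ℝ) 0,
      eLpNorm (onLine (fun z => h z / stripWeight z) y) 1 volume ≤ C * ρ 1 + C * ρ 2 := by
    intro y hy
    rw [eLpNorm_congr_ae (hsplit y hy)]
    refine (eLpNorm_add_le (hwm y hy.2.le (hfm y hy)) (hwm y hy.2.le (hgm y hy)) le_rfl).trans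
      (add_le_add ?_ ?_)
    · exact (eLpNorm_div_stripWeight_le (p := ∞) (q := 1) hy.2.le (hfm y hy)).trans
        (mul_le_mul_left (hfC y hy) _)
    · exact (eLpNorm_div_stripWeight_le (p := 2) (q := 2) hy.2.le (hgm y hy)).trans
        (mul_le_mul_left (hgC y hy) _)
  have hfw : ∀ y ∈ Ioo (-1 : ℝ) 0, eLpNorm (fun x => f y x / onLine stripWeight y x) 2 volume ≤
      ENNReal.ofReal (1 + y) * (C * ρ 2) := by
    intro y hy
    rw [← mul_assoc]
    exact (eLpNorm_div_stripWeight_le (p := ∞) (q := 2) hy.2.le (hfm y hy)).trans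
      (mul_le_mul_left (hf y hy) _)
  have hgw : ∀ y ∈ Ioo (-1 : ℝ) 0, eLpNorm (fun x => g y x / onLine stripWeight y x) 2 volume ≤
      ENNReal.ofReal (-y) * (C * ρ ∞) := by
    intro y hy
    rw [← mul_assoc]
    exact (eLpNorm_div_stripWeight_le (p := 2) (q := ∞) hy.2.le (hgm y hy)).trans
      (mul_le_mul_left (hg y hy) _)
  have hb2 : ∀ y ∈ Ioo (-1 : ℝ) 0,
      eLpNorm (onLine (fun z => h z / stripWeight z) y) 2 volume ≤ C * ρ 2 + C * ρ ∞ := by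
    intro y hy
    rw [eLpNorm_congr_ae (hsplit y hy)]
    refine (eLpNorm_add_le (hwm y hy.2.le (hfm y hy)) (hwm y hy.2.le (hgm y hy))
      (by norm_num)).trans (add_le_add ?_ ?_)
    · exact (hfw y hy).trans (mul_le_of_le_one_left' (hofR y hy).1)
    · exact (hgw y hy).trans (mul_le_of_le_one_left' (hofR y hy).2)
  have hM1 : C * ρ 1 + C * ρ 2 ≠ ∞ := by finiteness
  have hM2 : C * ρ 2 + C * ρ ∞ ≠ ∞ := by finiteness
  obtain ⟨u₀, u₁, hu₀, hu₁, hl₀, hl₁, -⟩ := exists_boundary_of_bounded hd hM1 hM2 hb1 hb2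
  have hw0 : ∀ (y x : ℝ), y ≤ 0 → onLine stripWeight y x ≠ 0 := fun y x hy =>
    stripWeight_ne_zero (by simpa using hy)
  -- Stated symmetrically to serve both edges: p is the part that survives in the limit, q the part
  -- that vanishes.
  have hlimit : ∀ {s : ℕ → ℝ} {p q : ℝ → ℝ → ℂ} {u : ℝ → ℂ}, (∀ n, s n ∈ Ioo (-1 : ℝ) 0) →
      (∀ y ∈ Ioo (-1 : ℝ) 0, AEStronglyMeasurable (p y) volume) →
      (∀ y ∈ Ioo (-1 : ℝ) 0, AEStronglyMeasurable (q y) volume) →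
      (∀ y ∈ Ioo (-1 : ℝ) 0, ∀ᵐ x, onLine (fun z => h z / stripWeight z) y x =
        p y x / onLine stripWeight y x + q y x / onLine stripWeight y x) →
      AEStronglyMeasurable u volume →
      Tendsto (fun n => eLpNorm (fun x => q (s n) x / onLine stripWeight (s n) x) 2 volume)
        atTop (𝓝 0) →
      Tendsto (fun n => eLpNorm (fun x => onLine (fun z => h z / stripWeight z) (s n) x - u x) 2
        volume) atTop (𝓝 0) →
      Tendsto (fun n => eLpNorm (fun x => p (s n) x / onLine stripWeight (s n) x - u x) 2
        volume) atTop (𝓝 0) := by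
    intro s p q u hs hp hq hpq hu hq0 hu0
    refine tendsto_of_tendsto_of_tendsto_of_le_of_le tendsto_const_nhds
      (by simpa using hu0.add hq0) (fun n => zero_le) (fun n => ?_)
    have hc := continuous_onLine_of_lowerStrip hd (hs n)
    refine (le_of_eq ?_).trans (eLpNorm_sub_le (hc.aestronglyMeasurable.sub hu)
      (hwm _ (hs n).2.le (hq _ (hs n))) (by norm_num))
    refine eLpNorm_congr_ae ?_
    filter_upwards [hpq _ (hs n)] with x hx
    simp only [Pi.sub_apply]
    rw [hx]
    ring
  refine ⟨fun x => u₀ x * onLine stripWeight 0 x, fun x => u₁ x * onLine stripWeight (-1) x,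
    hh.1, ⟨?_, ?_⟩, ⟨?_, ?_⟩, ⟨_, hM1, hb1⟩, ⟨_, hM2, hb2⟩, ?_, ?_⟩
  · exact hu₀.1.mul (continuous_onLine_stripWeight 0).aestronglyMeasurable
  · refine lt_of_le_of_lt (eLpNorm_mul_stripWeight_le_of_tendsto
      (s := fun n => -((n : ℝ) + 2)⁻¹) (fun n => (neg_inv_add_two_mem n).2.le)
      (tendsto_neg_inv_add_two.mono_right nhdsWithin_le_nhds)
      (fun n => hfm _ (neg_inv_add_two_mem n)) (fun n => hfC _ (neg_inv_add_two_mem n)) hu₀.1 ?_)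
      hC.lt_top
    refine hlimit neg_inv_add_two_mem hfm hgm hsplit hu₀.1 ?_ (hl₀.comp tendsto_neg_inv_add_two)
    refine tendsto_of_tendsto_of_tendsto_of_le_of_le tendsto_const_nhds ?_ (fun n => zero_le)
      (fun n => hgw _ (neg_inv_add_two_mem n))
    have h1 : Tendsto (fun n : ℕ => ENNReal.ofReal (-(-((n : ℝ) + 2)⁻¹))) atTop (𝓝 0) := by
      have := (ENNReal.continuous_ofReal.tendsto _).comp
        (tendsto_neg_inv_add_two.mono_right nhdsWithin_le_nhds).neg
      simpa [Function.comp_def] using this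
    simpa using ENNReal.Tendsto.mul_const h1 (Or.inr (by finiteness : C * ρ ∞ ≠ ∞))
  · exact hu₁.1.mul (continuous_onLine_stripWeight (-1)).aestronglyMeasurable
  · have hmem : ∀ n : ℕ, -1 - (-((n : ℝ) + 2)⁻¹) ∈ Ioo (-1 : ℝ) 0 := fun n => by
      have := neg_inv_add_two_mem n
      exact ⟨by linarith [this.2], by linarith [this.1]⟩
    refine lt_of_le_of_lt (eLpNorm_mul_stripWeight_le_of_tendsto
      (s := fun n => -1 - (-((n : ℝ) + 2)⁻¹)) (fun n => (hmem n).2.le)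
      (tendsto_neg_one_sub.mono_right nhdsWithin_le_nhds)
      (fun n => hgm _ (hmem n)) (fun n => hgC _ (hmem n)) hu₁.1 ?_)
      hC.lt_top
    refine hlimit hmem hgm hfm (fun y hy => (hsplit y hy).mono fun x hx => by
      rw [hx, add_comm]) hu₁.1 ?_ (hl₁.comp tendsto_neg_one_sub)
    refine tendsto_of_tendsto_of_tendsto_of_le_of_le tendsto_const_nhds ?_ (fun n => zero_le)
      (fun n => hfw _ (hmem n))
    have h1 : Tendsto (fun n : ℕ => ENNReal.ofReal (1 + (-1 - (-((n : ℝ) + 2)⁻¹)))) atTop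
        (𝓝 0) := by
      have := (ENNReal.continuous_ofReal.tendsto _).comp
        ((tendsto_neg_one_sub.mono_right nhdsWithin_le_nhds).const_add 1)
      simpa [Function.comp_def] using this
    simpa using ENNReal.Tendsto.mul_const h1 (Or.inr (by finiteness : C * ρ 2 ≠ ∞))
  · simpa only [mul_div_cancel_right₀ _ (hw0 0 _ le_rfl)] using hl₀
  · simpa only [mul_div_cancel_right₀ _ (hw0 (-1) _ (by norm_num))] using hl₁

/-! ### Pairings with boundary values -/

theorem eventually_mem_Ioo_zero : ∀ᶠ y in 𝓝[<] (0 : ℝ), y ∈ Ioo (-1 : ℝ) 0 :=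
  Ioo_mem_nhdsLT (by norm_num)

theorem eventually_mem_Ioo_neg_one : ∀ᶠ y in 𝓝[>] (-1 : ℝ), y ∈ Ioo (-1 : ℝ) 0 :=
  Ioo_mem_nhdsGT (by norm_num)

theorem onLine_stripWeight_ne_zero {y : ℝ} (hy : y ≤ 0) (x : ℝ) : onLine stripWeight y x ≠ 0 :=
  stripWeight_ne_zero (by simpa using hy)

theorem aestronglyMeasurable_div_stripWeight {y : ℝ} (hy : y ≤ 0) {q : ℝ → ℂ}
    (hq : AEStronglyMeasurable q volume) :
    AEStronglyMeasurable (fun x => q x / onLine stripWeight y x) volume := by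
  simp only [div_eq_mul_inv]
  exact hq.mul ((continuous_onLine_stripWeight y).inv₀ fun x =>
    onLine_stripWeight_ne_zero hy x).aestronglyMeasurable

theorem memLp_div_stripWeight_of_top {y : ℝ} (hy : y ≤ 0) {v : ℝ → ℂ} (hv : MemLp v ∞) :
    MemLp (fun x => v x / onLine stripWeight y x) 2 :=
  ⟨aestronglyMeasurable_div_stripWeight hy hv.1,
    (eLpNorm_div_stripWeight_le (p := ∞) (q := 2) hy hv.1).trans_lt
      (ENNReal.mul_lt_top hv.2 (memLp_one_add_sq_inv (Or.inr (Or.inl rfl))).2)⟩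

theorem memLp_div_stripWeight_of_two {y : ℝ} (hy : y ≤ 0) {v : ℝ → ℂ} (hv : MemLp v 2) :
    MemLp (fun x => v x / onLine stripWeight y x) 2 :=
  ⟨aestronglyMeasurable_div_stripWeight hy hv.1,
    (eLpNorm_div_stripWeight_le (p := 2) (q := ∞) hy hv.1).trans_lt
      (ENNReal.mul_lt_top hv.2 (memLp_one_add_sq_inv (Or.inr (Or.inr rfl))).2)⟩

/-- The product is regrouped as (h/w)(w q) with w the weight: the first factor converges in L² by
hypothesis, the second by domination. The lemma is applied to Schwartz functions and to the dual
kernel. -/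
theorem tendsto_integral_onLine_mul {h : ℂ → ℂ} (hd : DifferentiableOn ℂ h lowerStrip)
    {l : Filter ℝ} [l.IsCountablyGenerated] {y₀ : ℝ} (hl : l ≤ 𝓝 y₀) (hy₀ : y₀ ≤ 0)
    (hev : ∀ᶠ y in l, y ∈ Ioo (-1 : ℝ) 0) {M : ℝ≥0∞} (hM : M ≠ ∞)
    (hb : ∀ y ∈ Ioo (-1 : ℝ) 0, eLpNorm (onLine (fun z => h z / stripWeight z) y) 2 volume ≤ M)
    {v : ℝ → ℂ} (hv : MemLp (fun x => v x / onLine stripWeight y₀ x) 2)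
    (hlim : Tendsto (fun y => eLpNorm (fun x => onLine (fun z => h z / stripWeight z) y x -
      v x / onLine stripWeight y₀ x) 2 volume) l (𝓝 0))
    {q : ℝ → ℝ → ℂ} {q₀ : ℝ → ℂ} {b : ℝ → ℝ} (hbm : MemLp b 2)
    (hqm : ∀ᶠ y in l, AEStronglyMeasurable (q y) volume) (hqm₀ : AEStronglyMeasurable q₀ volume)
    (hqb : ∀ᶠ y in l, ∀ x, ‖onLine stripWeight y x * q y x‖ ≤ b x)
    (hqb₀ : ∀ x, ‖onLine stripWeight y₀ x * q₀ x‖ ≤ b x)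
    (hq : ∀ x, Tendsto (fun y => q y x) l (𝓝 (q₀ x))) :
    Tendsto (fun y => ∫ x, onLine h y x * q y x) l (𝓝 (∫ x, v x * q₀ x)) := by
  have hFd : DifferentiableOn ℂ (fun z => h z / stripWeight z) lowerStrip :=
    hd.div differentiable_stripWeight.differentiableOn fun z hz => stripWeight_ne_zero hz.2.le
  have hmul : ∀ {y : ℝ} {f : ℝ → ℂ}, AEStronglyMeasurable f volume →
      AEStronglyMeasurable (fun x => onLine stripWeight y x * f x) volume := fun hf =>
    (continuous_onLine_stripWeight _).aestronglyMeasurable.mul hf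
  have key := tendsto_integral_mul_of_tendsto_eLpNorm (l := l)
    (f := fun y x => onLine (fun z => h z / stripWeight z) y x)
    (g := fun y x => onLine stripWeight y x * q y x)
    (f₀ := fun x => v x / onLine stripWeight y₀ x)
    (g₀ := fun x => onLine stripWeight y₀ x * q₀ x) (μ := volume) ?_ ?_ hv ?_ hlim ?_
  · refine (key.congr' ?_).trans (le_of_eq ?_)
    · filter_upwards [hev] with y hy
      congr 1; ext x
      rw [← mul_assoc]
      congr 1
      exact div_mul_cancel₀ _ (onLine_stripWeight_ne_zero hy.2.le x)
    · congr 2; ext x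
      rw [← mul_assoc, div_mul_cancel₀ _ (onLine_stripWeight_ne_zero hy₀ x)]
  · filter_upwards [hev] with y hy
    exact ⟨(continuous_onLine_of_lowerStrip hFd hy).aestronglyMeasurable,
      (hb y hy).trans_lt hM.lt_top⟩
  · filter_upwards [hqm, hqb] with y h1 h2
    refine hbm.mono (hmul h1) (Eventually.of_forall fun x => ?_)
    exact (h2 x).trans (le_abs_self _)
  · refine hbm.mono (hmul hqm₀) (Eventually.of_forall fun x => ?_)
    exact (hqb₀ x).trans (le_abs_self _)
  · refine tendsto_eLpNorm_sub_of_dominated (hqm.mono fun y h => hmul h) (hmul hqm₀) hbm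
      (hqb.mono fun y h => Eventually.of_forall h) (Eventually.of_forall hqb₀)
      (Eventually.of_forall fun x => ?_)
    have : Continuous fun y : ℝ => onLine stripWeight y x := by
      unfold onLine stripWeight; fun_prop
    exact ((this.tendsto y₀).mono_left hl).mul (hq x)

theorem exists_memLp_bound_schwartz (φ : 𝓢(ℝ, ℂ)) : ∃ b : ℝ → ℝ, MemLp b 2 ∧
    ∀ y ∈ Icc (-1 : ℝ) 0, ∀ x, ‖onLine stripWeight y x * φ x‖ ≤ b x := by
  have h := fun x => SchwartzMap.one_add_le_sup_seminorm_apply (𝕜 := ℝ) (m := (4, 0)) (k := 4)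
    (n := 0) le_rfl le_rfl φ x
  simp only [norm_iteratedFDeriv_zero] at h
  set S := 2 ^ 4 * ((Finset.Iic (4, 0)).sup fun m => SchwartzMap.seminorm ℝ m.1 m.2) φ
  refine ⟨fun x => 9 * S * (1 + x ^ 2)⁻¹, (memLp_one_add_sq_inv (Or.inr (Or.inl rfl))).const_mul _,
    fun y hy x => ?_⟩
  have hx := h x
  have h1 : (1 + x ^ 2) ^ 2 * ‖φ x‖ ≤ S := by
    refine le_trans ?_ hx
    gcongr
    rw [Real.norm_eq_abs, show (4 : ℕ) = 2 * 2 by norm_num, pow_mul]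
    gcongr
    nlinarith [sq_abs x, abs_nonneg x]
  beta_reduce
  rw [norm_mul, ← div_eq_mul_inv, le_div_iff₀ (by positivity)]
  have h2 := norm_stripWeight_le hy x
  calc ‖onLine stripWeight y x‖ * ‖φ x‖ * (1 + x ^ 2)
      ≤ (9 * (1 + x ^ 2)) * ‖φ x‖ * (1 + x ^ 2) := by
        gcongr
        exact h2.trans (by nlinarith [sq_nonneg x])
    _ = 9 * ((1 + x ^ 2) ^ 2 * ‖φ x‖) := by ring
    _ ≤ 9 * S := by gcongr

namespace HasBoundary

variable {h : ℂ → ℂ} {v₀ v₁ : ℝ → ℂ}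

theorem isBoundaryValue_of_tendsto (H : HasBoundary h v₀ v₁) {p : ℝ≥0∞} {l : Filter ℝ}
    [l.IsCountablyGenerated] {y₀ : ℝ} (hl : l ≤ 𝓝 y₀) (hy₀ : y₀ ∈ Icc (-1 : ℝ) 0)
    (hev : ∀ᶠ y in l, y ∈ Ioo (-1 : ℝ) 0) {v : ℝ → ℂ} (hvp : MemLp v p)
    (hv : MemLp (fun x => v x / onLine stripWeight y₀ x) 2)
    (hlim : Tendsto (fun y => eLpNorm (fun x => onLine (fun z => h z / stripWeight z) y x -
      v x / onLine stripWeight y₀ x) 2 volume) l (𝓝 0)) : IsBoundaryValue p h l v := by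
  refine ⟨hvp, fun φ => ?_⟩
  obtain ⟨b, hb, hbb⟩ := exists_memLp_bound_schwartz φ
  obtain ⟨M, hM, hM'⟩ := H.bound₂
  have hnc : ∀ y x, ‖onLine stripWeight y x * conj (φ x)‖ = ‖onLine stripWeight y x * φ x‖ := by
    intro y x; simp
  have key := tendsto_integral_onLine_mul H.diff hl hy₀.2 hev hM hM' hv hlim
    (q := fun _ x => conj (φ x)) (q₀ := fun x => conj (φ x)) hb
    (Eventually.of_forall fun _ => (by fun_prop : Continuous _).aestronglyMeasurable)
    (by fun_prop : Continuous _).aestronglyMeasurable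
    (hev.mono fun y hy x => by rw [hnc]; exact hbb y ⟨hy.1.le, hy.2.le⟩ x)
    (fun x => by rw [hnc]; exact hbb y₀ hy₀ x) (fun x => tendsto_const_nhds)
  have := (Complex.continuous_conj.tendsto _).comp key
  simpa only [Function.comp_def, ← integral_conj, map_mul, Complex.conj_conj] using this

theorem isBoundaryValue_zero (H : HasBoundary h v₀ v₁) :
    IsBoundaryValue ∞ h (𝓝[<] (0 : ℝ)) v₀ :=
  H.isBoundaryValue_of_tendsto nhdsWithin_le_nhds (by simp) eventually_mem_Ioo_zero H.mem₀
    (memLp_div_stripWeight_of_top le_rfl H.mem₀) H.tendsto₀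

theorem isBoundaryValue_neg_one (H : HasBoundary h v₀ v₁) :
    IsBoundaryValue 2 h (𝓝[>] (-1 : ℝ)) v₁ :=
  H.isBoundaryValue_of_tendsto nhdsWithin_le_nhds (by simp) eventually_mem_Ioo_neg_one H.mem₁
    (memLp_div_stripWeight_of_two (by norm_num) H.mem₁) H.tendsto₁

/-- A function in the Hardy space is determined by its boundary value on `ℝ - i`. -/
theorem eqOn_of_ae_eq {g : ℂ → ℂ} {u₀ u₁ : ℝ → ℂ} (H : HasBoundary h v₀ v₁)
    (G : HasBoundary g u₀ u₁) (hvu : v₁ =ᵐ[volume] u₁) : EqOn h g lowerStrip := by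
  obtain ⟨M, hM, hMb⟩ := H.bound₁
  obtain ⟨M', hM', hMb'⟩ := H.bound₂
  obtain ⟨N, hN, hNb⟩ := G.bound₁
  obtain ⟨N', hN', hNb'⟩ := G.bound₂
  have hFd : DifferentiableOn ℂ (fun z => h z / stripWeight z) lowerStrip :=
    H.diff.div differentiable_stripWeight.differentiableOn fun z hz => stripWeight_ne_zero hz.2.le
  have hGd : DifferentiableOn ℂ (fun z => g z / stripWeight z) lowerStrip :=
    G.diff.div differentiable_stripWeight.differentiableOn fun z hz => stripWeight_ne_zero hz.2.le
  have hF : ∀ y ∈ Ioo (-1 : ℝ) 0,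
      AEStronglyMeasurable (onLine (fun z => h z / stripWeight z) y) volume := fun y hy =>
    (continuous_onLine_of_lowerStrip hFd hy).aestronglyMeasurable
  have hG : ∀ y ∈ Ioo (-1 : ℝ) 0,
      AEStronglyMeasurable (onLine (fun z => g z / stripWeight z) y) volume := fun y hy =>
    (continuous_onLine_of_lowerStrip hGd hy).aestronglyMeasurable
  obtain ⟨w₀, w₁, hw₀, hw₁, hl₀, hl₁, hz⟩ := exists_boundary_of_bounded (hFd.sub hGd)
    (M₁ := M + N) (M₂ := M' + N') (by finiteness) (by finiteness)
    (fun y hy => (eLpNorm_sub_le (hF y hy) (hG y hy) le_rfl).trans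
      (add_le_add (hMb y hy) (hNb y hy)))
    (fun y hy => (eLpNorm_sub_le (hF y hy) (hG y hy) (by norm_num)).trans
      (add_le_add (hMb' y hy) (hNb' y hy)))
  have h0 : eLpNorm w₁ 2 volume = 0 := by
    have hlim := (H.tendsto₁.add G.tendsto₁).add hl₁
    simp only [add_zero] at hlim
    refine le_antisymm (ge_of_tendsto hlim ?_) zero_le
    filter_upwards [eventually_mem_Ioo_neg_one] with y hy
    have a1 := aestronglyMeasurable_div_stripWeight (y := -1) (by norm_num) H.mem₁.1
    have a2 := aestronglyMeasurable_div_stripWeight (y := -1) (by norm_num) G.mem₁.1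
    have s1 := (hF y hy).sub a1
    have s2 := (hG y hy).sub a2
    have s3 := ((hF y hy).sub (hG y hy)).sub hw₁.1
    refine le_trans (le_of_eq ?_) ((eLpNorm_sub_le (s1.sub s2) s3 (by norm_num)).trans
      (add_le_add (eLpNorm_sub_le s1 s2 (by norm_num)) le_rfl))
    refine eLpNorm_congr_ae ?_
    filter_upwards [hvu] with x hx
    simp only [Pi.sub_apply, hx]
    ring
  rw [eLpNorm_eq_zero_iff hw₁.1 (by norm_num)] at h0
  intro z hzs
  have := hz h0 z hzs
  rw [Pi.sub_apply, sub_eq_zero] at this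
  exact (div_left_inj' (stripWeight_ne_zero hzs.2.le)).1 this

end HasBoundary

/-! ### Functions holomorphic beyond the closed strip -/

theorem lowerStrip_subset {s : ℝ} (hs : 1 < s) : lowerStrip ⊆ {z | |z.im| < s} := by
  rintro z ⟨h1, h2⟩
  rw [mem_ofPred_eq, abs_lt]
  constructor <;> linarith

/-- No genuine splitting is needed: after reflection, use g itself as the bounded part for y ≤ 1/2
and as the L² part for y ≥ 1/2. In each range the relevant factor 1/(1 − y) or 1/y is at most 2, and
the decay rate is at least π/4 in the second. -/
theorem mem_hardyLower_of_le {g : ℂ → ℂ} {s C : ℝ} (hs : 1 < s) (hC : 0 < C)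
    (hd : DifferentiableOn ℂ g {z | |z.im| < s})
    (hle : ∀ z : ℂ, |z.im| < s → ‖g z‖ ≤ C * Real.exp (Real.pi / 2 * z.im * |z.re|)) :
    g ∈ hardyLower ∞ 2 := by
  have hpi := Real.pi_pos
  have hlow := lowerStrip_subset hs
  have hup : ∀ z ∈ upperStrip, conj z ∈ {z : ℂ | |z.im| < s} := fun z hz => by
    have : |(conj z).im| < s := by
      rw [Complex.conj_im]; exact abs_lt.2 ⟨by linarith [hz.2], by linarith [hz.1]⟩
    exact this
  have hopen : IsOpen {z : ℂ | |z.im| < s} := isOpen_abs_im_lt s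
  have hdc : DifferentiableOn ℂ (fun z => conj (g (conj z))) upperStrip := by
    intro z hz
    have h1 := hd.differentiableAt (hopen.mem_nhds (hup z hz))
    exact (differentiableAt_conj_conj_iff.2 (by simpa using h1)).differentiableWithinAt
  refine ⟨hd.mono hlow, hdc, ?_⟩
  have hline : ∀ y ∈ Ioo (0 : ℝ) 1, Continuous (onLine (fun z => conj (g (conj z))) y) :=
    fun y hy => continuous_onLine (s := Ioo 0 1) hdc.continuousOn hy
  have hbd : ∀ y ∈ Ioo (0 : ℝ) 1, ∀ x, ‖onLine (fun z => conj (g (conj z))) y x‖ ≤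
      C * Real.exp (-(Real.pi / 2 * y) * |x|) := by
    intro y hy x
    have h1 := hle (conj (x + y * Complex.I)) (hup _ (by
      have : ((x : ℂ) + y * Complex.I).im = y := by simp
      exact ⟨by rw [this]; exact hy.1, by rw [this]; exact hy.2⟩))
    rw [onLine_apply, RCLike.norm_conj]
    refine h1.trans (le_of_eq ?_)
    simp
  set E : ℝ≥0∞ := eLpNorm (fun x : ℝ => C * Real.exp (-(Real.pi / 4) * |x|)) 2 volume with hE
  have hEt : E ≠ ∞ := ((memLp_two_exp_neg_mul_abs (by positivity)).const_mul C).2.ne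
  refine lt_of_le_of_lt (b := max (ENNReal.ofReal 2 * ENNReal.ofReal C) (ENNReal.ofReal 2 * E))
    (iSup₂_le fun y hy => ?_) (by finiteness)
  rcases le_total y (1 / 2) with h | h
  · have hle' : eLpNorm (onLine (fun z => conj (g (conj z))) y) ∞ volume ≤ ENNReal.ofReal C := by
      rw [eLpNorm_exponent_top]
      refine eLpNormEssSup_le_of_ae_bound (Eventually.of_forall fun x => ?_)
      refine (hbd y hy x).trans (mul_le_of_le_one_right hC.le (Real.exp_le_one_iff.2 ?_))
      have := mul_nonneg (mul_nonneg hpi.le hy.1.le) (abs_nonneg x)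
      linarith
    refine iInf_le_of_le (onLine (fun z => conj (g (conj z))) y) (iInf_le_of_le 0
      (iInf_le_of_le ⟨(hline y hy).aestronglyMeasurable, hle'.trans_lt ENNReal.ofReal_lt_top⟩
      (iInf_le_of_le MemLp.zero (iInf_le_of_le (by simp) ?_))))
    rw [eLpNorm_zero, mul_zero, add_zero]
    refine le_max_of_le_left ?_
    gcongr
    rw [div_le_iff₀ (by linarith [hy.2])]
    linarith
  · have hle' : eLpNorm (onLine (fun z => conj (g (conj z))) y) 2 volume ≤ E := by
      refine eLpNorm_mono_real fun x => (hbd y hy x).trans ?_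
      gcongr
      nlinarith
    refine iInf_le_of_le 0 (iInf_le_of_le (onLine (fun z => conj (g (conj z))) y)
      (iInf_le_of_le MemLp.zero
      (iInf_le_of_le ⟨(hline y hy).aestronglyMeasurable, hle'.trans_lt hEt.lt_top⟩
      (iInf_le_of_le (by simp) ?_))))
    rw [eLpNorm_zero, mul_zero, zero_add]
    refine le_max_of_le_right ?_
    gcongr
    rw [div_le_iff₀ hy.1]
    linarith

/-- Continuity across both edges gives pointwise convergence, and the weight supplies the dominating
function C/(1 + x²). -/
theorem hasBoundary_of_le {g : ℂ → ℂ} {s C : ℝ} (hs : 1 < s)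
    (hd : DifferentiableOn ℂ g {z | |z.im| < s})
    (hle : ∀ z : ℂ, |z.im| < s → ‖g z‖ ≤ C * Real.exp (Real.pi / 2 * z.im * |z.re|)) :
    HasBoundary g (onLine g 0) (onLine g (-1)) := by
  have hpi := Real.pi_pos
  have hC : 0 ≤ C := by
    have := (norm_nonneg _).trans (hle 0 (by simp; linarith))
    simpa using this
  have hlow := lowerStrip_subset hs
  have hI : ∀ y ∈ Icc (-1 : ℝ) 0, ∀ x : ℝ, |((x : ℂ) + y * Complex.I).im| < s := fun y hy x => by
    have : ((x : ℂ) + y * Complex.I).im = y := by simp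
    rw [this]; exact abs_lt.2 ⟨by linarith [hy.1], by linarith [hy.2]⟩
  have hcont : ∀ y ∈ Icc (-1 : ℝ) 0, Continuous (onLine g y) := fun y hy =>
    continuous_onLine (s := {y | |y| < s}) hd.continuousOn (by
      rw [mem_ofPred_eq, abs_lt]; constructor <;> linarith [hy.1, hy.2])
  have hb : ∀ y ∈ Icc (-1 : ℝ) 0, ∀ x, ‖onLine g y x‖ ≤ C * Real.exp (Real.pi / 2 * y * |x|) := by
    intro y hy x
    have := hle _ (hI y hy x)
    simpa [onLine_apply] using this
  have hbC : ∀ y ∈ Icc (-1 : ℝ) 0, ∀ x, ‖onLine g y x‖ ≤ C := fun y hy x =>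
    (hb y hy x).trans (mul_le_of_le_one_right hC (Real.exp_le_one_iff.2
      (mul_nonpos_of_nonpos_of_nonneg (mul_nonpos_of_nonneg_of_nonpos (by positivity) hy.2)
        (abs_nonneg x))))
  have hFb : ∀ y ∈ Icc (-1 : ℝ) 0, ∀ x, ‖onLine g y x / onLine stripWeight y x‖ ≤
      C * (1 + x ^ 2)⁻¹ := by
    intro y hy x
    rw [norm_div, div_eq_mul_inv]
    exact mul_le_mul (hbC y hy x) (inv_anti₀ (by positivity)
      (one_add_sq_le_norm_stripWeight hy.2 x)) (by positivity) hC
  have hlim : ∀ (l : Filter ℝ) (y₀ : ℝ), l.IsCountablyGenerated → y₀ ∈ Icc (-1 : ℝ) 0 → l ≤ 𝓝 y₀ →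
      (∀ᶠ y in l, y ∈ Ioo (-1 : ℝ) 0) →
      Tendsto (fun y => eLpNorm (fun x => onLine (fun z => g z / stripWeight z) y x -
        onLine g y₀ x / onLine stripWeight y₀ x) 2 volume) l (𝓝 0) := by
    intro l y₀ _ hy₀ hl hev
    have hm : ∀ y ∈ Icc (-1 : ℝ) 0,
        AEStronglyMeasurable (fun x => onLine g y x / onLine stripWeight y x) volume :=
      fun y hy => aestronglyMeasurable_div_stripWeight hy.2 (hcont y hy).aestronglyMeasurable
    have hev' := hev.mono fun y hy => Ioo_subset_Icc_self hy
    refine tendsto_eLpNorm_sub_of_dominated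
      (f := fun y x => onLine (fun z => g z / stripWeight z) y x)
      (b := fun x => C * (1 + x ^ 2)⁻¹) (hev'.mono hm) (hm y₀ hy₀)
      ((memLp_one_add_sq_inv (Or.inr (Or.inl rfl))).const_mul C)
      (hev'.mono fun y hy => Eventually.of_forall fun x => hFb y hy x)
      (Eventually.of_forall fun x => hFb y₀ hy₀ x) (Eventually.of_forall fun x => ?_)
    have hdiv : ContinuousAt (fun z => g z / stripWeight z) ((x : ℂ) + y₀ * Complex.I) :=
      ContinuousAt.div (hd.continuousOn.continuousAt ((isOpen_abs_im_lt s).mem_nhds (hI y₀ hy₀ x)))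
        continuous_stripWeight.continuousAt (onLine_stripWeight_ne_zero hy₀.2 x)
    have hv : Continuous fun y : ℝ => (x : ℂ) + y * Complex.I := by fun_prop
    exact (hdiv.tendsto.comp (hv.tendsto y₀)).mono_left hl
  have hmono : ∀ p : ℝ≥0∞, ∀ y ∈ Ioo (-1 : ℝ) 0,
      eLpNorm (onLine (fun z => g z / stripWeight z) y) p volume ≤
        eLpNorm (fun x : ℝ => C * (1 + x ^ 2)⁻¹) p volume := fun p y hy =>
    eLpNorm_mono_real fun x => hFb y (Ioo_subset_Icc_self hy) x
  refine ⟨hd.mono hlow, ?_, ?_, ⟨_, ?_, hmono 1⟩, ⟨_, ?_, hmono 2⟩, ?_, ?_⟩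
  · exact memLp_top_of_bound (hcont 0 (by simp)).aestronglyMeasurable C
      (Eventually.of_forall (hbC 0 (by simp)))
  · refine ((memLp_two_exp_neg_mul_abs (a := Real.pi / 2) (by positivity)).const_mul C).mono'
      (hcont (-1) (by simp)).aestronglyMeasurable (Eventually.of_forall fun x => ?_)
    have := hb (-1) (by simp) x
    rwa [mul_neg_one] at this
  · exact ((memLp_one_add_sq_inv (Or.inl rfl)).const_mul C).2.ne
  · exact ((memLp_one_add_sq_inv (Or.inr (Or.inl rfl))).const_mul C).2.ne
  · exact hlim _ 0 inferInstance (by simp) nhdsWithin_le_nhds eventually_mem_Ioo_zero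
  · exact hlim _ (-1) inferInstance (by simp) nhdsWithin_le_nhds eventually_mem_Ioo_neg_one

/-! ### The Poisson formula relative to the extremal function -/

/-- The Cauchy kernel of the strip, divided by the extremal function and modulated. -/
noncomputable def dualKernel (θ ω : ℝ) (H : ℂ → ℂ) (z : ℂ) : ℂ :=
  Complex.exp (Complex.I * ω * z) * stripKernel θ z / H z

theorem norm_exp_I_mul (ω x y : ℝ) :
    ‖Complex.exp (Complex.I * ω * (x + y * Complex.I))‖ = Real.exp (-(ω * y)) := by
  rw [Complex.norm_exp]
  congr 1
  simp

/-- Since π/2 > 3/2, one unit of the exponential rate pays for the quadratic weight and rate 1/2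
remains. This is what makes the dual kernel an admissible factor for weighted boundary values. -/
theorem weight_mul_exp_le (a x : ℝ) :
    (x ^ 2 + 9) * Real.exp (-(Real.pi / 2) * |x - a|) ≤
      18 * Real.exp (Real.pi / 2 * |a|) * Real.exp (-(1 / 2) * |x|) := by
  have h1 : x ^ 2 + 9 ≤ 18 * Real.exp |x| := by
    have := Real.quadratic_le_exp_of_nonneg (abs_nonneg x)
    nlinarith [sq_abs x, abs_nonneg x]
  have h2 : -(Real.pi / 2) * |x - a| ≤ Real.pi / 2 * |a| + -(3 / 2) * |x| := by
    have : |x| ≤ |x - a| + |a| := by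
      have := abs_add_le (x - a) a
      rwa [sub_add_cancel] at this
    nlinarith [Real.pi_gt_three, abs_nonneg x]
  calc (x ^ 2 + 9) * Real.exp (-(Real.pi / 2) * |x - a|)
      ≤ (18 * Real.exp |x|) * Real.exp (Real.pi / 2 * |a| + -(3 / 2) * |x|) := by gcongr
    _ = 18 * Real.exp (Real.pi / 2 * |a|) * (Real.exp |x| * Real.exp (-(3 / 2) * |x|)) := by
        rw [Real.exp_add]; ring
    _ = _ := by rw [← Real.exp_add]; congr 2; ring

theorem im_ofReal_add (x y : ℝ) : ((x : ℂ) + y * Complex.I).im = y := by simp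

theorem re_ofReal_add (x y : ℝ) : ((x : ℂ) + y * Complex.I).re = x := by simp

namespace IsExtremal

variable {θ s C : ℝ} {H : ℂ → ℂ}

theorem abs_lt_of_mem (E : IsExtremal θ H s C) {y : ℝ} (hy : y ∈ Icc (-1 : ℝ) 0) : |y| < s := by
  have := E.one_lt
  rw [abs_lt]; constructor <;> linarith [hy.1, hy.2]

theorem ne_zero (E : IsExtremal θ H s C) {z : ℂ} (hz : |z.im| < s) : H z ≠ 0 := by
  have := (Real.exp_pos _).trans_le (E.ge z hz)
  intro h
  simp [h] at this

theorem continuousAt (E : IsExtremal θ H s C) {z : ℂ} (hz : |z.im| < s) : ContinuousAt H z :=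
  (E.diff.differentiableAt ((isOpen_abs_im_lt s).mem_nhds hz)).continuousAt

theorem continuousAt_dualKernel (E : IsExtremal θ H s C) (hθ : θ ∈ Ioo (0 : ℝ) 1) (ω : ℝ) {z : ℂ}
    (hz : z.im ∈ Icc (-1 : ℝ) 0) (hne : z.im ≠ -θ) : ContinuousAt (dualKernel θ ω H) z := by
  have hk : ContinuousAt (stripKernel θ) z := by
    unfold stripKernel
    refine ContinuousAt.div (by fun_prop) (by fun_prop) ?_
    exact cosh_sub_cos_ne_zero hθ hz (by rintro rfl; simp at hne)
  unfold dualKernel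
  exact ContinuousAt.div (ContinuousAt.mul (by fun_prop) hk) (E.continuousAt (E.abs_lt_of_mem hz))
    (E.ne_zero (E.abs_lt_of_mem hz))

theorem continuous_onLine_dualKernel (E : IsExtremal θ H s C) (hθ : θ ∈ Ioo (0 : ℝ) 1) (ω : ℝ)
    {y : ℝ} (hy : y ∈ Icc (-1 : ℝ) 0) (hne : y ≠ -θ) : Continuous (onLine (dualKernel θ ω H) y) :=
  continuous_onLine (s := {y}) (fun z hz => (E.continuousAt_dualKernel hθ ω
    (by rw [mem_singleton_iff.1 hz]; exact hy)
    (by rw [mem_singleton_iff.1 hz]; exact hne)).continuousWithinAt) rfl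

/-- The Cauchy kernel decays like e^{-π|x|}, while 1/|H| grows at most like e^{π|x|/2} on the strip.
-/
theorem norm_dualKernel_le_of_one_lt (E : IsExtremal θ H s C) (hθ : θ ∈ Ioo (0 : ℝ) 1) (ω : ℝ)
    {x y : ℝ} (hy : y ∈ Icc (-1 : ℝ) 0) (hx : 1 < |x|) :
    ‖onLine (dualKernel θ ω H) y x‖ ≤
      2 * C * Real.exp |ω| * Real.exp (-(Real.pi / 2) * |x|) := by
  have hk := norm_stripKernel_le hθ (z := x + y * Complex.I) (by rwa [re_ofReal_add])
  rw [re_ofReal_add] at hk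
  have hge := E.ge (x + y * Complex.I) (by rw [im_ofReal_add]; exact E.abs_lt_of_mem hy)
  rw [im_ofReal_add, re_ofReal_add] at hge
  have hC := E.C_pos
  have h1 : ‖H (x + y * Complex.I)‖⁻¹ ≤ C * Real.exp (Real.pi / 2 * |x|) := by
    have hpos := E.ne_zero (z := x + y * Complex.I)
      (by rw [im_ofReal_add]; exact E.abs_lt_of_mem hy)
    have hn : 0 < ‖H (x + y * Complex.I)‖ := norm_pos_iff.2 hpos
    rw [inv_le_iff_one_le_mul₀ hn]
    have h2 : Real.exp (-(Real.pi / 2 * |x|)) ≤ C * ‖H (x + y * Complex.I)‖ := by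
      refine le_trans (Real.exp_le_exp.2 ?_) hge
      have := Real.pi_pos
      have : Real.pi / 2 * (-1) * |x| ≤ Real.pi / 2 * y * |x| := by gcongr; exact hy.1
      linarith
    calc (1 : ℝ) = Real.exp (-(Real.pi / 2 * |x|)) * Real.exp (Real.pi / 2 * |x|) := by
          rw [← Real.exp_add]; simp
      _ ≤ C * ‖H (x + y * Complex.I)‖ * Real.exp (Real.pi / 2 * |x|) := by gcongr
      _ = _ := by ring
  have h3 : Real.exp (-(ω * y)) ≤ Real.exp |ω| := by
    refine Real.exp_le_exp.2 ((neg_le_abs _).trans ?_)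
    rw [abs_mul]
    exact mul_le_of_le_one_right (abs_nonneg _) (abs_le.2 ⟨hy.1, hy.2.trans zero_le_one⟩)
  rw [onLine_apply, dualKernel, norm_div, norm_mul, norm_exp_I_mul, div_eq_mul_inv]
  calc Real.exp (-(ω * y)) * ‖stripKernel θ (x + y * Complex.I)‖ * ‖H (x + y * Complex.I)‖⁻¹
      ≤ Real.exp |ω| * (2 * Real.exp (-Real.pi * |x|)) * (C * Real.exp (Real.pi / 2 * |x|)) := by
        gcongr
    _ = 2 * C * Real.exp |ω| * (Real.exp (-Real.pi * |x|) * Real.exp (Real.pi / 2 * |x|)) := by ring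
    _ = _ := by rw [← Real.exp_add]; congr 2; ring

theorem exists_norm_dualKernel_le (E : IsExtremal θ H s C) (hθ : θ ∈ Ioo (0 : ℝ) 1) (ω : ℝ)
    {c d : ℝ} (hc : -1 ≤ c) (hd : d ≤ 0) (hne : -θ ∉ Icc c d) :
    ∃ B : ℝ, 0 < B ∧ ∀ y ∈ Icc c d, ∀ x : ℝ,
      ‖onLine (dualKernel θ ω H) y x‖ ≤ B * Real.exp (-(Real.pi / 2) * |x|) := by
  have hI : ∀ y ∈ Icc c d, y ∈ Icc (-1 : ℝ) 0 := fun y hy => ⟨hc.trans hy.1, hy.2.trans hd⟩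
  have hcomp : IsCompact (Icc (-1 : ℝ) 1 ×ℂ Icc c d) := isCompact_Icc.reProdIm isCompact_Icc
  have hcont : ContinuousOn (dualKernel θ ω H) (Icc (-1 : ℝ) 1 ×ℂ Icc c d) := fun z hz =>
    (E.continuousAt_dualKernel hθ ω (hI _ hz.2)
      (by rintro h; exact hne (h ▸ hz.2))).continuousWithinAt
  obtain ⟨D, hD⟩ := hcomp.exists_bound_of_continuousOn hcont
  have hpi := Real.pi_pos
  have hC := E.C_pos
  have hB0 : 0 < 2 * C * Real.exp |ω| := by positivity
  refine ⟨max (D * Real.exp (Real.pi / 2)) (2 * C * Real.exp |ω|), lt_max_of_lt_right hB0,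
    fun y hy x => ?_⟩
  by_cases hx : 1 < |x|
  · refine (E.norm_dualKernel_le_of_one_lt hθ ω (hI y hy) hx).trans ?_
    gcongr
    exact le_max_right _ _
  · push Not at hx
    have h1 : ‖onLine (dualKernel θ ω H) y x‖ ≤ D :=
      hD _ ⟨by simpa using abs_le.1 hx, by simpa using hy⟩
    have hD0 : 0 ≤ D := (norm_nonneg _).trans h1
    have h2 : (1 : ℝ) ≤ Real.exp (Real.pi / 2) * Real.exp (-(Real.pi / 2) * |x|) := by
      rw [← Real.exp_add]
      refine Real.one_le_exp ?_
      nlinarith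
    calc ‖onLine (dualKernel θ ω H) y x‖ ≤ D * 1 := by rwa [mul_one]
      _ ≤ D * (Real.exp (Real.pi / 2) * Real.exp (-(Real.pi / 2) * |x|)) := by gcongr
      _ = D * Real.exp (Real.pi / 2) * Real.exp (-(Real.pi / 2) * |x|) := by ring
      _ ≤ _ := by gcongr; exact le_max_left _ _

end IsExtremal

theorem norm_stripWeight_mul_le {B a y x : ℝ} (hB : 0 ≤ B) (hy : y ∈ Icc (-1 : ℝ) 0) {q : ℂ}
    (hq : ‖q‖ ≤ B * Real.exp (-(Real.pi / 2) * |x - a|)) :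
    ‖onLine stripWeight y x * q‖ ≤
      B * (18 * Real.exp (Real.pi / 2 * |a|)) * Real.exp (-(1 / 2) * |x|) := by
  have h1 := norm_stripWeight_le hy x
  have h2 := weight_mul_exp_le a x
  rw [norm_mul]
  calc ‖onLine stripWeight y x‖ * ‖q‖
      ≤ (x ^ 2 + 9) * (B * Real.exp (-(Real.pi / 2) * |x - a|)) := by
        gcongr
        exact h1
    _ = B * ((x ^ 2 + 9) * Real.exp (-(Real.pi / 2) * |x - a|)) := by ring
    _ ≤ B * (18 * Real.exp (Real.pi / 2 * |a|) * Real.exp (-(1 / 2) * |x|)) := by gcongr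
    _ = _ := by ring

namespace HasBoundary

variable {θ s C : ℝ} {H h : ℂ → ℂ} {v₀ v₁ : ℝ → ℂ}

theorem integral_sub_integral_dualKernel (hb : HasBoundary h v₀ v₁) (E : IsExtremal θ H s C)
    (hθ : θ ∈ Ioo (0 : ℝ) 1) (a ω : ℝ) {y₁ y₂ : ℝ} (h1 : -1 < y₁) (h1' : y₁ < -θ) (h2 : -θ < y₂)
    (h2' : y₂ < 0) :
    (∫ x, onLine h y₂ x * onLine (dualKernel θ ω H) y₂ (x - a)) -
      ∫ x, onLine h y₁ x * onLine (dualKernel θ ω H) y₁ (x - a) =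
      h (-θ * Complex.I + a) * Real.exp (ω * θ) / H (-θ * Complex.I) := by
  obtain ⟨M, hM, hMb⟩ := hb.bound₁
  -- The translation is put into h, so that the pole stays at −iθ and evaluates h at a − iθ.
  set Φ : ℂ → ℂ := fun z => h (z + a) * Complex.exp (Complex.I * ω * z) / H z with hΦ
  have hstrip : ∀ z : ℂ, z.im ∈ Icc y₁ y₂ → z + a ∈ lowerStrip := fun z hz => by
    have : (z + a).im = z.im := by simp
    exact ⟨by rw [this]; linarith [hz.1], by rw [this]; linarith [hz.2]⟩
  have hI : ∀ y ∈ Icc y₁ y₂, y ∈ Icc (-1 : ℝ) 0 := fun y hy =>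
    ⟨by linarith [hy.1], by linarith [hy.2]⟩
  have hΦd : DifferentiableOn ℂ Φ {z | z.im ∈ Icc y₁ y₂} := by
    intro z hz
    have e1 : DifferentiableAt ℂ (fun z => h (z + a)) z :=
      (hb.diff.differentiableAt (isOpen_lowerStrip.mem_nhds (hstrip z hz))).comp z
        (by fun_prop : DifferentiableAt ℂ (fun z : ℂ => z + a) z)
    have hz' : |z.im| < s := E.abs_lt_of_mem (hI _ hz)
    have e2 : DifferentiableAt ℂ H z := E.diff.differentiableAt ((isOpen_abs_im_lt s).mem_nhds hz')
    exact ((e1.mul (by fun_prop)).div e2 (E.ne_zero hz')).differentiableWithinAt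
  have hform : ∀ y x : ℝ, onLine (fun z => Φ z * stripKernel θ z) y x =
      onLine h y (x + a) * onLine (dualKernel θ ω H) y x := by
    intro y x
    simp only [onLine_apply, hΦ, dualKernel]
    rw [show ((x : ℂ) + y * Complex.I + a) = ((x + a : ℝ) : ℂ) + y * Complex.I by push_cast; ring]
    ring
  set B : ℝ := 2 * C * Real.exp |ω| with hB
  have hB0 : 0 ≤ B := by have := E.C_pos; positivity
  set B' : ℝ := B * (18 * Real.exp (Real.pi / 2 * |a|)) with hB'
  have hbound : ∀ y ∈ Icc y₁ y₂, ∫⁻ x in {x : ℝ | 1 < |x|},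
      ‖onLine (fun z => Φ z * stripKernel θ z) y x‖ₑ ≤ ENNReal.ofReal B' * M := by
    intro y hy
    have hy' : y ∈ Ioo (-1 : ℝ) 0 := ⟨by linarith [hy.1], by linarith [hy.2]⟩
    calc ∫⁻ x in {x : ℝ | 1 < |x|}, ‖onLine (fun z => Φ z * stripKernel θ z) y x‖ₑ
        ≤ ∫⁻ x in {x : ℝ | 1 < |x|}, ENNReal.ofReal B' *
            ‖onLine (fun z => h z / stripWeight z) y (x + a)‖ₑ := by
          refine setLIntegral_mono_ae' (measurableSet_lt measurable_const (by fun_prop))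
            (Eventually.of_forall fun x hx => ?_)
          have hk := E.norm_dualKernel_le_of_one_lt hθ ω (hI y hy) hx
          have hw := norm_stripWeight_mul_le (a := a) (x := x + a) hB0 (hI y hy)
            (by rw [add_sub_cancel_right]; exact hk)
          have hw' : ‖onLine stripWeight y (x + a) * onLine (dualKernel θ ω H) y x‖ ≤ B' :=
            hw.trans (mul_le_of_le_one_right (by positivity) (Real.exp_le_one_iff.2 (by
              nlinarith [abs_nonneg (x + a)])))
          have e : onLine (fun z => Φ z * stripKernel θ z) y x =
              (onLine stripWeight y (x + a) * onLine (dualKernel θ ω H) y x) *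
                onLine (fun z => h z / stripWeight z) y (x + a) := by
            rw [hform]
            have := onLine_stripWeight_ne_zero hy'.2.le (x + a)
            have e' : onLine (fun z => h z / stripWeight z) y (x + a) =
              onLine h y (x + a) / onLine stripWeight y (x + a) := rfl
            rw [e']
            field_simp
          rw [e, enorm_mul]
          gcongr
          rw [← ofReal_norm]
          exact ENNReal.ofReal_le_ofReal hw'
      _ ≤ ∫⁻ x, ENNReal.ofReal B' * ‖onLine (fun z => h z / stripWeight z) y (x + a)‖ₑ :=
          setLIntegral_le_lintegral _ _
      _ = ENNReal.ofReal B' * eLpNorm (onLine (fun z => h z / stripWeight z) y) 1 volume := by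
          rw [lintegral_const_mul' _ _ ENNReal.ofReal_ne_top, eLpNorm_one_eq_lintegral_enorm]
          congr 1
          exact lintegral_add_right_eq_self
            (fun x => ‖onLine (fun z => h z / stripWeight z) y x‖ₑ) a
      _ ≤ _ := by gcongr; exact hMb y hy'
  have key := integral_mul_stripKernel hθ h1.le h1' h2 h2'.le hΦd.continuousOn
    (hΦd.mono fun z hz => ⟨hz.1.le, hz.2.le⟩) (ENNReal.mul_ne_top ENNReal.ofReal_ne_top hM) hbound
  have hshift : ∀ y : ℝ, ∫ x, onLine h y x * onLine (dualKernel θ ω H) y (x - a) =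
      ∫ x, onLine (fun z => Φ z * stripKernel θ z) y x := by
    intro y
    rw [← integral_sub_right_eq_self (fun x => onLine (fun z => Φ z * stripKernel θ z) y x) a]
    congr 1; ext x
    rw [hform, sub_add_cancel]
  rw [hshift, hshift, key, hΦ]
  simp only
  congr 2
  rw [Complex.ofReal_exp]
  congr 1
  push_cast
  linear_combination (-(ω : ℂ) * θ) * Complex.I_sq

/-- The Poisson formula for functions in the Hardy space, relative to the extremal function. -/
theorem poisson (hb : HasBoundary h v₀ v₁) (E : IsExtremal θ H s C) (hθ : θ ∈ Ioo (0 : ℝ) 1)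
    (a ω : ℝ) :
    (∫ x, v₀ x * onLine (dualKernel θ ω H) 0 (x - a)) -
      ∫ x, v₁ x * onLine (dualKernel θ ω H) (-1) (x - a) =
      h (-θ * Complex.I + a) * Real.exp (ω * θ) / H (-θ * Complex.I) := by
  obtain ⟨M, hM, hMb⟩ := hb.bound₂
  have hlim : ∀ (l : Filter ℝ) (y₀ c d : ℝ) (v : ℝ → ℂ), l.IsCountablyGenerated → l ≤ 𝓝 y₀ →
      -1 ≤ c → d ≤ 0 → -θ ∉ Icc c d → y₀ ∈ Icc c d →
      (∀ᶠ y in l, y ∈ Ioo (-1 : ℝ) 0 ∧ y ∈ Icc c d) →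
      MemLp (fun x => v x / onLine stripWeight y₀ x) 2 →
      Tendsto (fun y => eLpNorm (fun x => onLine (fun z => h z / stripWeight z) y x -
        v x / onLine stripWeight y₀ x) 2 volume) l (𝓝 0) →
      Tendsto (fun y => ∫ x, onLine h y x * onLine (dualKernel θ ω H) y (x - a)) l
        (𝓝 (∫ x, v x * onLine (dualKernel θ ω H) y₀ (x - a))) := by
    intro l y₀ c d v _ hl hc hd hne hy₀ hev hv hvl
    obtain ⟨B, hB0, hB⟩ := E.exists_norm_dualKernel_le hθ ω hc hd hne
    have hI : ∀ y ∈ Icc c d, y ∈ Icc (-1 : ℝ) 0 := fun y hy => ⟨hc.trans hy.1, hy.2.trans hd⟩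
    have hneq : ∀ y ∈ Icc c d, y ≠ -θ := fun y hy e => hne (e ▸ hy)
    have hcont : ∀ y ∈ Icc c d,
        AEStronglyMeasurable (fun x => onLine (dualKernel θ ω H) y (x - a)) volume := fun y hy =>
      ((E.continuous_onLine_dualKernel hθ ω (hI y hy) (hneq y hy)).comp
        (continuous_sub_right a)).aestronglyMeasurable
    refine tendsto_integral_onLine_mul hb.diff hl (hI y₀ hy₀).2 (hev.mono fun y hy => hy.1) hM hMb
      hv hvl (q := fun y x => onLine (dualKernel θ ω H) y (x - a))
      ((memLp_two_exp_neg_mul_abs (a := 1 / 2) (by norm_num)).const_mul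
        (B * (18 * Real.exp (Real.pi / 2 * |a|))))
      (hev.mono fun y hy => hcont y hy.2) (hcont y₀ hy₀)
      (hev.mono fun y hy x => norm_stripWeight_mul_le hB0.le (hI y hy.2) (hB y hy.2 (x - a)))
      (fun x => norm_stripWeight_mul_le hB0.le (hI y₀ hy₀) (hB y₀ hy₀ (x - a))) (fun x => ?_)
    have h1 := E.continuousAt_dualKernel hθ ω (z := ((x - a : ℝ) : ℂ) + y₀ * Complex.I)
      (by rw [im_ofReal_add]; exact hI y₀ hy₀) (by rw [im_ofReal_add]; exact hneq y₀ hy₀)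
    have hv : Continuous fun y : ℝ => ((x - a : ℝ) : ℂ) + y * Complex.I := by fun_prop
    exact (h1.tendsto.comp (hv.tendsto y₀)).mono_left hl
  have hθ1 := hθ.1
  have hθ2 := hθ.2
  have ev0 : ∀ᶠ y in 𝓝[<] (0 : ℝ), y ∈ Ioo (-θ / 2) 0 := Ioo_mem_nhdsLT (by linarith)
  have ev1 : ∀ᶠ y in 𝓝[>] (-1 : ℝ), y ∈ Ioo (-1) (-(1 + θ) / 2) := Ioo_mem_nhdsGT (by linarith)
  have l0 := hlim (𝓝[<] 0) 0 (-θ / 2) 0 v₀ inferInstance nhdsWithin_le_nhds (by linarith) le_rfl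
    (by rintro ⟨h1, _⟩; linarith) ⟨by linarith, le_rfl⟩
    (ev0.mono fun y hy => ⟨⟨by linarith [hy.1], hy.2⟩, hy.1.le, hy.2.le⟩)
    (memLp_div_stripWeight_of_top le_rfl hb.mem₀) hb.tendsto₀
  have l1 := hlim (𝓝[>] (-1)) (-1) (-1) (-(1 + θ) / 2) v₁ inferInstance nhdsWithin_le_nhds le_rfl
    (by linarith) (by rintro ⟨_, h1⟩; linarith) ⟨le_rfl, by linarith⟩
    (ev1.mono fun y hy => ⟨⟨hy.1, by linarith [hy.2]⟩, hy.1.le, hy.2.le⟩)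
    (memLp_div_stripWeight_of_two (by norm_num) hb.mem₁) hb.tendsto₁
  -- The two heights tend to the edges independently, along a product filter; the difference of the
  -- integrals is constant by the residue formula.
  have hl := (l0.comp tendsto_fst).sub (l1.comp (tendsto_snd (f := 𝓝[<] (0 : ℝ))))
  refine tendsto_nhds_unique hl (Tendsto.congr' ?_ tendsto_const_nhds)
  filter_upwards [(tendsto_fst (f := 𝓝[<] (0 : ℝ)) (g := 𝓝[>] (-1 : ℝ))).eventually ev0,
    (tendsto_snd (f := 𝓝[<] (0 : ℝ)) (g := 𝓝[>] (-1 : ℝ))).eventually ev1] with p hp1 hp2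
  exact (hb.integral_sub_integral_dualKernel E hθ a ω hp2.1 (by linarith [hp2.2])
    (by linarith [hp1.1]) hp1.2).symm

end HasBoundary

/-! ### The sharp three lines inequality -/

/-- This is the reason for prescribing |H|² on ℝ − i: dividing the density by H gives a multiple of
conj H, hence an L² pairing with H itself. -/
theorem stripKernel_div_eq {θ : ℝ} (hθ : θ ∈ Ioo (0 : ℝ) 1) {c : ℂ} {x : ℝ}
    (hc : ‖c‖ ^ 2 = stripDensity θ x / θ) : (stripDensity θ x : ℂ) / c = θ * conj c := by
  have hp := stripDensity_pos hθ x
  have h0 := hθ.1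
  have hc0 : c ≠ 0 := by
    rintro rfl
    have : 0 < stripDensity θ x / θ := div_pos hp h0
    rw [← hc] at this
    simp at this
  rw [div_eq_iff hc0, mul_assoc, Complex.conj_mul', ← Complex.ofReal_pow, hc]
  push_cast
  rw [mul_div_cancel₀]
  exact_mod_cast h0.ne'

/-- The optimal choice is e^ω = A/B. If A = 0 or B = 0 no optimum exists, and the bound comes from ω
→ −∞ or ω → +∞ respectively. -/
theorem le_mul_rpow_mul_rpow {θ A B K X : ℝ} (hθ : θ ∈ Ioo (0 : ℝ) 1) (hA : 0 ≤ A) (hB : 0 ≤ B)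
    (h : ∀ ω : ℝ, X * Real.exp (ω * θ) ≤ K * ((1 - θ) * A + θ * Real.exp ω * B)) :
    X ≤ K * (A ^ (1 - θ) * B ^ θ) := by
  have h0 := hθ.1
  have h1 := hθ.2
  rcases hA.eq_or_lt with rfl | hA
  · rw [Real.zero_rpow (by linarith), zero_mul, mul_zero]
    have hlim : Tendsto (fun ω : ℝ => K * (θ * B) * Real.exp ((1 - θ) * ω)) atBot (𝓝 (K * (θ * B) * 0)) :=
      (Real.tendsto_exp_atBot.comp (tendsto_id.const_mul_atBot (by linarith))).const_mul _
    rw [mul_zero] at hlim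
    refine ge_of_tendsto hlim (Eventually.of_forall fun ω => ?_)
    have := h ω
    rw [mul_zero, zero_add] at this
    have e : Real.exp ω = Real.exp ((1 - θ) * ω) * Real.exp (ω * θ) := by
      rw [← Real.exp_add]; ring_nf
    rw [e] at this
    refine le_of_mul_le_mul_right (this.trans (le_of_eq (by ring))) (Real.exp_pos (ω * θ))
  rcases hB.eq_or_lt with rfl | hB
  · rw [Real.zero_rpow (by linarith), mul_zero, mul_zero]
    have hlim : Tendsto (fun ω : ℝ => K * ((1 - θ) * A) * Real.exp ((-θ) * ω)) atTop
        (𝓝 (K * ((1 - θ) * A) * 0)) :=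
      (Real.tendsto_exp_atBot.comp (tendsto_id.const_mul_atTop_of_neg (by linarith))).const_mul _
    rw [mul_zero] at hlim
    refine ge_of_tendsto hlim (Eventually.of_forall fun ω => ?_)
    have := h ω
    rw [mul_zero, add_zero] at this
    have e : Real.exp ((-θ) * ω) * Real.exp (ω * θ) = 1 := by
      rw [← Real.exp_add]; ring_nf; simp
    refine le_of_mul_le_mul_right (this.trans (le_of_eq ?_)) (Real.exp_pos (ω * θ))
    rw [mul_assoc _ (Real.exp _), e, mul_one]
  · have := h (Real.log (A / B))
    have e1 : Real.exp (Real.log (A / B)) = A / B := Real.exp_log (by positivity)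
    have e2 : Real.exp (Real.log (A / B) * θ) = (A / B) ^ θ := by
      rw [Real.rpow_def_of_pos (by positivity)]
    rw [e1, e2, mul_assoc θ, div_mul_cancel₀ _ hB.ne'] at this
    have hpos : 0 < (A / B) ^ θ := by positivity
    refine le_of_mul_le_mul_right (this.trans (le_of_eq ?_)) hpos
    rw [Real.div_rpow hA.le hB.le, Real.rpow_sub hA, Real.rpow_one]
    have : 0 < A ^ θ := by positivity
    have : 0 < B ^ θ := by positivity
    field_simp
    ring

namespace IsExtremal

variable {θ s C : ℝ} {H : ℂ → ℂ}

theorem continuous_onLine (E : IsExtremal θ H s C) {y : ℝ} (hy : |y| < s) :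
    Continuous (onLine H y) :=
  _root_.continuous_onLine (s := {y | |y| < s}) E.diff.continuousOn hy

theorem continuous_onLine_neg_one (E : IsExtremal θ H s C) : Continuous (onLine H (-1)) :=
  E.continuous_onLine (E.abs_lt_of_mem (by simp))

theorem eLpNorm_onLine_neg_one (E : IsExtremal θ H s C) (hθ : θ ∈ Ioo (0 : ℝ) 1) :
    eLpNorm (onLine H (-1)) 2 volume = 1 := by
  have h0 := hθ.1
  rw [eLpNorm_eq_lintegral_rpow_enorm_toReal two_ne_zero (by norm_num)]
  simp only [ENNReal.toReal_ofNat]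
  have e : ∀ x, ‖onLine H (-1) x‖ₑ ^ (2 : ℝ) = ENNReal.ofReal (stripDensity θ x / θ) := by
    intro x
    rw [← E.norm_onLine_neg_one x, ← ofReal_norm, ENNReal.ofReal_rpow_of_nonneg (norm_nonneg _)
      (by norm_num)]
    congr 1
    exact Real.rpow_natCast _ 2
  simp_rw [e]
  rw [← ofReal_integral_eq_lintegral_ofReal ((integrable_stripDensity hθ).div_const θ)
    (Eventually.of_forall fun x => (div_pos (stripDensity_pos hθ x) h0).le), integral_div,
    integral_stripDensity hθ, div_self h0.ne']
  simp

theorem norm_dualKernel_zero (E : IsExtremal θ H s C) (hθ : θ ∈ Ioo (0 : ℝ) 1) (ω x : ℝ) :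
    ‖onLine (dualKernel θ ω H) 0 x‖ = stripDensity (1 - θ) x := by
  have hk := stripKernel_onLine_zero (θ := θ) x
  have hn := E.norm_onLine_zero x
  rw [onLine_apply] at hk hn ⊢
  rw [dualKernel, norm_div, norm_mul, norm_exp_I_mul, hk, hn, Complex.norm_real,
    Real.norm_of_nonneg (stripDensity_pos (one_sub_mem_Ioo hθ) x).le]
  simp

theorem dualKernel_neg_one (E : IsExtremal θ H s C) (hθ : θ ∈ Ioo (0 : ℝ) 1) (ω x : ℝ) :
    onLine (dualKernel θ ω H) (-1) x =
      -(θ * Real.exp ω) * (Complex.exp (Complex.I * ω * x) * conj (onLine H (-1) x)) := by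
  have hk := stripKernel_onLine_neg_one (θ := θ) x
  have hn := stripKernel_div_eq hθ (E.norm_onLine_neg_one x)
  have e : onLine (dualKernel θ ω H) (-1) x =
      Complex.exp (Complex.I * ω * (x + ((-1 : ℝ) : ℂ) * Complex.I)) *
        onLine (stripKernel θ) (-1) x / onLine H (-1) x := rfl
  have e2 : Complex.exp (Complex.I * ω * (x + ((-1 : ℝ) : ℂ) * Complex.I)) =
      Real.exp ω * Complex.exp (Complex.I * ω * x) := by
    rw [Complex.ofReal_exp, ← Complex.exp_add]
    congr 1
    push_cast
    linear_combination (-(ω : ℂ)) * Complex.I_sq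
  rw [e, hk, mul_neg, neg_div, mul_div_assoc, hn, e2]
  ring

end IsExtremal

/-- The modulated translates of the boundary value of the extremal function. -/
noncomputable def modTranslate (u : ℝ → ℂ) (a ω x : ℝ) : ℂ :=
  Complex.exp (-(Complex.I * ω * (x - a))) * u (x - a)

theorem norm_modTranslate (u : ℝ → ℂ) (a ω x : ℝ) : ‖modTranslate u a ω x‖ = ‖u (x - a)‖ := by
  rw [modTranslate, norm_mul, Complex.norm_exp]
  simp

theorem eLpNorm_modTranslate {u : ℝ → ℂ} (hu : AEStronglyMeasurable u volume) (a ω : ℝ)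
    (p : ℝ≥0∞) : eLpNorm (modTranslate u a ω) p volume = eLpNorm u p volume := by
  rw [← eLpNorm_comp_measurePreserving hu (measurePreserving_sub_right volume a)]
  exact eLpNorm_congr_norm_ae (Eventually.of_forall fun x => norm_modTranslate u a ω x)

theorem continuous_modTranslate {u : ℝ → ℂ} (hu : Continuous u) (a ω : ℝ) :
    Continuous (modTranslate u a ω) := by
  unfold modTranslate
  exact Continuous.mul (by fun_prop) (hu.comp (continuous_sub_right a))

namespace HasBoundary

variable {θ s C : ℝ} {H h : ℂ → ℂ} {v₀ v₁ : ℝ → ℂ}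

theorem integral_dualKernel_neg_one (E : IsExtremal θ H s C) (hθ : θ ∈ Ioo (0 : ℝ) 1) (v : ℝ → ℂ)
    (a ω : ℝ) : ∫ x, v x * onLine (dualKernel θ ω H) (-1) (x - a) =
      -(θ * Real.exp ω) * ∫ x, v x * conj (modTranslate (onLine H (-1)) a ω x) := by
  rw [← integral_const_mul]
  congr 1; ext x
  rw [E.dualKernel_neg_one hθ, modTranslate, map_mul, ← Complex.exp_conj]
  simp only [map_neg, map_mul, Complex.conj_I, Complex.conj_ofReal, map_sub]
  push_cast
  ring_nf

theorem norm_le_toReal_eLpNorm_top {v : ℝ → ℂ} (hv : MemLp v ∞) :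
    ∀ᵐ x, ‖v x‖ ≤ (eLpNorm v ∞ volume).toReal := by
  have := hv.2.ne
  rw [eLpNorm_exponent_top] at this ⊢
  filter_upwards [ae_le_eLpNormEssSup (f := v) (μ := volume)] with x hx
  rw [← toReal_enorm]
  exact ENNReal.toReal_mono this hx

theorem norm_integral_dualKernel_zero_le (E : IsExtremal θ H s C) (hθ : θ ∈ Ioo (0 : ℝ) 1)
    {v : ℝ → ℂ} (hv : MemLp v ∞) (a ω : ℝ) :
    ‖∫ x, v x * onLine (dualKernel θ ω H) 0 (x - a)‖ ≤
      (1 - θ) * (eLpNorm v ∞ volume).toReal := by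
  have hi : Integrable fun x => (eLpNorm v ∞ volume).toReal * stripDensity (1 - θ) (x - a) :=
    ((integrable_stripDensity (one_sub_mem_Ioo hθ)).comp_sub_right a).const_mul _
  refine (norm_integral_le_of_norm_le hi ?_).trans (le_of_eq ?_)
  · filter_upwards [norm_le_toReal_eLpNorm_top hv] with x hx
    rw [norm_mul, E.norm_dualKernel_zero hθ]
    exact mul_le_mul_of_nonneg_right hx (stripDensity_pos (one_sub_mem_Ioo hθ) _).le
  · rw [integral_const_mul, integral_sub_right_eq_self (stripDensity (1 - θ)) a,
      integral_stripDensity (one_sub_mem_Ioo hθ), mul_comm]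

/-- Absolute values in the Poisson formula. The pairing on ℝ − i is kept rather than estimated,
because the characterisation of maximizers depends on it. -/
theorem norm_mul_exp_le (hb : HasBoundary h v₀ v₁) (E : IsExtremal θ H s C)
    (hθ : θ ∈ Ioo (0 : ℝ) 1) (a ω : ℝ) :
    ‖h (-θ * Complex.I + a)‖ * Real.exp (ω * θ) ≤ ‖H (-θ * Complex.I)‖ *
      ((1 - θ) * (eLpNorm v₀ ∞ volume).toReal +
        θ * Real.exp ω * ‖∫ x, v₁ x * conj (modTranslate (onLine H (-1)) a ω x)‖) := by
  have hw : |(-θ * Complex.I : ℂ).im| < s := by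
    have : (-θ * Complex.I : ℂ).im = -θ := by simp
    rw [this]
    exact E.abs_lt_of_mem ⟨by linarith [hθ.2], by linarith [hθ.1]⟩
  have hH : 0 < ‖H (-θ * Complex.I)‖ := norm_pos_iff.2 (E.ne_zero hw)
  have key := congrArg norm (hb.poisson E hθ a ω)
  rw [norm_div, norm_mul, Complex.norm_real, Real.norm_of_nonneg (Real.exp_pos _).le,
    eq_div_iff hH.ne'] at key
  rw [← key, mul_comm]
  refine mul_le_mul_of_nonneg_left ((norm_sub_le _ _).trans (add_le_add
    (norm_integral_dualKernel_zero_le E hθ hb.mem₀ a ω) ?_)) hH.le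
  rw [integral_dualKernel_neg_one E hθ, norm_mul, norm_neg, norm_mul, Complex.norm_real,
    Complex.norm_real, Real.norm_of_nonneg hθ.1.le, Real.norm_of_nonneg (Real.exp_pos _).le]

theorem norm_integral_modTranslate_le (hb : HasBoundary h v₀ v₁) (E : IsExtremal θ H s C)
    (hθ : θ ∈ Ioo (0 : ℝ) 1) (a ω : ℝ) :
    ‖∫ x, v₁ x * conj (modTranslate (onLine H (-1)) a ω x)‖ ≤ (eLpNorm v₁ 2 volume).toReal := by
  have hm := E.continuous_onLine_neg_one.aestronglyMeasurable (μ := volume)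
  have hn : eLpNorm (modTranslate (onLine H (-1)) a ω) 2 volume = 1 := by
    rw [eLpNorm_modTranslate hm, E.eLpNorm_onLine_neg_one hθ]
  have hmem : MemLp (modTranslate (onLine H (-1)) a ω) 2 :=
    ⟨(continuous_modTranslate E.continuous_onLine_neg_one a ω).aestronglyMeasurable,
      by rw [hn]; exact ENNReal.one_lt_top⟩
  have h1 := norm_integral_mul_le hb.mem₁ (MemLp.star hmem)
  have h2 : eLpNorm (star (modTranslate (onLine H (-1)) a ω)) 2 volume = 1 := by
    rw [← hn]
    exact eLpNorm_congr_norm_ae (Eventually.of_forall fun x => by simp)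
  rw [h2, ENNReal.toReal_one, mul_one] at h1
  exact h1

/-- The sharp three lines inequality. -/
theorem norm_le (hb : HasBoundary h v₀ v₁) (E : IsExtremal θ H s C) (hθ : θ ∈ Ioo (0 : ℝ) 1)
    (a : ℝ) : ‖h (-θ * Complex.I + a)‖ ≤ ‖H (-θ * Complex.I)‖ *
      ((eLpNorm v₀ ∞ volume).toReal ^ (1 - θ) * (eLpNorm v₁ 2 volume).toReal ^ θ) := by
  refine le_mul_rpow_mul_rpow hθ ENNReal.toReal_nonneg ENNReal.toReal_nonneg fun ω => ?_
  refine (hb.norm_mul_exp_le E hθ a ω).trans ?_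
  have := hθ.1
  gcongr
  exact hb.norm_integral_modTranslate_le E hθ a ω

/-- A fixed L² function is asymptotically orthogonal to translates running to infinity. This
compactness makes the supremum on the middle line attained. -/
theorem tendsto_integral_modTranslate (hb : HasBoundary h v₀ v₁) (E : IsExtremal θ H s C)
    (ω : ℝ) : Tendsto (fun a => ∫ x, v₁ x * conj (modTranslate (onLine H (-1)) a ω x))
      (cocompact ℝ) (𝓝 0) := by
  have : (cocompact ℝ).IsCountablyGenerated := by
    rw [cocompact_eq_atBot_atTop]; infer_instance
  -- Half the decay rate π/2 of H on ℝ − i: one half cuts off v₁, which then tends to 0 in L² as |a|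
  -- → ∞; the other half keeps the second factor bounded in L² uniformly in a.
  set c : ℝ := Real.pi / 4 with hc
  have hc0 : 0 < c := by have := Real.pi_pos; positivity
  set f : ℝ → ℝ → ℂ := fun a x => v₁ x * Real.exp (-c * |x - a|) with hf
  set g : ℝ → ℝ → ℂ := fun a x =>
    Real.exp (c * |x - a|) * conj (modTranslate (onLine H (-1)) a ω x) with hg
  have hfm : ∀ a, AEStronglyMeasurable (f a) volume := fun a =>
    hb.mem₁.1.mul (by fun_prop : Continuous _).aestronglyMeasurable
  have hfle : ∀ a x, ‖f a x‖ ≤ ‖v₁ x‖ := by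
    intro a x
    rw [hf, norm_mul, Complex.norm_real, Real.norm_of_nonneg (Real.exp_pos _).le]
    refine mul_le_of_le_one_right (norm_nonneg _) (Real.exp_le_one_iff.2 ?_)
    nlinarith [abs_nonneg (x - a)]
  have hfm2 : ∀ a, MemLp (f a) 2 := fun a =>
    hb.mem₁.mono (hfm a) (Eventually.of_forall (hfle a))
  have hlim : Tendsto (fun a => eLpNorm (fun x => f a x - 0) 2 volume) (cocompact ℝ) (𝓝 0) := by
    refine tendsto_eLpNorm_sub_of_dominated (f₀ := fun _ => 0) (Eventually.of_forall hfm)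
      aestronglyMeasurable_const hb.mem₁.norm
      (Eventually.of_forall fun a => Eventually.of_forall fun x => hfle a x)
      (Eventually.of_forall fun x => by simp) (Eventually.of_forall fun x => ?_)
    have h1 : Tendsto (fun a : ℝ => |x - a|) (cocompact ℝ) atTop := by
      have h2 := (tendsto_norm_cocompact_atTop (E := ℝ)).comp
        ((Homeomorph.subLeft x).isClosedEmbedding.tendsto_cocompact)
      simpa [Function.comp_def] using h2
    have h3 := Real.tendsto_exp_atBot.comp (h1.const_mul_atTop_of_neg (neg_lt_zero.2 hc0))
    have h4 := ((Complex.continuous_ofReal.tendsto _).comp h3).const_mul (v₁ x)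
    simpa [hf, Function.comp_def] using h4
  simp only [sub_zero] at hlim
  set D : ℝ → ℝ := fun x => C * Real.exp (-c * |x|) with hD
  have hDm : MemLp D 2 := (memLp_two_exp_neg_mul_abs hc0).const_mul C
  have hgle : ∀ a x, ‖g a x‖ ≤ D (x - a) := by
    intro a x
    have h1 := E.le (((x - a : ℝ) : ℂ) + ((-1 : ℝ) : ℂ) * Complex.I)
      (by rw [im_ofReal_add]; exact E.abs_lt_of_mem (by simp))
    rw [im_ofReal_add, re_ofReal_add] at h1
    rw [hg, norm_mul, Complex.norm_real, Real.norm_of_nonneg (Real.exp_pos _).le, RCLike.norm_conj,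
      norm_modTranslate, onLine_apply, hD]
    calc _ ≤ Real.exp (c * |x - a|) * (C * Real.exp (Real.pi / 2 * (-1) * |x - a|)) := by gcongr
      _ = C * (Real.exp (c * |x - a|) * Real.exp (Real.pi / 2 * (-1) * |x - a|)) := by ring
      _ = _ := by rw [← Real.exp_add, hc]; congr 2; ring
  have hgm : ∀ a, AEStronglyMeasurable (g a) volume := fun a => by
    have := continuous_modTranslate E.continuous_onLine_neg_one a ω
    exact (Continuous.mul (by fun_prop) (Complex.continuous_conj.comp this)).aestronglyMeasurable
  have hDt : ∀ a, eLpNorm (fun x => D (x - a)) 2 volume = eLpNorm D 2 volume := fun a =>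
    eLpNorm_comp_measurePreserving hDm.1 (measurePreserving_sub_right volume a)
  have hgn : ∀ a, eLpNorm (g a) 2 volume ≤ eLpNorm D 2 volume := fun a =>
    (eLpNorm_mono_real (hgle a)).trans (hDt a).le
  have hgm2 : ∀ a, MemLp (g a) 2 := fun a => ⟨hgm a, (hgn a).trans_lt hDm.2⟩
  have hlim' : Tendsto (fun a => (eLpNorm (f a) 2 volume).toReal * (eLpNorm D 2 volume).toReal)
      (cocompact ℝ) (𝓝 0) := by
    have := ((ENNReal.tendsto_toReal ENNReal.zero_ne_top).comp hlim).mul_const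
      (eLpNorm D 2 volume).toReal
    simpa [Function.comp_def] using this
  refine squeeze_zero_norm (fun a => ?_) hlim'
  have e : ∫ x, v₁ x * conj (modTranslate (onLine H (-1)) a ω x) = ∫ x, f a x * g a x := by
    congr 1; ext x
    simp only [hf, hg]
    have : (Real.exp (-c * |x - a|) : ℂ) * Real.exp (c * |x - a|) = 1 := by
      rw [← Complex.ofReal_mul, ← Real.exp_add]; simp
    linear_combination (-(v₁ x) * conj (modTranslate (onLine H (-1)) a ω x)) * this
  rw [e]
  refine (norm_integral_mul_le (hfm2 a) (hgm2 a)).trans ?_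
  gcongr
  · exact hDm.2.ne
  · exact hgn a

/-- Equality in the Cauchy-Schwarz step determines the boundary value on `ℝ - i`. -/
theorem ae_eq_of_norm_eq (hb : HasBoundary h v₀ v₁) (E : IsExtremal θ H s C)
    (hθ : θ ∈ Ioo (0 : ℝ) 1) {a ω : ℝ} (hB : eLpNorm v₁ 2 volume ≠ 0)
    (h : (eLpNorm v₁ 2 volume).toReal ≤
      ‖∫ x, v₁ x * conj (modTranslate (onLine H (-1)) a ω x)‖) :
    ∃ c : ℂ, c ≠ 0 ∧ v₁ =ᵐ[volume] fun x => c * modTranslate (onLine H (-1)) a ω x := by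
  have hm := E.continuous_onLine_neg_one.aestronglyMeasurable (μ := volume)
  have hn : eLpNorm (modTranslate (onLine H (-1)) a ω) 2 volume = 1 := by
    rw [eLpNorm_modTranslate hm, E.eLpNorm_onLine_neg_one hθ]
  have hmem : MemLp (modTranslate (onLine H (-1)) a ω) 2 :=
    ⟨(continuous_modTranslate E.continuous_onLine_neg_one a ω).aestronglyMeasurable,
      by rw [hn]; exact ENNReal.one_lt_top⟩
  have hle := le_antisymm (hb.norm_integral_modTranslate_le E hθ a ω) h
  set g := hmem.toLp _ with hg
  set v := hb.mem₁.toLp _ with hv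
  have hgn : ‖g‖ = 1 := by rw [hg, Lp.norm_toLp, hn, ENNReal.toReal_one]
  have hvn : ‖v‖ = (eLpNorm v₁ 2 volume).toReal := Lp.norm_toLp _ _
  have hin : inner ℂ g v = ∫ x, v₁ x * conj (modTranslate (onLine H (-1)) a ω x) := by
    rw [L2.inner_def]
    refine integral_congr_ae ?_
    filter_upwards [hmem.coeFn_toLp, hb.mem₁.coeFn_toLp] with x h1 h2
    rw [RCLike.inner_apply, h1, h2]
  have hv0 : v ≠ 0 := by
    rw [← norm_ne_zero_iff, hvn]
    exact ENNReal.toReal_ne_zero.2 ⟨hB, hb.mem₁.2.ne⟩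
  have hg0 : g ≠ 0 := by rw [← norm_ne_zero_iff, hgn]; exact one_ne_zero
  -- Equality in Cauchy-Schwarz between nonzero vectors, hence proportionality.
  have heq : ‖inner ℂ g v‖ = ‖g‖ * ‖v‖ := by rw [hin, hle, hgn, hvn, one_mul]
  obtain ⟨r, hr, hrv⟩ := (norm_inner_eq_norm_iff hg0 hv0).1 heq
  refine ⟨r, hr, ?_⟩
  have h1 := hb.mem₁.coeFn_toLp
  rw [← hv, hrv] at h1
  filter_upwards [h1, Lp.coeFn_smul r g, hmem.coeFn_toLp] with x a1 a2 a3
  rw [← a1, a2, Pi.smul_apply, smul_eq_mul, a3]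

end HasBoundary

/-! ### Maximizers of the three lines problem -/

theorem enorm_le_eLpNorm_top_of_continuous {f : ℝ → ℂ} (hf : Continuous f) (x : ℝ) :
    ‖f x‖ₑ ≤ eLpNorm f ∞ volume := by
  have hd : Dense {x | ‖f x‖ₑ ≤ eLpNorm f ∞ volume} := by
    refine Measure.dense_of_ae (μ := volume) ?_
    rw [eLpNorm_exponent_top]
    exact ae_le_eLpNormEssSup
  have hc : IsClosed {x | ‖f x‖ₑ ≤ eLpNorm f ∞ volume} :=
    isClosed_le (continuous_enorm.comp hf) continuous_const
  have : x ∈ closure {x | ‖f x‖ₑ ≤ eLpNorm f ∞ volume} := hd x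
  rwa [hc.closure_eq] at this

theorem boundaryValue_ae_eq {p : ℝ≥0∞} (hp : 1 ≤ p) {h : ℂ → ℂ} {l : Filter ℝ} [l.NeBot]
    {v : ℝ → ℂ} (hv : IsBoundaryValue p h l v) : boundaryValue p h l =ᵐ[volume] v := by
  have hex : ∃ v, IsBoundaryValue p h l v := ⟨v, hv⟩
  rw [boundaryValue, dif_pos hex]
  exact hex.choose_spec.ae_eq hp hv

theorem boundaryValue_congr {p : ℝ≥0∞} {h g : ℂ → ℂ} {l : Filter ℝ}
    (H : ∀ᶠ y in l, onLine h y = onLine g y) : boundaryValue p h l = boundaryValue p g l := by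
  have e : IsBoundaryValue p h l = IsBoundaryValue p g l := by
    ext v
    refine and_congr_right fun _ => forall_congr' fun φ => tendsto_congr' ?_
    filter_upwards [H] with y hy
    rw [hy]
  unfold boundaryValue
  rw [e]

theorem onLine_eq_of_eqOn {h g : ℂ → ℂ} (H : EqOn h g lowerStrip) {y : ℝ}
    (hy : y ∈ Ioo (-1 : ℝ) 0) : onLine h y = onLine g y := by
  ext x
  exact H (by simpa [lowerStrip] using hy)

theorem threeLinesRatio_congr {γ : ℝ} (hγ : 2 < γ) {h g : ℂ → ℂ} (H : EqOn h g lowerStrip) :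
    threeLinesRatio γ h = threeLinesRatio γ g := by
  have hθ : 2 / γ ∈ Ioo (0 : ℝ) 1 := ⟨by positivity, (div_lt_one (by linarith)).2 hγ⟩
  unfold threeLinesRatio
  rw [onLine_eq_of_eqOn H (y := -(2 / γ)) ⟨by linarith [hθ.2], by linarith [hθ.1]⟩,
    boundaryValue_congr (eventually_mem_Ioo_zero.mono fun y hy => onLine_eq_of_eqOn H hy),
    boundaryValue_congr (eventually_mem_Ioo_neg_one.mono fun y hy => onLine_eq_of_eqOn H hy)]

theorem mem_hardyLower_congr {p q : ℝ≥0∞} {h g : ℂ → ℂ} (H : EqOn h g lowerStrip)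
    (hg : g ∈ hardyLower p q) : h ∈ hardyLower p q := by
  have hc : EqOn (fun z => conj (h (conj z))) (fun z => conj (g (conj z))) upperStrip := by
    intro z hz
    simp only
    rw [H (by simpa [lowerStrip, upperStrip, and_comm, neg_lt_neg_iff] using hz)]
  refine ⟨hg.1.congr H, hg.2.1.congr hc, ?_⟩
  refine (le_of_eq ?_).trans_lt hg.2.2
  unfold hardyNorm
  refine iSup_congr fun y => iSup_congr fun hy => ?_
  have : onLine (fun z => conj (h (conj z))) y = onLine (fun z => conj (g (conj z))) y := by
    ext x
    exact hc (by simpa [upperStrip] using hy)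
  rw [this]

theorem mem_threeLinesDomain_congr {h g : ℂ → ℂ} (H : EqOn h g lowerStrip)
    (hg : g ∈ threeLinesDomain) : h ∈ threeLinesDomain := by
  obtain ⟨z, hz, hne⟩ := hg.2
  exact ⟨mem_hardyLower_congr H hg.1, z, hz, by rwa [H hz]⟩

theorem HasBoundary.threeLinesRatio_eq {h : ℂ → ℂ} {v₀ v₁ : ℝ → ℂ} (hb : HasBoundary h v₀ v₁)
    (γ : ℝ) : threeLinesRatio γ h = eLpNorm (onLine h (-(2 / γ))) ∞ volume /
      (eLpNorm v₀ ∞ volume ^ (1 - 2 / γ) * eLpNorm v₁ 2 volume ^ (2 / γ)) := by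
  unfold threeLinesRatio
  rw [eLpNorm_congr_ae (boundaryValue_ae_eq le_top hb.isBoundaryValue_zero),
    eLpNorm_congr_ae (boundaryValue_ae_eq one_le_two hb.isBoundaryValue_neg_one)]

theorem onLine_neg_apply (h : ℂ → ℂ) (θ x : ℝ) :
    onLine h (-θ) x = h (-θ * Complex.I + x) := by
  rw [onLine_apply, add_comm]; push_cast; rfl

namespace HasBoundary

variable {θ s C : ℝ} {H h : ℂ → ℂ} {v₀ v₁ : ℝ → ℂ}

/-- The sharp inequality holds at every height, each with its own extremal function; take θ = −Im z.
Consequently both boundary norms of a competitor are positive. -/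
theorem eq_zero_of_mul_eq_zero (hb : HasBoundary h v₀ v₁)
    (h0 : eLpNorm v₀ ∞ volume = 0 ∨ eLpNorm v₁ 2 volume = 0) {z : ℂ} (hz : z ∈ lowerStrip) :
    h z = 0 := by
  have hθ : -z.im ∈ Ioo (0 : ℝ) 1 := ⟨by linarith [hz.2], by linarith [hz.1]⟩
  obtain ⟨H, s, C, E⟩ := exists_isExtremal hθ
  have h1 := hb.norm_le E hθ z.re
  have e : -((-z.im : ℝ) : ℂ) * Complex.I + z.re = z := by
    rw [add_comm]; push_cast; rw [neg_neg]; exact Complex.re_add_im z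
  rw [e] at h1
  rw [← norm_le_zero_iff]
  refine h1.trans (le_of_eq ?_)
  rcases h0 with h0 | h0
  · rw [h0, ENNReal.toReal_zero, Real.zero_rpow (by linarith [hθ.2])]; simp
  · rw [h0, ENNReal.toReal_zero, Real.zero_rpow hθ.1.ne']; simp

theorem ofReal_mul_rpow (hb : HasBoundary h v₀ v₁) (hθ : θ ∈ Ioo (0 : ℝ) 1) :
    eLpNorm v₀ ∞ volume ^ (1 - θ) * eLpNorm v₁ 2 volume ^ θ =
      ENNReal.ofReal ((eLpNorm v₀ ∞ volume).toReal ^ (1 - θ) *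
        (eLpNorm v₁ 2 volume).toReal ^ θ) := by
  rw [ENNReal.ofReal_mul (by positivity),
    ← ENNReal.ofReal_rpow_of_nonneg ENNReal.toReal_nonneg (by linarith [hθ.2]),
    ← ENNReal.ofReal_rpow_of_nonneg ENNReal.toReal_nonneg hθ.1.le,
    ENNReal.ofReal_toReal hb.mem₀.2.ne, ENNReal.ofReal_toReal hb.mem₁.2.ne]

theorem eLpNorm_onLine_le (hb : HasBoundary h v₀ v₁) (E : IsExtremal θ H s C)
    (hθ : θ ∈ Ioo (0 : ℝ) 1) : eLpNorm (onLine h (-θ)) ∞ volume ≤ ‖H (-θ * Complex.I)‖ₑ *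
      (eLpNorm v₀ ∞ volume ^ (1 - θ) * eLpNorm v₁ 2 volume ^ θ) := by
  rw [hb.ofReal_mul_rpow hθ, ← ofReal_norm, ← ENNReal.ofReal_mul (norm_nonneg _),
    eLpNorm_exponent_top]
  refine eLpNormEssSup_le_of_ae_bound (Eventually.of_forall fun x => ?_)
  rw [onLine_neg_apply]
  exact hb.norm_le E hθ x

theorem continuous_onLine (hb : HasBoundary h v₀ v₁) (hθ : θ ∈ Ioo (0 : ℝ) 1) :
    Continuous (onLine h (-θ)) :=
  continuous_onLine_of_lowerStrip hb.diff ⟨by linarith [hθ.2], by linarith [hθ.1]⟩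

/-- The supremum over the line is attained by an extremal competitor. -/
theorem exists_norm_eq (hb : HasBoundary h v₀ v₁) (E : IsExtremal θ H s C)
    (hθ : θ ∈ Ioo (0 : ℝ) 1) (hA : eLpNorm v₀ ∞ volume ≠ 0) (hB : eLpNorm v₁ 2 volume ≠ 0)
    (hK : ‖H (-θ * Complex.I)‖ₑ * (eLpNorm v₀ ∞ volume ^ (1 - θ) * eLpNorm v₁ 2 volume ^ θ) ≤
      eLpNorm (onLine h (-θ)) ∞ volume) :
    ∃ a ω : ℝ, (eLpNorm v₁ 2 volume).toReal ≤
      ‖∫ x, v₁ x * conj (modTranslate (onLine H (-1)) a ω x)‖ := by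
  have hw : |(-θ * Complex.I : ℂ).im| < s := by
    have : (-θ * Complex.I : ℂ).im = -θ := by simp
    rw [this]
    exact E.abs_lt_of_mem ⟨by linarith [hθ.2], by linarith [hθ.1]⟩
  have hH : 0 < ‖H (-θ * Complex.I)‖ := norm_pos_iff.2 (E.ne_zero hw)
  rw [hb.ofReal_mul_rpow hθ, ← ofReal_norm, ← ENNReal.ofReal_mul (norm_nonneg _)] at hK
  set A := (eLpNorm v₀ ∞ volume).toReal with hA'
  set B := (eLpNorm v₁ 2 volume).toReal with hB'
  set K := ‖H (-θ * Complex.I)‖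
  have hA0 : 0 < A := ENNReal.toReal_pos hA hb.mem₀.2.ne
  have hB0 : 0 < B := ENNReal.toReal_pos hB hb.mem₁.2.ne
  have h0 := hθ.1
  have h1 := hθ.2
  -- This modulation balances A against e^ω B; with it the extremal value of |h| e^{ωθ} is exactly K
  -- A.
  set ω := Real.log (A / B) with hω
  have e1 : Real.exp ω = A / B := Real.exp_log (by positivity)
  have e2 : K * (A ^ (1 - θ) * B ^ θ) * Real.exp (ω * θ) = K * A := by
    have : Real.exp (ω * θ) = (A / B) ^ θ := by rw [Real.rpow_def_of_pos (by positivity)]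
    rw [this, Real.div_rpow hA0.le hB0.le, Real.rpow_sub hA0, Real.rpow_one]
    have : 0 < A ^ θ := by positivity
    have : 0 < B ^ θ := by positivity
    field_simp
  set f : ℝ → ℝ := fun a => ‖onLine h (-θ) a‖ * Real.exp (ω * θ) with hf
  have hfc : Continuous f := ((hb.continuous_onLine hθ).norm).mul_const _
  have hsup : ∀ M, (∀ a, f a ≤ M) → K * A ≤ M := by
    intro M hM
    have hM0 : 0 ≤ M * (Real.exp (ω * θ))⁻¹ :=
      mul_nonneg ((by positivity : 0 ≤ f 0).trans (hM 0)) (by positivity)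
    have : eLpNorm (onLine h (-θ)) ∞ volume ≤ ENNReal.ofReal (M * (Real.exp (ω * θ))⁻¹) := by
      rw [eLpNorm_exponent_top]
      refine eLpNormEssSup_le_of_ae_bound (Eventually.of_forall fun x => ?_)
      rw [← div_eq_mul_inv, le_div_iff₀ (Real.exp_pos _)]
      exact hM x
    have := (ENNReal.ofReal_le_ofReal_iff hM0).1 (hK.trans this)
    rw [← e2]
    rwa [← div_eq_mul_inv, le_div_iff₀ (Real.exp_pos _)] at this
  have hle : ∀ a, f a ≤ K * ((1 - θ) * A + θ * (A / B) *
      ‖∫ x, v₁ x * conj (modTranslate (onLine H (-1)) a ω x)‖) := by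
    intro a
    have := hb.norm_mul_exp_le E hθ a ω
    rw [e1] at this
    simpa only [hf, onLine_neg_apply] using this
  -- The supremum of f is at least K A, strictly above the limit K(1 − θ)A of its majorant at
  -- infinity. So f attains its maximum.
  obtain ⟨a₀, ha₀⟩ : ∃ a₀, K * ((1 - θ) * A) < f a₀ := by
    by_contra! hcon
    have := hsup _ hcon
    nlinarith [mul_pos hH (mul_pos h0 hA0)]
  have hlim : Tendsto (fun a => K * ((1 - θ) * A + θ * (A / B) *
      ‖∫ x, v₁ x * conj (modTranslate (onLine H (-1)) a ω x)‖)) (cocompact ℝ)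
      (𝓝 (K * ((1 - θ) * A + θ * (A / B) * ‖(0 : ℂ)‖))) :=
    (((hb.tendsto_integral_modTranslate E ω).norm.const_mul _).const_add _).const_mul _
  rw [norm_zero, mul_zero, add_zero] at hlim
  obtain ⟨a, ha⟩ := hfc.exists_forall_ge' a₀ ((hlim.eventually_lt_const ha₀).mono fun a h =>
    (hle a).trans h.le)
  refine ⟨a, ω, ?_⟩
  -- At the maximum point A ≤ (1 − θ)A + θ(A/B)·|pairing|, which forces |pairing| ≥ B.
  have h3 := le_of_mul_le_mul_left ((hsup _ ha).trans (hle a)) hH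
  have h4 : θ * A * B ≤ θ * A * ‖∫ x, v₁ x * conj (modTranslate (onLine H (-1)) a ω x)‖ := by
    have : θ * A ≤ θ * (A / B) * ‖∫ x, v₁ x * conj (modTranslate (onLine H (-1)) a ω x)‖ := by
      linarith
    calc θ * A * B ≤ _ := mul_le_mul_of_nonneg_right this hB0.le
      _ = _ := by field_simp
  exact le_of_mul_le_mul_left h4 (by positivity)

end HasBoundary

/-! ### Symmetries and the classification of maximizers -/

/-- The action of the symmetries of the three lines problem. -/
noncomputable def orbitMap (α ω : ℝ) (β : ℂ) (h : ℂ → ℂ) (z : ℂ) : ℂ :=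
  β * h (z - α) * Complex.exp (Complex.I * ω * z)

theorem norm_orbitMap (α ω : ℝ) (β : ℂ) (h : ℂ → ℂ) (z : ℂ) :
    ‖orbitMap α ω β h z‖ = ‖β‖ * ‖h (z - α)‖ * Real.exp (-(ω * z.im)) := by
  have := norm_exp_I_mul ω z.re z.im
  rw [Complex.re_add_im] at this
  rw [orbitMap, norm_mul, norm_mul, this]

theorem sub_ofReal_mem_lowerStrip {z : ℂ} (hz : z ∈ lowerStrip) (α : ℝ) :
    z - α ∈ lowerStrip := by
  simpa [lowerStrip] using hz

namespace IsExtremal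

variable {θ s C : ℝ} {H : ℂ → ℂ}

theorem differentiableOn_orbitMap (E : IsExtremal θ H s C) (α ω : ℝ) (β : ℂ) :
    DifferentiableOn ℂ (orbitMap α ω β H) {z | |z.im| < s} := by
  have h1 : DifferentiableOn ℂ (fun z : ℂ => H (z - α)) {z | |z.im| < s} :=
    E.diff.comp (by fun_prop) fun z hz => by simpa using hz
  exact (h1.const_mul β).mul (by fun_prop)

theorem norm_orbitMap_le (E : IsExtremal θ H s C) (α ω : ℝ) (β : ℂ) {z : ℂ} (hz : |z.im| < s) :
    ‖orbitMap α ω β H z‖ ≤ (‖β‖ * C * Real.exp (Real.pi / 2 * s * |α| + |ω| * s)) *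
      Real.exp (Real.pi / 2 * z.im * |z.re|) := by
  have h1 := E.le (z - α) (by simpa using hz)
  have e1 : (z - α : ℂ).im = z.im := by simp
  have e2 : (z - α : ℂ).re = z.re - α := by simp
  rw [e1, e2] at h1
  rw [norm_orbitMap]
  have hC := E.C_pos
  have key : Real.pi / 2 * z.im * |z.re - α| + -(ω * z.im) ≤
      Real.pi / 2 * s * |α| + |ω| * s + Real.pi / 2 * z.im * |z.re| := by
    have a1 : -(ω * z.im) ≤ |ω| * s := by
      calc -(ω * z.im) ≤ |ω * z.im| := neg_le_abs _
        _ = |ω| * |z.im| := abs_mul _ _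
        _ ≤ _ := by gcongr
    have a2 : z.im * (|z.re - α| - |z.re|) ≤ s * |α| := by
      calc z.im * (|z.re - α| - |z.re|) ≤ |z.im * (|z.re - α| - |z.re|)| := le_abs_self _
        _ = |z.im| * |(|z.re - α| - |z.re|)| := abs_mul _ _
        _ ≤ |z.im| * |α| := by
          have := abs_abs_sub_abs_le_abs_sub (z.re - α) z.re
          rw [sub_sub_cancel_left, abs_neg] at this
          gcongr
        _ ≤ _ := by gcongr
    nlinarith [Real.pi_pos]
  calc _ ≤ ‖β‖ * (C * Real.exp (Real.pi / 2 * z.im * |z.re - α|)) * Real.exp (-(ω * z.im)) := by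
        gcongr
    _ = ‖β‖ * C * Real.exp (Real.pi / 2 * z.im * |z.re - α| + -(ω * z.im)) := by
        rw [Real.exp_add]; ring
    _ ≤ ‖β‖ * C * Real.exp (Real.pi / 2 * s * |α| + |ω| * s + Real.pi / 2 * z.im * |z.re|) := by
        gcongr
    _ = _ := by rw [Real.exp_add]; ring

theorem hasBoundary_orbitMap (E : IsExtremal θ H s C) (α ω : ℝ) (β : ℂ) :
    HasBoundary (orbitMap α ω β H) (onLine (orbitMap α ω β H) 0)
      (onLine (orbitMap α ω β H) (-1)) :=
  hasBoundary_of_le E.one_lt (E.differentiableOn_orbitMap α ω β)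
    fun _ hz => E.norm_orbitMap_le α ω β hz

theorem orbitMap_mem_threeLinesDomain (E : IsExtremal θ H s C) (α ω : ℝ) {β : ℂ} (hβ : β ≠ 0) :
    orbitMap α ω β H ∈ threeLinesDomain := by
  have hC := E.C_pos
  refine ⟨mem_hardyLower_of_le E.one_lt (by positivity) (E.differentiableOn_orbitMap α ω β)
    fun _ hz => E.norm_orbitMap_le α ω β hz, -(1 / 2) * Complex.I, by simp [lowerStrip]; norm_num, ?_⟩
  refine mul_ne_zero (mul_ne_zero hβ (E.ne_zero ?_)) (Complex.exp_ne_zero _)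
  have := E.one_lt
  simp [abs_of_pos]; linarith

theorem norm_onLine_orbitMap (α ω : ℝ) (β : ℂ) (y x : ℝ) :
    ‖onLine (orbitMap α ω β H) y x‖ = ‖β‖ * Real.exp (-(ω * y)) * ‖onLine H y (x - α)‖ := by
  rw [onLine_apply, norm_orbitMap, im_ofReal_add, onLine_apply]
  push_cast
  rw [add_sub_right_comm]
  ring

theorem eLpNorm_orbitMap_zero (E : IsExtremal θ H s C) (α ω : ℝ) (β : ℂ) :
    eLpNorm (onLine (orbitMap α ω β H) 0) ∞ volume = ‖β‖ₑ := by
  have : eLpNorm (onLine (orbitMap α ω β H) 0) ∞ volume = eLpNorm (fun _ : ℝ => β) ∞ volume := by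
    refine eLpNorm_congr_norm_ae (Eventually.of_forall fun x => ?_)
    rw [norm_onLine_orbitMap, E.norm_onLine_zero]; simp
  rw [this, eLpNorm_exponent_top, eLpNormEssSup_const _ (NeZero.ne volume)]

theorem eLpNorm_orbitMap_neg_one (E : IsExtremal θ H s C) (hθ : θ ∈ Ioo (0 : ℝ) 1) (α ω : ℝ)
    (β : ℂ) : eLpNorm (onLine (orbitMap α ω β H) (-1)) 2 volume =
      ‖β‖ₑ * ENNReal.ofReal (Real.exp ω) := by
  have : eLpNorm (onLine (orbitMap α ω β H) (-1)) 2 volume =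
      eLpNorm ((β * Real.exp ω) • fun x => onLine H (-1) (x - α)) 2 volume := by
    refine eLpNorm_congr_norm_ae (Eventually.of_forall fun x => ?_)
    rw [norm_onLine_orbitMap, Pi.smul_apply, norm_smul, norm_mul, Complex.norm_real,
      Real.norm_of_nonneg (Real.exp_pos _).le]
    simp
  have h2 : eLpNorm (fun x => onLine H (-1) (x - α)) 2 volume = 1 := by
    rw [← E.eLpNorm_onLine_neg_one hθ]
    exact eLpNorm_comp_measurePreserving E.continuous_onLine_neg_one.aestronglyMeasurable
      (measurePreserving_sub_right volume α)
  rw [this, eLpNorm_const_smul, h2, mul_one, enorm_mul, ← ofReal_norm (Real.exp ω : ℂ),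
    Complex.norm_real, Real.norm_of_nonneg (Real.exp_pos _).le]

/-- The boundary norms are |β| and |β|e^ω, and at α − iθ the modulus is |β|e^{ωθ}K; the factors |β|
and e^{ωθ} cancel in the ratio. -/
theorem le_threeLinesRatio_orbitMap {γ : ℝ} (hγ : 2 < γ) (E : IsExtremal (2 / γ) H s C)
    (α ω : ℝ) {β : ℂ} (hβ : β ≠ 0) :
    ‖H (-((2 / γ : ℝ) : ℂ) * Complex.I)‖ₑ ≤ threeLinesRatio γ (orbitMap α ω β H) := by
  have hθ : 2 / γ ∈ Ioo (0 : ℝ) 1 := ⟨by positivity, (div_lt_one (by linarith)).2 hγ⟩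
  have hb := E.hasBoundary_orbitMap α ω β
  rw [hb.threeLinesRatio_eq, hb.ofReal_mul_rpow hθ, E.eLpNorm_orbitMap_zero,
    E.eLpNorm_orbitMap_neg_one hθ]
  set θ := 2 / γ
  have hβ' : 0 < ‖β‖ := norm_pos_iff.2 hβ
  have e : ENNReal.ofReal (‖β‖ₑ.toReal ^ (1 - θ) *
      (‖β‖ₑ * ENNReal.ofReal (Real.exp ω)).toReal ^ θ) =
      ENNReal.ofReal (‖β‖ * Real.exp (ω * θ)) := by
    congr 1
    rw [ENNReal.toReal_mul, toReal_enorm, ENNReal.toReal_ofReal (Real.exp_pos _).le,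
      Real.mul_rpow hβ'.le (Real.exp_pos _).le, ← mul_assoc, ← Real.rpow_add hβ', ← Real.exp_mul]
    simp
  rw [e, ENNReal.le_div_iff_mul_le (Or.inl (ENNReal.ofReal_pos.2 (by positivity)).ne') (Or.inl ENNReal.ofReal_ne_top)]
  have h1 := enorm_le_eLpNorm_top_of_continuous (hb.continuous_onLine hθ) α
  refine (le_of_eq ?_).trans h1
  rw [← ofReal_norm, ← ofReal_norm, ← ENNReal.ofReal_mul (norm_nonneg _), norm_onLine_orbitMap,
    sub_self, onLine_neg_apply]
  congr 1
  simp
  ring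

end IsExtremal

theorem threeLinesRatio_le {γ s C : ℝ} {H h : ℂ → ℂ} (hγ : 2 < γ) (E : IsExtremal (2 / γ) H s C)
    (hh : h ∈ threeLinesDomain) :
    threeLinesRatio γ h ≤ ‖H (-((2 / γ : ℝ) : ℂ) * Complex.I)‖ₑ := by
  have hθ : 2 / γ ∈ Ioo (0 : ℝ) 1 := ⟨by positivity, (div_lt_one (by linarith)).2 hγ⟩
  obtain ⟨v₀, v₁, hb⟩ := exists_hasBoundary hh.1
  rw [hb.threeLinesRatio_eq]
  exact ENNReal.div_le_of_le_mul (hb.eLpNorm_onLine_le E hθ)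

theorem exists_eqOn_orbitMap {γ s C : ℝ} {H h : ℂ → ℂ} (hγ : 2 < γ)
    (E : IsExtremal (2 / γ) H s C) (hh : h ∈ threeLinesDomain)
    (hK : ‖H (-((2 / γ : ℝ) : ℂ) * Complex.I)‖ₑ ≤ threeLinesRatio γ h) :
    ∃ (α ω : ℝ) (β : ℂ), β ≠ 0 ∧ EqOn h (orbitMap α ω β H) lowerStrip := by
  have hθ : 2 / γ ∈ Ioo (0 : ℝ) 1 := ⟨by positivity, (div_lt_one (by linarith)).2 hγ⟩
  obtain ⟨v₀, v₁, hb⟩ := exists_hasBoundary hh.1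
  obtain ⟨z, hz, hne⟩ := hh.2
  have hA : eLpNorm v₀ ∞ volume ≠ 0 := fun h0 => hne (hb.eq_zero_of_mul_eq_zero (.inl h0) hz)
  have hB : eLpNorm v₁ 2 volume ≠ 0 := fun h0 => hne (hb.eq_zero_of_mul_eq_zero (.inr h0) hz)
  rw [hb.threeLinesRatio_eq, ENNReal.le_div_iff_mul_le] at hK
  rotate_left
  · left
    exact mul_ne_zero (ENNReal.rpow_pos (pos_iff_ne_zero.2 hA) hb.mem₀.2.ne).ne'
      (ENNReal.rpow_pos (pos_iff_ne_zero.2 hB) hb.mem₁.2.ne).ne'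
  · left
    exact ENNReal.mul_ne_top
      (ENNReal.rpow_ne_top_of_nonneg (by linarith [hθ.2]) hb.mem₀.2.ne)
      (ENNReal.rpow_ne_top_of_nonneg hθ.1.le hb.mem₁.2.ne)
  obtain ⟨a, ω, h1⟩ := hb.exists_norm_eq E hθ hA hB hK
  obtain ⟨c, hc, h2⟩ := hb.ae_eq_of_norm_eq E hθ hB h1
  -- On ℝ − i the factor e^{-iωz} equals e^{-ω}e^{-iωx}. The constant e^ω compensates for the former
  -- and e^{iωa} accounts for the translation in e^{-iω(x−a)}.
  refine ⟨a, -ω, c * Complex.exp (Complex.I * ω * a) * Complex.exp ω,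
    mul_ne_zero (mul_ne_zero hc (Complex.exp_ne_zero _)) (Complex.exp_ne_zero _), ?_⟩
  refine hb.eqOn_of_ae_eq (E.hasBoundary_orbitMap _ _ _) ?_
  filter_upwards [h2] with x hx
  rw [hx, modTranslate, onLine_apply, onLine_apply, orbitMap]
  have e : Complex.exp (-(Complex.I * ω * (x - a))) = Complex.exp (Complex.I * ω * a) *
      Complex.exp ω * Complex.exp (Complex.I * (-ω : ℝ) * (x + ((-1 : ℝ) : ℂ) * Complex.I)) := by
    rw [← Complex.exp_add, ← Complex.exp_add]
    congr 1
    push_cast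
    linear_combination (-(ω : ℂ)) * Complex.I_sq
  rw [e, Complex.ofReal_sub, add_sub_right_comm]
  ring

theorem isThreeLinesMaximizer_iff {γ s C : ℝ} {H h : ℂ → ℂ} (hγ : 2 < γ)
    (E : IsExtremal (2 / γ) H s C) : IsThreeLinesMaximizer γ h ↔
      ∃ (α ω : ℝ) (β : ℂ), β ≠ 0 ∧ EqOn h (orbitMap α ω β H) lowerStrip := by
  constructor
  · rintro ⟨hh, hmax⟩
    refine exists_eqOn_orbitMap hγ E hh ?_
    exact (E.le_threeLinesRatio_orbitMap hγ 0 0 one_ne_zero).trans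
      (hmax (E.orbitMap_mem_threeLinesDomain 0 0 one_ne_zero))
  · rintro ⟨α, ω, β, hβ, heq⟩
    refine ⟨mem_threeLinesDomain_congr heq (E.orbitMap_mem_threeLinesDomain α ω hβ), ?_⟩
    intro g hg
    change threeLinesRatio γ g ≤ threeLinesRatio γ h
    rw [threeLinesRatio_congr hγ heq]
    exact (threeLinesRatio_le hγ E hg).trans (E.le_threeLinesRatio_orbitMap hγ α ω hβ)

theorem isGreatest_threeLinesRatio {γ s C : ℝ} {H : ℂ → ℂ} (hγ : 2 < γ)
    (E : IsExtremal (2 / γ) H s C) : IsGreatest (threeLinesRatio γ '' threeLinesDomain)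
      ((‖H (-((2 / γ : ℝ) : ℂ) * Complex.I)‖₊ : ℝ≥0) : ℝ≥0∞) := by
  have hm := E.orbitMap_mem_threeLinesDomain 0 0 one_ne_zero
  refine ⟨⟨_, hm, le_antisymm (threeLinesRatio_le hγ E hm)
    (E.le_threeLinesRatio_orbitMap hγ 0 0 one_ne_zero)⟩, ?_⟩
  rintro _ ⟨h, hh, rfl⟩
  exact threeLinesRatio_le hγ E hh

/-- Every maximizer lies in the orbit of H, and the orbit maps compose and invert among themselves.
Exchanging a translation with a modulation costs only a constant phase, which is absorbed in β. -/
theorem isThreeLinesMaximizer_iff_orbitMap {γ : ℝ} (hγ : 2 < γ) {h : ℂ → ℂ}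
    (hh : IsThreeLinesMaximizer γ h) (h' : ℂ → ℂ) : IsThreeLinesMaximizer γ h' ↔
      ∃ (α ω : ℝ) (β : ℂ), β ≠ 0 ∧ EqOn h' (orbitMap α ω β h) lowerStrip := by
  have hθ : 2 / γ ∈ Ioo (0 : ℝ) 1 := ⟨by positivity, (div_lt_one (by linarith)).2 hγ⟩
  obtain ⟨H, s, C, E⟩ := exists_isExtremal hθ
  obtain ⟨a, w, b, hb, heq⟩ := (isThreeLinesMaximizer_iff hγ E).1 hh
  rw [isThreeLinesMaximizer_iff hγ E]
  constructor
  · rintro ⟨a', w', b', hb', heq'⟩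
    refine ⟨a' - a, w' - w, b' / b * Complex.exp (Complex.I * w * (a' - a)),
      mul_ne_zero (div_ne_zero hb' hb) (Complex.exp_ne_zero _), fun z hz => ?_⟩
    rw [heq' hz, orbitMap, orbitMap, heq (sub_ofReal_mem_lowerStrip hz _), orbitMap]
    have e : Complex.exp (Complex.I * w' * z) = Complex.exp (Complex.I * w * (a' - a)) *
        Complex.exp (Complex.I * w * (z - (a' - a : ℝ))) *
        Complex.exp (Complex.I * (w' - w : ℝ) * z) := by
      rw [← Complex.exp_add, ← Complex.exp_add]; congr 1; push_cast; ring
    have e2 : z - (a' - a : ℝ) - a = z - a' := by push_cast; ring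
    rw [e, e2]
    field_simp
  · rintro ⟨α, ω, β, hβ, heq'⟩
    refine ⟨a + α, w + ω, β * b * Complex.exp (-(Complex.I * w * α)),
      mul_ne_zero (mul_ne_zero hβ hb) (Complex.exp_ne_zero _), fun z hz => ?_⟩
    rw [heq' hz, orbitMap, orbitMap, heq (sub_ofReal_mem_lowerStrip hz _), orbitMap]
    have e : Complex.exp (-(Complex.I * w * α)) * Complex.exp (Complex.I * (w + ω : ℝ) * z) =
        Complex.exp (Complex.I * w * (z - α)) * Complex.exp (Complex.I * ω * z) := by
      rw [← Complex.exp_add, ← Complex.exp_add]; congr 1; push_cast; ring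
    have e2 : z - α - a = z - (a + α : ℝ) := by push_cast; ring
    rw [e2]
    linear_combination (-(β * b * H (z - (a + α : ℝ)))) * e

/-! ### The primal problem in logarithmic coordinates -/

/-- Additive convolution on the line. -/
noncomputable def lineConv (n₁ n₂ : ℝ → ℂ) (u : ℝ) : ℂ := ∫ v, n₁ (u - v) * n₂ v

/-- The error term of the primal problem in logarithmic coordinates. -/
noncomputable def lineError (θ : ℝ) (n₁ n₂ : ℝ → ℂ) : ℝ≥0∞ :=
  ∫⁻ u, ‖((2 * Real.pi * θ : ℝ) : ℂ) * lineConv n₁ n₂ u - Real.exp (2 * Real.pi * θ * u)‖ₑ ^ 2 *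
    ENNReal.ofReal (Real.exp (-(4 * Real.pi * u)))

theorem measurableEmbedding_exp_mul {c : ℝ} (hc : 0 < c) :
    MeasurableEmbedding fun u : ℝ => Real.exp (c * u) := by
  refine Continuous.measurableEmbedding (by fun_prop) fun u v h => ?_
  exact mul_left_cancel₀ hc.ne' (Real.exp_injective h)

theorem mulHaar_eq_map {c : ℝ} (hc : 0 < c) :
    mulHaar = ENNReal.ofReal c • Measure.map (fun u : ℝ => Real.exp (c * u)) volume := by
  ext A hA
  have hr : (fun u : ℝ => Real.exp (c * u)) '' univ = Ioi 0 := by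
    rw [image_univ]
    ext t
    constructor
    · rintro ⟨u, rfl⟩; exact Real.exp_pos _
    · intro ht
      exact ⟨Real.log t / c, by simp only; rw [mul_div_cancel₀ _ hc.ne', Real.exp_log ht]⟩
  rw [mulHaar, withDensity_apply _ hA, Measure.smul_apply,
    Measure.map_apply (measurableEmbedding_exp_mul hc).measurable hA, smul_eq_mul,
    ← lintegral_indicator hA, ← hr,
    lintegral_image_eq_lintegral_abs_deriv_mul MeasurableSet.univ
      (f' := fun u => Real.exp (c * u) * c) ?_ (measurableEmbedding_exp_mul hc).injective.injOn]
  · have e : ∀ u : ℝ, ENNReal.ofReal |Real.exp (c * u) * c| *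
        A.indicator (fun s => ENNReal.ofReal s⁻¹) (Real.exp (c * u)) =
        ((fun u : ℝ => Real.exp (c * u)) ⁻¹' A).indicator (fun _ => ENNReal.ofReal c) u := by
      intro u
      by_cases hu : Real.exp (c * u) ∈ A
      · rw [indicator_of_mem hu, indicator_of_mem (by exact hu), ← ENNReal.ofReal_mul (abs_nonneg _),
          abs_of_pos (by positivity)]
        congr 1
        field_simp
      · rw [indicator_of_notMem hu, indicator_of_notMem (by exact hu), mul_zero]
    simp_rw [e]
    rw [Measure.restrict_univ,
      lintegral_indicator_const ((measurableEmbedding_exp_mul hc).measurable hA)]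
  · intro u _
    have := ((hasDerivAt_id u).const_mul c).exp
    simpa using this

theorem lintegral_mulHaar {c : ℝ} (hc : 0 < c) (f : ℝ → ℝ≥0∞) :
    ∫⁻ t, f t ∂mulHaar = ENNReal.ofReal c * ∫⁻ u, f (Real.exp (c * u)) := by
  rw [mulHaar_eq_map hc, lintegral_smul_measure, (measurableEmbedding_exp_mul hc).lintegral_map,
    smul_eq_mul]

theorem mulConv_exp {c : ℝ} (hc : 0 < c) (m₁ m₂ : ℝ → ℂ) (u : ℝ) :
    mulConv m₁ m₂ (Real.exp (c * u)) =
      c * lineConv (fun u => m₁ (Real.exp (c * u))) (fun u => m₂ (Real.exp (c * u))) u := by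
  rw [mulConv, mulHaar_eq_map hc, integral_smul_measure,
    (measurableEmbedding_exp_mul hc).integral_map, ENNReal.toReal_ofReal hc.le, lineConv,
    Complex.real_smul]
  simp_rw [← Real.exp_sub, mul_sub]

/-- The rate 2πθ is chosen because θγ = 2: then t becomes e^{2πθu} and t^{-γ} becomes e^{-4πu}, the
exponentials produced by moving a Fourier transform from ℝ to the lines at heights −θ and −1. -/
theorem primalError_eq {γ : ℝ} (hγ : 0 < γ) (m₁ m₂ : ℝ → ℂ) :
    primalError γ m₁ m₂ = ENNReal.ofReal (2 * Real.pi * (2 / γ)) *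
      lineError (2 / γ) (fun u => m₁ (Real.exp (2 * Real.pi * (2 / γ) * u)))
        (fun u => m₂ (Real.exp (2 * Real.pi * (2 / γ) * u))) := by
  have hc : 0 < 2 * Real.pi * (2 / γ) := by have := Real.pi_pos; positivity
  rw [primalError, lintegral_mulHaar hc, lineError]
  congr 1
  refine lintegral_congr fun u => ?_
  rw [mulConv_exp hc, ← Real.exp_mul]
  congr 3
  field_simp
  ring

theorem eLpNorm_mulHaar {c : ℝ} (hc : 0 < c) (m : ℝ → ℂ) :
    eLpNorm m 2 mulHaar = ENNReal.ofReal c ^ (1 / 2 : ℝ) *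
      eLpNorm (fun u => m (Real.exp (c * u))) 2 volume := by
  rw [mulHaar_eq_map hc, eLpNorm_smul_measure_of_ne_top (by norm_num),
    (measurableEmbedding_exp_mul hc).eLpNorm_map_measure, smul_eq_mul]
  simp [Function.comp_def]

theorem eLpNorm_mulHaar_mul {c : ℝ} (hc : 0 < c) (m₁ m₂ : ℝ → ℂ) :
    eLpNorm m₁ 2 mulHaar * eLpNorm m₂ 2 mulHaar = ENNReal.ofReal c *
      (eLpNorm (fun u => m₁ (Real.exp (c * u))) 2 volume *
        eLpNorm (fun u => m₂ (Real.exp (c * u))) 2 volume) := by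
  rw [eLpNorm_mulHaar hc, eLpNorm_mulHaar hc, mul_mul_mul_comm,
    ← ENNReal.rpow_add_of_nonneg _ _ (by norm_num) (by norm_num)]
  norm_num

theorem memLp_mulHaar_iff {c : ℝ} (hc : 0 < c) {m : ℝ → ℂ} :
    MemLp m 2 mulHaar ↔ MemLp (fun u => m (Real.exp (c * u))) 2 := by
  have h0 : ENNReal.ofReal c ≠ 0 := (ENNReal.ofReal_pos.2 hc).ne'
  have h1 : MemLp m 2 mulHaar ↔ MemLp m 2 (Measure.map (fun u : ℝ => Real.exp (c * u)) volume) := by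
    rw [mulHaar_eq_map hc]
    refine ⟨fun h => ?_, fun h => h.smul_measure ENNReal.ofReal_ne_top⟩
    have := h.smul_measure (c := (ENNReal.ofReal c)⁻¹) (ENNReal.inv_ne_top.2 h0)
    rwa [smul_smul, ENNReal.inv_mul_cancel h0 ENNReal.ofReal_ne_top, one_smul] at this
  rw [h1, (measurableEmbedding_exp_mul hc).memLp_map_measure_iff]
  rfl

theorem le_primalConst {γ : ℝ} (hγ : 0 < γ) {c : ℝ≥0∞}
    (h : ∀ n₁ n₂ : ℝ → ℂ, MemLp n₁ 2 → MemLp n₂ 2 → lineError (2 / γ) n₁ n₂ ≠ ∞ →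
      c ≤ (ENNReal.ofReal (2 * Real.pi * (2 / γ)) * (eLpNorm n₁ 2 volume * eLpNorm n₂ 2 volume)) ^
        (γ - 2) * (ENNReal.ofReal (2 * Real.pi * (2 / γ)) * lineError (2 / γ) n₁ n₂)) :
    c ≤ primalConst γ := by
  have hc : 0 < 2 * Real.pi * (2 / γ) := by have := Real.pi_pos; positivity
  refine le_iInf fun m₁ => le_iInf fun m₂ => le_iInf fun h1 => le_iInf fun h2 => le_iInf fun h3 => ?_
  rw [primalError_eq hγ, eLpNorm_mulHaar_mul hc]
  refine h _ _ ((memLp_mulHaar_iff hc).1 h1) ((memLp_mulHaar_iff hc).1 h2) fun h4 => h3 ?_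
  rw [primalError_eq hγ, h4, ENNReal.mul_top (ENNReal.ofReal_pos.2 hc).ne']

theorem primalConst_le_of_memLp {γ : ℝ} {m₁ m₂ : ℝ → ℂ} (h1 : MemLp m₁ 2 mulHaar)
    (h2 : MemLp m₂ 2 mulHaar) (h3 : primalError γ m₁ m₂ ≠ ∞) : primalConst γ ≤
      (eLpNorm m₁ 2 mulHaar * eLpNorm m₂ 2 mulHaar) ^ (γ - 2) * primalError γ m₁ m₂ := by
  unfold primalConst
  refine (iInf_le _ m₁).trans ((iInf_le _ m₂).trans ?_)
  refine (iInf_le _ h1).trans ((iInf_le _ h2).trans ?_)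
  exact iInf_le _ h3

theorem primalConst_le {γ : ℝ} (hγ : 0 < γ) {n₁ n₂ : ℝ → ℂ} (h1 : MemLp n₁ 2) (h2 : MemLp n₂ 2)
    (h3 : lineError (2 / γ) n₁ n₂ ≠ ∞) : primalConst γ ≤
      (ENNReal.ofReal (2 * Real.pi * (2 / γ)) * (eLpNorm n₁ 2 volume * eLpNorm n₂ 2 volume)) ^
        (γ - 2) * (ENNReal.ofReal (2 * Real.pi * (2 / γ)) * lineError (2 / γ) n₁ n₂) := by
  have hc : 0 < 2 * Real.pi * (2 / γ) := by have := Real.pi_pos; positivity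
  set c := 2 * Real.pi * (2 / γ)
  have e : ∀ n : ℝ → ℂ, (fun u => (fun t => n (Real.log t / c)) (Real.exp (c * u))) = n := by
    intro n
    ext u
    simp only
    rw [Real.log_exp, mul_div_cancel_left₀ _ hc.ne']
  have hm : ∀ {n : ℝ → ℂ}, MemLp n 2 → MemLp (fun t => n (Real.log t / c)) 2 mulHaar := by
    intro n hn
    rw [memLp_mulHaar_iff hc, e]
    exact hn
  have he : primalError γ (fun t => n₁ (Real.log t / c)) (fun t => n₂ (Real.log t / c)) =
      ENNReal.ofReal c * lineError (2 / γ) n₁ n₂ := by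
    rw [primalError_eq hγ, e, e]
  have hfin : primalError γ (fun t => n₁ (Real.log t / c)) (fun t => n₂ (Real.log t / c)) ≠ ∞ := by
    rw [he]
    exact ENNReal.mul_ne_top ENNReal.ofReal_ne_top h3
  refine (primalConst_le_of_memLp (hm h1) (hm h2) hfin).trans (le_of_eq ?_)
  rw [he, eLpNorm_mulHaar_mul hc]
  simp only [e]

/-! ### Pairing convolutions with Fourier transforms -/

theorem integrable_mul_comp_sub {n₁ n₂ : ℝ → ℂ} (h1 : MemLp n₁ 2) (h2 : MemLp n₂ 2) (u : ℝ) :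
    Integrable fun v => n₁ (u - v) * n₂ v :=
  (h1.comp_measurePreserving (Measure.measurePreserving_sub_left volume u)).integrable_mul h2

theorem norm_lineConv_le {n₁ n₂ : ℝ → ℂ} (h1 : MemLp n₁ 2) (h2 : MemLp n₂ 2) (u : ℝ) :
    ‖lineConv n₁ n₂ u‖ ≤ (eLpNorm n₁ 2 volume).toReal * (eLpNorm n₂ 2 volume).toReal := by
  have hp := Measure.measurePreserving_sub_left (volume : Measure ℝ) u
  have := norm_integral_mul_le (h1.comp_measurePreserving hp) h2
  rwa [eLpNorm_comp_measurePreserving h1.1 hp] at this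

theorem lineConv_eq_convolution (n₁ n₂ : ℝ → ℂ) :
    lineConv n₁ n₂ = MeasureTheory.convolution n₂ n₁ (ContinuousLinearMap.mul ℂ ℂ) volume := by
  ext u
  simp only [lineConv, MeasureTheory.convolution, ContinuousLinearMap.mul_apply']
  simp_rw [mul_comm]

theorem integrable_lineConv {n₁ n₂ : ℝ → ℂ} (h1 : Integrable n₁) (h2 : Integrable n₂) :
    Integrable (lineConv n₁ n₂) := by
  rw [lineConv_eq_convolution]
  exact h2.integrable_convolution _ h1

theorem fourier_lineConv {n₁ n₂ : ℝ → ℂ} (h1 : Integrable n₁) (h2 : Integrable n₂) (ξ : ℝ) :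
    𝓕 (lineConv n₁ n₂) ξ = 𝓕 n₁ ξ * 𝓕 n₂ ξ := by
  rw [lineConv_eq_convolution, Real.fourier_mul_convolution_eq h2 h1, mul_comm]

theorem integral_mul_fourier_eq_flip {f g : ℝ → ℂ} (hf : Integrable f) (hg : Integrable g) :
    ∫ x, f x * 𝓕 g x = ∫ x, 𝓕 f x * g x := by
  have := VectorFourier.integral_fourierIntegral_smul_eq_flip (μ := (volume : Measure ℝ))
    (ν := (volume : Measure ℝ)) (f := f) (g := g) (L := innerₗ ℝ)
    Real.continuous_fourierChar (by exact continuous_inner) hf hg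
  rw [flip_innerₗ] at this
  exact this.symm

/-- Moving the transform onto the convolution turns the integral into that of 𝓕n₁ · 𝓕n₂ · f, where f
acts as a multiplier bounded by B; then Cauchy-Schwarz and Plancherel. -/
theorem norm_integral_lineConv_mul_fourier_le_of_integrable {n₁ n₂ f : ℝ → ℂ} {B : ℝ}
    (h1 : MemLp n₁ 2) (h2 : MemLp n₂ 2) (i1 : Integrable n₁) (i2 : Integrable n₂)
    (hf : Integrable f) (hB : ∀ x, ‖f x‖ ≤ B) :
    ‖∫ u, lineConv n₁ n₂ u * 𝓕 f u‖ ≤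
      B * ((eLpNorm n₁ 2 volume).toReal * (eLpNorm n₂ 2 volume).toReal) := by
  have hB0 : 0 ≤ B := (norm_nonneg _).trans (hB 0)
  rw [integral_mul_fourier_eq_flip (integrable_lineConv i1 i2) hf]
  have m1 := memLp_fourier i1 h1
  have m2 := memLp_fourier i2 h2
  have hle : ∀ x, ‖𝓕 n₁ x * f x‖ ≤ B * ‖𝓕 n₁ x‖ := fun x => by
    rw [norm_mul, mul_comm]
    exact mul_le_mul_of_nonneg_right (hB x) (norm_nonneg _)
  have m3 : MemLp (fun x => 𝓕 n₁ x * f x) 2 :=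
    m1.of_le_mul (m1.1.mul hf.1) (Eventually.of_forall hle)
  have e : ∫ x, 𝓕 (lineConv n₁ n₂) x * f x = ∫ x, (𝓕 n₁ x * f x) * 𝓕 n₂ x := by
    congr 1; ext x
    rw [fourier_lineConv i1 i2]; ring
  rw [e]
  refine (norm_integral_mul_le m3 m2).trans ?_
  have h3 : eLpNorm (fun x => 𝓕 n₁ x * f x) 2 volume ≤ ENNReal.ofReal B * eLpNorm n₁ 2 volume := by
    rw [← eLpNorm_fourier i1 h1]
    exact eLpNorm_le_mul_eLpNorm_of_ae_le_mul (Eventually.of_forall hle) 2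
  have h4 := ENNReal.toReal_mono (ENNReal.mul_ne_top ENNReal.ofReal_ne_top h1.2.ne) h3
  rw [ENNReal.toReal_mul, ENNReal.toReal_ofReal hB0] at h4
  rw [eLpNorm_fourier i2 h2, ← mul_assoc]
  exact mul_le_mul_of_nonneg_right h4 ENNReal.toReal_nonneg

/-- Truncation to the interval `[-k, k]`. -/
noncomputable def truncate (n : ℝ → ℂ) (k : ℕ) : ℝ → ℂ := (Icc (-(k : ℝ)) k).indicator n

theorem memLp_truncate {n : ℝ → ℂ} (h : MemLp n 2) (k : ℕ) : MemLp (truncate n k) 2 :=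
  h.indicator measurableSet_Icc

theorem integrable_truncate {n : ℝ → ℂ} (h : MemLp n 2) (k : ℕ) : Integrable (truncate n k) :=
  (integrable_indicator_iff measurableSet_Icc).2 ((h.restrict _).integrable one_le_two)

theorem norm_truncate_le (n : ℝ → ℂ) (k : ℕ) (x : ℝ) : ‖truncate n k x‖ ≤ ‖n x‖ :=
  norm_indicator_le_norm_self _ _

theorem toReal_eLpNorm_truncate_le {n : ℝ → ℂ} (h : MemLp n 2) (k : ℕ) :
    (eLpNorm (truncate n k) 2 volume).toReal ≤ (eLpNorm n 2 volume).toReal :=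
  ENNReal.toReal_mono h.2.ne (eLpNorm_indicator_le _)

theorem eventually_truncate_eq (n : ℝ → ℂ) (x : ℝ) : ∀ᶠ k in atTop, truncate n k x = n x := by
  filter_upwards [eventually_ge_atTop ⌈|x|⌉₊] with k hk
  refine indicator_of_mem ?_ _
  have : |x| ≤ k := (Nat.le_ceil _).trans (by exact_mod_cast hk)
  exact abs_le.1 this

theorem tendsto_lineConv_truncate {n₁ n₂ : ℝ → ℂ} (h1 : MemLp n₁ 2) (h2 : MemLp n₂ 2) (u : ℝ) :
    Tendsto (fun k => lineConv (truncate n₁ k) (truncate n₂ k) u) atTop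
      (𝓝 (lineConv n₁ n₂ u)) := by
  refine tendsto_integral_of_dominated_convergence (fun v => ‖n₁ (u - v) * n₂ v‖)
    (fun k => (integrable_mul_comp_sub (memLp_truncate h1 k) (memLp_truncate h2 k) u).1)
    (integrable_mul_comp_sub h1 h2 u).norm (fun k => Eventually.of_forall fun v => ?_)
    (Eventually.of_forall fun v => ?_)
  · rw [norm_mul, norm_mul]
    exact mul_le_mul (norm_truncate_le _ _ _) (norm_truncate_le _ _ _) (norm_nonneg _)
      (norm_nonneg _)
  · refine tendsto_const_nhds.congr' ?_
    filter_upwards [eventually_truncate_eq n₁ (u - v), eventually_truncate_eq n₂ v] with k a b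
    rw [a, b]

theorem aestronglyMeasurable_lineConv {n₁ n₂ : ℝ → ℂ} (h1 : MemLp n₁ 2) (h2 : MemLp n₂ 2) :
    AEStronglyMeasurable (lineConv n₁ n₂) volume :=
  aestronglyMeasurable_of_tendsto_ae atTop
    (fun k => (integrable_lineConv (integrable_truncate h1 k) (integrable_truncate h2 k)).1)
    (Eventually.of_forall fun u => tendsto_lineConv_truncate h1 h2 u)

/-- For merely square-integrable n₁, n₂, truncate. The truncated convolutions converge pointwise and
are uniformly bounded, and 𝓕f is integrable. -/
theorem norm_integral_lineConv_mul_fourier_le {n₁ n₂ f : ℝ → ℂ} {B : ℝ}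
    (h1 : MemLp n₁ 2) (h2 : MemLp n₂ 2) (hf : Integrable f) (hf' : Integrable (𝓕 f))
    (hB : ∀ x, ‖f x‖ ≤ B) :
    ‖∫ u, lineConv n₁ n₂ u * 𝓕 f u‖ ≤
      B * ((eLpNorm n₁ 2 volume).toReal * (eLpNorm n₂ 2 volume).toReal) := by
  have hB0 : 0 ≤ B := (norm_nonneg _).trans (hB 0)
  set N := (eLpNorm n₁ 2 volume).toReal * (eLpNorm n₂ 2 volume).toReal with hN
  have hmul : ∀ k, (eLpNorm (truncate n₁ k) 2 volume).toReal *
      (eLpNorm (truncate n₂ k) 2 volume).toReal ≤ N := fun k =>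
    mul_le_mul (toReal_eLpNorm_truncate_le h1 k) (toReal_eLpNorm_truncate_le h2 k)
      ENNReal.toReal_nonneg ENNReal.toReal_nonneg
  have hlim : Tendsto (fun k => ∫ u, lineConv (truncate n₁ k) (truncate n₂ k) u * 𝓕 f u) atTop
      (𝓝 (∫ u, lineConv n₁ n₂ u * 𝓕 f u)) := by
    refine tendsto_integral_of_dominated_convergence (fun u => N * ‖𝓕 f u‖)
      (fun k => ?_) (hf'.norm.const_mul N) (fun k => Eventually.of_forall fun u => ?_)
      (Eventually.of_forall fun u => (tendsto_lineConv_truncate h1 h2 u).mul_const _)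
    · exact (integrable_lineConv (integrable_truncate h1 k) (integrable_truncate h2 k)).1.mul hf'.1
    · rw [norm_mul]
      exact mul_le_mul_of_nonneg_right ((norm_lineConv_le (memLp_truncate h1 k)
        (memLp_truncate h2 k) u).trans (hmul k)) (norm_nonneg _)
  refine le_of_tendsto hlim.norm (Eventually.of_forall fun k => ?_)
  exact (norm_integral_lineConv_mul_fourier_le_of_integrable (memLp_truncate h1 k)
    (memLp_truncate h2 k) (integrable_truncate h1 k) (integrable_truncate h2 k) hf hB).trans
    (mul_le_mul_of_nonneg_left (hmul k) hB0)

/-! ### Lower bound for the primal problem -/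

/-- Holomorphic functions on `{|Im z| < s}`, `s > 1`, with exponential decay. -/
structure IsStripDecaying (g : ℂ → ℂ) (s C : ℝ) : Prop where
  one_lt : 1 < s
  diff : DifferentiableOn ℂ g {z | |z.im| < s}
  le : ∀ z : ℂ, |z.im| < s → ‖g z‖ ≤ C * Real.exp (-1 * |z.re|)

namespace IsStripDecaying

variable {g : ℂ → ℂ} {s C : ℝ}

theorem norm_onLine_le (G : IsStripDecaying g s C) {y : ℝ} (hy : |y| < s) (x : ℝ) :
    ‖onLine g y x‖ ≤ C * Real.exp (-1 * |x|) := by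
  have := G.le ((x : ℂ) + y * Complex.I) (by rwa [im_ofReal_add])
  rwa [re_ofReal_add] at this

theorem continuous_onLine (G : IsStripDecaying g s C) {y : ℝ} (hy : |y| < s) :
    Continuous (onLine g y) :=
  _root_.continuous_onLine (s := {y | |y| < s}) G.diff.continuousOn hy

theorem integrable_onLine (G : IsStripDecaying g s C) {y : ℝ} (hy : |y| < s) :
    Integrable (onLine g y) :=
  ((integrable_exp_neg_mul_abs one_pos).const_mul C).mono'
    (G.continuous_onLine hy).aestronglyMeasurable (Eventually.of_forall (G.norm_onLine_le hy))

theorem memLp_onLine (G : IsStripDecaying g s C) {y : ℝ} (hy : |y| < s) :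
    MemLp (onLine g y) 2 := by
  refine ((memLp_two_exp_neg_mul_abs one_pos).const_mul C).mono
    (G.continuous_onLine hy).aestronglyMeasurable (Eventually.of_forall fun x => ?_)
  exact (G.norm_onLine_le hy x).trans (le_abs_self _)

theorem norm_fourier_onLine_le (G : IsStripDecaying g s C) {y : ℝ} (hy : |y| < s) (u : ℝ) :
    ‖𝓕 (onLine g y) u‖ ≤ C * ∫ x : ℝ, Real.exp (-1 * |x|) := by
  rw [Real.fourier_real_eq_integral_exp_smul, ← integral_const_mul]
  refine norm_integral_le_of_norm_le ((integrable_exp_neg_mul_abs one_pos).const_mul C)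
    (Eventually.of_forall fun x => ?_)
  rw [norm_smul, Complex.norm_exp_ofReal_mul_I, one_mul]
  exact G.norm_onLine_le hy x

theorem exp_mul_fourier_onLine_eq_of_le (G : IsStripDecaying g s C) {a b : ℝ} (ha : |a| < s)
    (hb : |b| < s) (hab : a ≤ b) (u : ℝ) :
    (Real.exp (2 * Real.pi * u * a) : ℂ) * 𝓕 (onLine g a) u =
      Real.exp (2 * Real.pi * u * b) * 𝓕 (onLine g b) u := by
  have hsub : ∀ {y}, y ∈ Icc a b → |y| < s := fun hy =>
    abs_lt.2 ⟨(abs_lt.1 ha).1.trans_le hy.1, hy.2.trans_lt (abs_lt.1 hb).2⟩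
  set F : ℂ → ℂ := fun z => Complex.exp (-(2 * Real.pi * u * Complex.I) * z) * g z with hF
  have hFd : DifferentiableOn ℂ F {z | |z.im| < s} := by
    refine DifferentiableOn.mul ?_ G.diff
    fun_prop
  have e : ∀ y x : ℝ, onLine F y x = Real.exp (2 * Real.pi * u * y) *
      (Complex.exp (↑(-2 * Real.pi * x * u) * Complex.I) • onLine g y x) := by
    intro y x
    rw [onLine_apply, onLine_apply, hF, smul_eq_mul, ← mul_assoc, Complex.ofReal_exp,
      ← Complex.exp_add]
    simp only
    congr 2
    push_cast
    linear_combination (-2 * Real.pi * u * y : ℂ) * Complex.I_sq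
  have hi : ∀ y, ∫ x, onLine F y x = Real.exp (2 * Real.pi * u * y) * 𝓕 (onLine g y) u := by
    intro y
    simp_rw [e]
    rw [integral_const_mul, Real.fourier_real_eq_integral_exp_smul]
  set D : ℝ → ℝ := fun x => Real.exp (2 * Real.pi * |u| * s) * (C * Real.exp (-1 * |x|)) with hD
  have hDi : Integrable D := ((integrable_exp_neg_mul_abs one_pos).const_mul C).const_mul _
  rw [← hi, ← hi]
  refine integral_onLine_eq_of_differentiableOn hab
    (hFd.continuousOn.mono fun z hz => hsub hz)
    (hFd.mono fun z hz => hsub (Ioo_subset_Icc_self hz)) (M := ∫⁻ x, ‖D x‖ₑ) hDi.2.ne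
    fun y hy => lintegral_tail_le fun x _ => ?_
  rw [e, norm_mul, norm_smul, Complex.norm_exp_ofReal_mul_I, one_mul, Complex.norm_real,
    Real.norm_of_nonneg (Real.exp_pos _).le, hD]
  refine mul_le_mul (Real.exp_le_exp.2 ?_) (G.norm_onLine_le (hsub hy) x) (norm_nonneg _)
    (Real.exp_pos _).le
  have : u * y ≤ |u| * s := by
    calc u * y ≤ |u * y| := le_abs_self _
      _ = |u| * |y| := abs_mul _ _
      _ ≤ _ := by gcongr; exact (hsub hy).le
  nlinarith [Real.pi_pos]

theorem fourier_onLine_eq (G : IsStripDecaying g s C) {a b : ℝ} (ha : |a| < s)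
    (hb : |b| < s) (u : ℝ) :
    𝓕 (onLine g a) u = Real.exp (2 * Real.pi * u * (b - a)) * 𝓕 (onLine g b) u := by
  have h : (Real.exp (2 * Real.pi * u * a) : ℂ) * 𝓕 (onLine g a) u =
      Real.exp (2 * Real.pi * u * b) * 𝓕 (onLine g b) u := by
    rcases le_total a b with hab | hab
    · exact G.exp_mul_fourier_onLine_eq_of_le ha hb hab u
    · exact (G.exp_mul_fourier_onLine_eq_of_le hb ha hab u).symm
  have e : (Real.exp (2 * Real.pi * u * b) : ℂ) =
      Real.exp (2 * Real.pi * u * a) * Real.exp (2 * Real.pi * u * (b - a)) := by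
    rw [← Complex.ofReal_mul, ← Real.exp_add]; congr 2; ring
  have h0 : (Real.exp (2 * Real.pi * u * a) : ℂ) ≠ 0 := by
    exact_mod_cast (Real.exp_pos _).ne'
  refine mul_left_cancel₀ h0 (h.trans ?_)
  rw [e, mul_assoc (Real.exp _ : ℂ)]

/-- Shift the line outside the closed strip: down to height −(s + 1)/2 for u ≥ 0 and up to (s − 1)/2
for u ≤ 0. Either way the distance moved is at least (s − 1)/2. -/
theorem norm_fourier_onLine_neg_le (G : IsStripDecaying g s C) {c : ℝ} (hc : c ∈ Icc (0 : ℝ) 1)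
    (u : ℝ) : ‖𝓕 (onLine g (-c)) u‖ ≤
      (C * ∫ x : ℝ, Real.exp (-1 * |x|)) * Real.exp (-(Real.pi * (s - 1)) * |u|) := by
  have hs := G.one_lt
  have hπ := Real.pi_pos
  have hc' : |-c| < s := by rw [abs_neg, abs_of_nonneg hc.1]; linarith [hc.2]
  have key : ∀ b : ℝ, |b| < s → 2 * Real.pi * u * (b - -c) ≤ -(Real.pi * (s - 1)) * |u| →
      ‖𝓕 (onLine g (-c)) u‖ ≤
        (C * ∫ x : ℝ, Real.exp (-1 * |x|)) * Real.exp (-(Real.pi * (s - 1)) * |u|) := by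
    intro b hb hle
    rw [G.fourier_onLine_eq hc' hb, norm_mul, Complex.norm_real,
      Real.norm_of_nonneg (Real.exp_pos _).le, mul_comm]
    have h1 := G.norm_fourier_onLine_le hb u
    exact mul_le_mul h1 (Real.exp_le_exp.2 hle) (Real.exp_pos _).le ((norm_nonneg _).trans h1)
  rcases le_total 0 u with hu | hu
  · refine key (-((s + 1) / 2)) ?_ ?_
    · rw [abs_neg, abs_of_pos (by linarith)]; linarith
    · rw [abs_of_nonneg hu]
      nlinarith [mul_nonneg hu (sub_nonneg.2 hc.2), mul_nonneg hπ.le (mul_nonneg hu (sub_nonneg.2 hc.2))]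
  · refine key ((s - 1) / 2) ?_ ?_
    · rw [abs_of_pos (by linarith)]; linarith
    · rw [abs_of_nonpos hu]
      nlinarith [mul_nonneg hπ.le (mul_nonneg (neg_nonneg.2 hu) hc.1)]

theorem continuous_fourier_onLine (G : IsStripDecaying g s C) {y : ℝ} (hy : |y| < s) :
    Continuous (𝓕 (onLine g y)) :=
  VectorFourier.fourierIntegral_continuous Real.continuous_fourierChar
    (by exact continuous_inner) (G.integrable_onLine hy)

theorem abs_neg_lt (G : IsStripDecaying g s C) {c : ℝ} (hc : c ∈ Icc (0 : ℝ) 1) : |-c| < s := by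
  rw [abs_neg, abs_of_nonneg hc.1]; linarith [hc.2, G.one_lt]

theorem integrable_fourier_onLine (G : IsStripDecaying g s C) {c : ℝ} (hc : c ∈ Icc (0 : ℝ) 1) :
    Integrable (𝓕 (onLine g (-c))) := by
  have : 0 < Real.pi * (s - 1) := mul_pos Real.pi_pos (by linarith [G.one_lt])
  exact ((integrable_exp_neg_mul_abs this).const_mul _).mono'
    (G.continuous_fourier_onLine (G.abs_neg_lt hc)).aestronglyMeasurable
    (Eventually.of_forall (G.norm_fourier_onLine_neg_le hc))

theorem integral_fourier_onLine (G : IsStripDecaying g s C) {c : ℝ} (hc : c ∈ Icc (0 : ℝ) 1) :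
    ∫ u, 𝓕 (onLine g (-c)) u = g (-c * Complex.I) := by
  have h := congrFun ((G.continuous_onLine (G.abs_neg_lt hc)).fourierInv_fourier_eq
    (G.integrable_onLine (G.abs_neg_lt hc)) (G.integrable_fourier_onLine hc)) 0
  rw [Real.fourierInv_eq', onLine_neg_apply] at h
  simpa using h

end IsStripDecaying

theorem memLp_lineError {θ : ℝ} {n₁ n₂ : ℝ → ℂ} (h1 : MemLp n₁ 2) (h2 : MemLp n₂ 2)
    (h : lineError θ n₁ n₂ ≠ ∞) :
    MemLp (fun u => (((2 * Real.pi * θ : ℝ) : ℂ) * lineConv n₁ n₂ u -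
      Real.exp (2 * Real.pi * θ * u)) * Real.exp (-(2 * Real.pi * u))) 2 ∧
    eLpNorm (fun u => (((2 * Real.pi * θ : ℝ) : ℂ) * lineConv n₁ n₂ u -
      Real.exp (2 * Real.pi * θ * u)) * Real.exp (-(2 * Real.pi * u))) 2 volume =
      lineError θ n₁ n₂ ^ (1 / 2 : ℝ) := by
  have e : eLpNorm (fun u => (((2 * Real.pi * θ : ℝ) : ℂ) * lineConv n₁ n₂ u -
      Real.exp (2 * Real.pi * θ * u)) * Real.exp (-(2 * Real.pi * u))) 2 volume =
      lineError θ n₁ n₂ ^ (1 / 2 : ℝ) := by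
    rw [eLpNorm_eq_lintegral_rpow_enorm_toReal two_ne_zero (by norm_num), lineError]
    simp only [ENNReal.toReal_ofNat]
    congr 1
    refine lintegral_congr fun u => ?_
    have h2 : ∀ x : ℝ≥0∞, x ^ (2 : ℝ) = x ^ 2 := fun x => by exact_mod_cast ENNReal.rpow_natCast x 2
    rw [enorm_mul, h2, mul_pow]
    congr 1
    rw [← ofReal_norm, Complex.norm_real, Real.norm_of_nonneg (Real.exp_pos _).le,
      ← ENNReal.ofReal_pow (Real.exp_pos _).le, ← Real.exp_nat_mul]
    congr 2
    push_cast
    ring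
  refine ⟨⟨?_, ?_⟩, e⟩
  · exact (((aestronglyMeasurable_lineConv h1 h2).const_mul _).sub
      (by fun_prop : Continuous fun u : ℝ => (Real.exp (2 * Real.pi * θ * u) : ℂ)).aestronglyMeasurable).mul
      (by fun_prop : Continuous fun u : ℝ => (Real.exp (-(2 * Real.pi * u)) : ℂ)).aestronglyMeasurable
  · rw [e]
    exact (ENNReal.rpow_ne_top_of_nonneg (by norm_num) h).lt_top

/-- The duality inequality between the two problems. -/
theorem IsStripDecaying.norm_le {g : ℂ → ℂ} {s C θ B : ℝ} (G : IsStripDecaying g s C)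
    (hθ : θ ∈ Ioo (0 : ℝ) 1) (hB : ∀ x, ‖onLine g 0 x‖ ≤ B) {n₁ n₂ : ℝ → ℂ} (h1 : MemLp n₁ 2)
    (h2 : MemLp n₂ 2) (h : lineError θ n₁ n₂ ≠ ∞) :
    ‖g (-θ * Complex.I)‖ ≤ B * (2 * Real.pi * θ *
      ((eLpNorm n₁ 2 volume).toReal * (eLpNorm n₂ 2 volume).toReal)) +
      (lineError θ n₁ n₂ ^ (1 / 2 : ℝ)).toReal * (eLpNorm (onLine g (-1)) 2 volume).toReal := by
  obtain ⟨hm, he⟩ := memLp_lineError h1 h2 h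
  have hπ := Real.pi_pos
  have t0 : (0 : ℝ) ∈ Icc (0 : ℝ) 1 := by simp
  have t1 : (1 : ℝ) ∈ Icc (0 : ℝ) 1 := by simp
  have tθ : θ ∈ Icc (0 : ℝ) 1 := Ioo_subset_Icc_self hθ
  have s0 : |(0 : ℝ)| < s := by simpa using G.abs_neg_lt t0
  set Q : ℝ → ℂ := fun u => (((2 * Real.pi * θ : ℝ) : ℂ) * lineConv n₁ n₂ u -
      Real.exp (2 * Real.pi * θ * u)) * Real.exp (-(2 * Real.pi * u))
  have i0 : Integrable (𝓕 (onLine g 0)) := by simpa using G.integrable_fourier_onLine t0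
  have f1 := memLp_fourier (G.integrable_onLine (G.abs_neg_lt t1)) (G.memLp_onLine (G.abs_neg_lt t1))
  have i1 : Integrable fun u => lineConv n₁ n₂ u * 𝓕 (onLine g 0) u := by
    refine i0.bdd_mul (aestronglyMeasurable_lineConv h1 h2)
      (Eventually.of_forall fun u => norm_lineConv_le h1 h2 u)
  -- By definition of Q, e^{2πθu} = 2πθ(n₁ * n₂)(u) − Q(u)e^{2πu}; multiplied by 𝓕g_0(u), the two
  -- exponentials become the transforms on the lines at −θ and −1.
  have key : ∀ u, 𝓕 (onLine g (-θ)) u = ((2 * Real.pi * θ : ℝ) : ℂ) *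
      (lineConv n₁ n₂ u * 𝓕 (onLine g 0) u) - Q u * 𝓕 (onLine g (-1)) u := by
    intro u
    rw [G.fourier_onLine_eq (G.abs_neg_lt tθ) s0, G.fourier_onLine_eq (G.abs_neg_lt t1) s0]
    have e1 : (Real.exp (-(2 * Real.pi * u)) : ℂ) * Real.exp (2 * Real.pi * u * (0 - -1)) = 1 := by
      rw [← Complex.ofReal_mul, ← Real.exp_add]; simp
    have e2 : 2 * Real.pi * u * (0 - -θ) = 2 * Real.pi * θ * u := by ring
    rw [e2]
    linear_combination (((2 * Real.pi * θ : ℝ) : ℂ) * lineConv n₁ n₂ u -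
      Real.exp (2 * Real.pi * θ * u)) * 𝓕 (onLine g 0) u * e1
  have i2 : Integrable fun u => Q u * 𝓕 (onLine g (-1)) u := hm.integrable_mul f1
  rw [← G.integral_fourier_onLine tθ]
  simp_rw [key]
  rw [integral_sub (i1.const_mul _) i2, integral_const_mul]
  refine (norm_sub_le _ _).trans (add_le_add ?_ ?_)
  · rw [norm_mul, Complex.norm_real, Real.norm_of_nonneg (by have := hθ.1; positivity)]
    have := norm_integral_lineConv_mul_fourier_le h1 h2 (G.integrable_onLine s0) i0 hB
    calc _ ≤ 2 * Real.pi * θ * (B * ((eLpNorm n₁ 2 volume).toReal *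
          (eLpNorm n₂ 2 volume).toReal)) := by
          have := hθ.1
          gcongr
      _ = _ := by ring
  · refine (norm_integral_mul_le hm f1).trans (le_of_eq ?_)
    rw [he, eLpNorm_fourier (G.integrable_onLine (G.abs_neg_lt t1)) (G.memLp_onLine (G.abs_neg_lt t1))]

/-! ### The extremal function as a test function -/

/-- A Gaussian regularization of a modulated function. -/
noncomputable def gaussTwist (ω ε : ℝ) (H : ℂ → ℂ) (z : ℂ) : ℂ :=
  H z * Complex.exp (Complex.I * ω * z - ε * z ^ 2)

theorem norm_gaussTwist (ω ε : ℝ) (H : ℂ → ℂ) (z : ℂ) :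
    ‖gaussTwist ω ε H z‖ = ‖H z‖ * Real.exp (-(ω * z.im) - ε * (z.re ^ 2 - z.im ^ 2)) := by
  rw [gaussTwist, norm_mul, Complex.norm_exp]
  congr 2
  simp [pow_two]

namespace IsExtremal

variable {θ s C : ℝ} {H : ℂ → ℂ}

theorem isStripDecaying_gaussTwist (E : IsExtremal θ H s C) (ω : ℝ) {ε : ℝ} (hε : 0 < ε) :
    ∃ C', IsStripDecaying (gaussTwist ω ε H) s C' := by
  -- Completing the square bounds b|x| − εx² by b²/(4ε); the summand 1 in b leaves the required
  -- decay e^{-|x|}.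
  set b := Real.pi / 2 * s + 1 with hb
  have hπ := Real.pi_pos
  have hs := E.one_lt
  have hC := E.C_pos
  refine ⟨C * Real.exp (|ω| * s + ε * s ^ 2 + b ^ 2 / (4 * ε)), E.one_lt, ?_, fun z hz => ?_⟩
  · refine E.diff.mul ?_
    fun_prop
  · rw [norm_gaussTwist]
    calc _ ≤ C * Real.exp (Real.pi / 2 * z.im * |z.re|) *
          Real.exp (-(ω * z.im) - ε * (z.re ^ 2 - z.im ^ 2)) := by
          gcongr; exact E.le z hz
      _ = C * Real.exp (Real.pi / 2 * z.im * |z.re| +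
          (-(ω * z.im) - ε * (z.re ^ 2 - z.im ^ 2))) := by rw [mul_assoc, Real.exp_add]
      _ ≤ C * Real.exp ((|ω| * s + ε * s ^ 2 + b ^ 2 / (4 * ε)) + -1 * |z.re|) := by
          refine mul_le_mul_of_nonneg_left (Real.exp_le_exp.2 ?_) hC.le
          have a1 : -(ω * z.im) ≤ |ω| * s := by
            calc -(ω * z.im) ≤ |ω * z.im| := neg_le_abs _
              _ = |ω| * |z.im| := abs_mul _ _
              _ ≤ _ := by gcongr
          have a2 : z.im ^ 2 ≤ s ^ 2 := by
            rw [← sq_abs z.im]; gcongr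
          have a3 : z.im * |z.re| ≤ s * |z.re| := by
            gcongr; exact (le_abs_self _).trans hz.le
          have a4 : b * |z.re| - ε * z.re ^ 2 ≤ b ^ 2 / (4 * ε) := by
            rw [le_div_iff₀ (by positivity), ← sq_abs z.re]
            nlinarith [sq_nonneg (b - 2 * ε * |z.re|)]
          have a5 := mul_le_mul_of_nonneg_left a3 (by positivity : 0 ≤ Real.pi / 2)
          have a6 := mul_le_mul_of_nonneg_left a2 hε.le
          have a7 : b * |z.re| = Real.pi / 2 * (s * |z.re|) + |z.re| := by rw [hb]; ring
          linarith
      _ = _ := by rw [Real.exp_add]; ring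

/-- H itself does not decay on ℝ. The damped and modulated H stays bounded by 1 on ℝ, gains at least
e^{ωθ} at −iθ, and has L² norm at most e^{ω+ε} on ℝ − i; then ε → 0. -/
theorem norm_mul_exp_le (E : IsExtremal θ H s C) (hθ : θ ∈ Ioo (0 : ℝ) 1) {n₁ n₂ : ℝ → ℂ}
    (h1 : MemLp n₁ 2) (h2 : MemLp n₂ 2) (h : lineError θ n₁ n₂ ≠ ∞) (ω : ℝ) :
    ‖H (-θ * Complex.I)‖ * Real.exp (ω * θ) ≤ 2 * Real.pi * θ *
      ((eLpNorm n₁ 2 volume).toReal * (eLpNorm n₂ 2 volume).toReal) +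
      Real.exp ω * (lineError θ n₁ n₂ ^ (1 / 2 : ℝ)).toReal := by
  have key : ∀ ε : ℝ, 0 < ε → ‖H (-θ * Complex.I)‖ * Real.exp (ω * θ) ≤ 2 * Real.pi * θ *
      ((eLpNorm n₁ 2 volume).toReal * (eLpNorm n₂ 2 volume).toReal) +
      Real.exp (ω + ε) * (lineError θ n₁ n₂ ^ (1 / 2 : ℝ)).toReal := by
    intro ε hε
    obtain ⟨C', G⟩ := E.isStripDecaying_gaussTwist ω hε
    have hB : ∀ x, ‖onLine (gaussTwist ω ε H) 0 x‖ ≤ 1 := by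
      intro x
      have := E.norm_onLine_zero x
      rw [onLine_apply] at this ⊢
      rw [norm_gaussTwist, this, one_mul, im_ofReal_add, re_ofReal_add, Real.exp_le_one_iff]
      nlinarith [mul_nonneg hε.le (sq_nonneg x)]
    have h3 := G.norm_le hθ hB h1 h2 h
    have h4 : ‖H (-θ * Complex.I)‖ * Real.exp (ω * θ) ≤ ‖gaussTwist ω ε H (-θ * Complex.I)‖ := by
      rw [norm_gaussTwist]
      gcongr
      simp
      positivity
    have h5 : (eLpNorm (onLine (gaussTwist ω ε H) (-1)) 2 volume).toReal ≤ Real.exp (ω + ε) := by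
      refine ENNReal.toReal_le_of_le_ofReal (Real.exp_pos _).le ?_
      have := eLpNorm_le_mul_eLpNorm_of_ae_le_mul (μ := volume) (f := onLine (gaussTwist ω ε H) (-1))
        (g := onLine H (-1)) (c := Real.exp (ω + ε)) (Eventually.of_forall fun x => ?_) 2
      · rwa [E.eLpNorm_onLine_neg_one hθ, mul_one] at this
      · rw [onLine_apply, onLine_apply, norm_gaussTwist, im_ofReal_add, re_ofReal_add, mul_comm]
        gcongr
        nlinarith [mul_nonneg hε.le (sq_nonneg x)]
    refine h4.trans (h3.trans ?_)
    rw [one_mul, mul_comm (Real.exp _)]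
    gcongr
  have hlim : Tendsto (fun ε : ℝ => 2 * Real.pi * θ *
      ((eLpNorm n₁ 2 volume).toReal * (eLpNorm n₂ 2 volume).toReal) +
      Real.exp (ω + ε) * (lineError θ n₁ n₂ ^ (1 / 2 : ℝ)).toReal) (𝓝[>] 0)
      (𝓝 (2 * Real.pi * θ * ((eLpNorm n₁ 2 volume).toReal * (eLpNorm n₂ 2 volume).toReal) +
      Real.exp (ω + 0) * (lineError θ n₁ n₂ ^ (1 / 2 : ℝ)).toReal)) :=
    tendsto_nhdsWithin_of_tendsto_nhds (Continuous.tendsto (by fun_prop) 0)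
  rw [add_zero] at hlim
  exact ge_of_tendsto hlim (eventually_nhdsWithin_of_forall key)

end IsExtremal

/-- The value of the primal problem in terms of the value `K` of the three lines problem. -/
noncomputable def primalValue (γ K : ℝ) : ℝ :=
  2 * Real.pi * (2 / γ) * ((1 - 2 / γ) ^ (γ - 2) * (2 / γ) ^ 2 * K ^ γ)

/-- The optimisation in ω with A = N/(1 − θ) and B = R/θ, raised to the power γ; the exponents
become (1 − θ)γ = γ − 2 and θγ = 2. -/
theorem rpow_mul_le_of_exp_le {γ K N R : ℝ} (hγ : 2 < γ) (hK : 0 ≤ K) (hN : 0 ≤ N) (hR : 0 ≤ R)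
    (h : ∀ ω : ℝ, K * Real.exp (ω * (2 / γ)) ≤ N + Real.exp ω * R) :
    (1 - 2 / γ) ^ (γ - 2) * (2 / γ) ^ 2 * K ^ γ ≤ N ^ (γ - 2) * R ^ 2 := by
  have hθ : 2 / γ ∈ Ioo (0 : ℝ) 1 := ⟨by positivity, (div_lt_one (by linarith)).2 hγ⟩
  set θ := 2 / γ with hθd
  have h0 := hθ.1
  have h1 : 0 < 1 - θ := by linarith [hθ.2]
  have hγ0 : γ ≠ 0 := by linarith
  have e1 : (1 - θ) * γ = γ - 2 := by rw [hθd]; field_simp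
  have e2 : θ * γ = 2 := by rw [hθd]; field_simp
  have h2 := le_mul_rpow_mul_rpow (K := 1) hθ (A := N / (1 - θ)) (B := R / θ) (by positivity)
    (by positivity) (X := K) (fun ω => (h ω).trans (le_of_eq (by field_simp)))
  rw [one_mul] at h2
  have h3 := Real.rpow_le_rpow hK h2 (by linarith : 0 ≤ γ)
  rw [Real.mul_rpow (by positivity) (by positivity), ← Real.rpow_mul (by positivity),
    ← Real.rpow_mul (by positivity), e1, e2, Real.div_rpow hN h1.le, Real.rpow_two, div_pow] at h3
  have h4 : 0 < (1 - θ) ^ (γ - 2) := by positivity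
  calc _ ≤ (1 - θ) ^ (γ - 2) * θ ^ 2 * (N ^ (γ - 2) / (1 - θ) ^ (γ - 2) * (R ^ 2 / θ ^ 2)) := by
        gcongr
    _ = _ := by field_simp

theorem IsExtremal.primalValue_le {γ s C : ℝ} {H : ℂ → ℂ} (hγ : 2 < γ)
    (E : IsExtremal (2 / γ) H s C) :
    ENNReal.ofReal (primalValue γ ‖H (-((2 / γ : ℝ) : ℂ) * Complex.I)‖) ≤ primalConst γ := by
  have hθ : 2 / γ ∈ Ioo (0 : ℝ) 1 := ⟨by positivity, (div_lt_one (by linarith)).2 hγ⟩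
  have hπ := Real.pi_pos
  refine le_primalConst (by linarith) fun n₁ n₂ h1 h2 h => ?_
  set θ := 2 / γ
  have h0 := hθ.1
  set R := (lineError θ n₁ n₂ ^ (1 / 2 : ℝ)).toReal with hR
  set N₁ := (eLpNorm n₁ 2 volume).toReal with hN₁
  set N₂ := (eLpNorm n₂ 2 volume).toReal with hN₂
  have a1 : 0 ≤ N₁ := ENNReal.toReal_nonneg
  have a2 : 0 ≤ N₂ := ENNReal.toReal_nonneg
  have a3 : 0 ≤ R := ENNReal.toReal_nonneg
  have hle := rpow_mul_le_of_exp_le hγ (norm_nonneg (H (-(θ : ℂ) * Complex.I)))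
    (by positivity) a3 (N := 2 * Real.pi * θ * (N₁ * N₂)) (E.norm_mul_exp_le hθ h1 h2 h)
  have e1 : lineError θ n₁ n₂ = ENNReal.ofReal (R ^ 2) := by
    rw [hR, ← ENNReal.toReal_pow, ENNReal.ofReal_toReal]
    · rw [← ENNReal.rpow_natCast, ← ENNReal.rpow_mul]
      norm_num
    · exact ENNReal.pow_ne_top (ENNReal.rpow_ne_top_of_nonneg (by norm_num) h)
  have e2 : ENNReal.ofReal (2 * Real.pi * θ) * (eLpNorm n₁ 2 volume * eLpNorm n₂ 2 volume) =
      ENNReal.ofReal (2 * Real.pi * θ * (N₁ * N₂)) := by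
    rw [ENNReal.ofReal_mul (by positivity : 0 ≤ 2 * Real.pi * θ), ENNReal.ofReal_mul a1, hN₁, hN₂,
      ENNReal.ofReal_toReal h1.2.ne, ENNReal.ofReal_toReal h2.2.ne]
  rw [e2, e1, ENNReal.ofReal_rpow_of_nonneg (by positivity) (by linarith),
    ← ENNReal.ofReal_mul (by positivity), ← ENNReal.ofReal_mul (by positivity)]
  refine ENNReal.ofReal_le_ofReal ?_
  have hc : 0 ≤ 2 * Real.pi * θ := by positivity
  exact (mul_le_mul_of_nonneg_left hle hc).trans (le_of_eq (mul_left_comm _ _ _))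

/-! ### Upper bound for the primal problem -/

theorem memLp_fourierInv {f : ℝ → ℂ} (h1 : Integrable f) (h2 : MemLp f 2) :
    MemLp (𝓕⁻ f) 2 := by
  have e : 𝓕⁻ f = 𝓕 f ∘ fun x => -x := by ext x; exact Real.fourierInv_eq_fourier_neg f x
  rw [e]
  exact (memLp_fourier h1 h2).comp_measurePreserving (Measure.measurePreserving_neg volume)

theorem eLpNorm_fourierInv {f : ℝ → ℂ} (h1 : Integrable f) (h2 : MemLp f 2) :
    eLpNorm (𝓕⁻ f) 2 volume = eLpNorm f 2 volume := by
  have e : 𝓕⁻ f = 𝓕 f ∘ fun x => -x := by ext x; exact Real.fourierInv_eq_fourier_neg f x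
  rw [e, eLpNorm_comp_measurePreserving (memLp_fourier h1 h2).1
    (Measure.measurePreserving_neg volume), eLpNorm_fourier h1 h2]

theorem fourierInv_eq_integral_exp (f : ℝ → ℂ) (u : ℝ) :
    𝓕⁻ f u = ∫ x : ℝ, Complex.exp (Complex.I * (2 * Real.pi * u : ℝ) * x) * f x := by
  rw [Real.fourierInv_eq']
  congr 1; ext x
  rw [smul_eq_mul]
  congr 2
  simp
  ring

theorem fourier_eq_integral_exp (f : ℝ → ℂ) (u : ℝ) :
    𝓕 f u = ∫ x : ℝ, Complex.exp (-(Complex.I * (2 * Real.pi * u : ℝ) * x)) * f x := by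
  rw [Real.fourier_real_eq_integral_exp_smul]
  congr 1; ext x
  rw [smul_eq_mul]
  congr 2
  push_cast
  ring

theorem conj_fourier (f : ℝ → ℂ) (u : ℝ) :
    conj (𝓕 f u) = ∫ x : ℝ, Complex.exp (Complex.I * (2 * Real.pi * u : ℝ) * x) * conj (f x) := by
  rw [fourier_eq_integral_exp, ← integral_conj]
  congr 1; ext x
  rw [map_mul, ← Complex.exp_conj]
  simp only [map_neg, map_mul, Complex.conj_I, Complex.conj_ofReal, neg_mul, neg_neg]

theorem norm_exp_I_mul_real (ω x : ℝ) : ‖Complex.exp (Complex.I * ω * x)‖ = 1 := by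
  simpa using norm_exp_I_mul ω x 0

/-- Parseval for e^{2πiux}b₁ and conj b₂: the transform of the first at v is 𝓕⁻b₁(u − v), and the
conjugate of the transform of the second is 𝓕⁻b₂(v). -/
theorem lineConv_fourierInv {b₁ b₂ : ℝ → ℂ} (i1 : Integrable b₁) (h1 : MemLp b₁ 2)
    (i2 : Integrable b₂) (h2 : MemLp b₂ 2) (u : ℝ) :
    lineConv (𝓕⁻ b₁) (𝓕⁻ b₂) u =
      ∫ x : ℝ, Complex.exp (Complex.I * (2 * Real.pi * u : ℝ) * x) * (b₁ x * b₂ x) := by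
  set c : ℝ → ℂ := fun x => Complex.exp (Complex.I * (2 * Real.pi * u : ℝ) * x) * b₁ x with hc
  have hcm : AEStronglyMeasurable c volume :=
    (by fun_prop : Continuous fun x : ℝ =>
      Complex.exp (Complex.I * (2 * Real.pi * u : ℝ) * x)).aestronglyMeasurable.mul h1.1
  have hcn : ∀ x, ‖c x‖ = ‖b₁ x‖ := fun x => by
    rw [hc, norm_mul, norm_exp_I_mul_real, one_mul]
  have ic : Integrable c := i1.mono hcm (Eventually.of_forall fun x => (hcn x).le)
  have mc : MemLp c 2 := h1.mono hcm (Eventually.of_forall fun x => (hcn x).le)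
  have hs : ∀ x, ‖conj (b₂ x)‖ ≤ ‖b₂ x‖ := fun x => (RCLike.norm_conj _).le
  have hsm : AEStronglyMeasurable (fun x => conj (b₂ x)) volume :=
    Complex.continuous_conj.comp_aestronglyMeasurable h2.1
  have key := integral_fourier_mul_conj ic mc (i2.mono hsm (Eventually.of_forall hs))
    (h2.mono hsm (Eventually.of_forall hs))
  simp only [Complex.conj_conj] at key
  rw [lineConv]
  refine Eq.trans ?_ (key.trans ?_)
  · congr 1; ext v
    rw [conj_fourier, fourierInv_eq_integral_exp, fourierInv_eq_integral_exp,
      fourier_eq_integral_exp]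
    simp only [Complex.conj_conj]
    congr 2; ext x
    rw [hc, ← mul_assoc, ← Complex.exp_add]
    congr 2
    push_cast
    ring
  · congr 1; ext x
    rw [hc, mul_assoc]

/-- A square root factorization of an exponentially decaying function. -/
theorem exists_factorization {a : ℝ → ℂ} (hc : Continuous a) (h0 : ∀ x, a x ≠ 0) {D δ : ℝ}
    (hδ : 0 < δ) (ha : ∀ x, ‖a x‖ ≤ D * Real.exp (-(2 * δ) * |x|)) :
    ∃ b₁ b₂ : ℝ → ℂ, Integrable b₁ ∧ MemLp b₁ 2 ∧ Integrable b₂ ∧ MemLp b₂ 2 ∧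
      (∀ x, b₁ x * b₂ x = a x) ∧
      eLpNorm b₁ 2 volume * eLpNorm b₂ 2 volume = ENNReal.ofReal (∫ x, ‖a x‖) := by
  have hpos : ∀ x, 0 < √‖a x‖ := fun x => Real.sqrt_pos.2 (norm_pos_iff.2 (h0 x))
  -- Factors of equal modulus √|a| give equality in Cauchy-Schwarz, so the product of the norms is
  -- exactly the L¹ norm of a.
  set b₁ : ℝ → ℂ := fun x => (√‖a x‖ : ℝ) with hb₁
  set b₂ : ℝ → ℂ := fun x => a x / (√‖a x‖ : ℝ) with hb₂
  have hne : ∀ x, ((√‖a x‖ : ℝ) : ℂ) ≠ 0 := fun x => by exact_mod_cast (hpos x).ne'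
  have c1 : Continuous b₁ := by fun_prop
  have c2 : Continuous b₂ := hc.div c1 hne
  have n1 : ∀ x, ‖b₁ x‖ = √‖a x‖ := fun x => by
    rw [hb₁, Complex.norm_real, Real.norm_of_nonneg (hpos x).le]
  have n2 : ∀ x, ‖b₂ x‖ = √‖a x‖ := fun x => by
    rw [hb₂, norm_div, Complex.norm_real, Real.norm_of_nonneg (hpos x).le, Real.div_sqrt]
  have hle : ∀ x, √‖a x‖ ≤ √D * Real.exp (-δ * |x|) := by
    intro x
    have hD : 0 ≤ D := by
      have := (norm_nonneg _).trans (ha 0)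
      simpa using this
    refine Real.sqrt_le_iff.2 ⟨by positivity, (ha x).trans (le_of_eq ?_)⟩
    rw [mul_pow, Real.sq_sqrt hD, ← Real.exp_nat_mul]
    congr 2
    push_cast
    ring
  have hi : ∀ b : ℝ → ℂ, Continuous b → (∀ x, ‖b x‖ = √‖a x‖) →
      Integrable b ∧ MemLp b 2 ∧ eLpNorm b 2 volume = ENNReal.ofReal (∫ x, ‖a x‖) ^ (1 / 2 : ℝ) := by
    intro b hb hn
    refine ⟨((integrable_exp_neg_mul_abs hδ).const_mul _).mono' hb.aestronglyMeasurable
      (Eventually.of_forall fun x => (hn x).trans_le (hle x)),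
      ((memLp_two_exp_neg_mul_abs hδ).const_mul (√D)).mono hb.aestronglyMeasurable
        (Eventually.of_forall fun x => ((hn x).trans_le (hle x)).trans (le_abs_self _)), ?_⟩
    have hai : Integrable a := ((integrable_exp_neg_mul_abs (mul_pos two_pos hδ)).const_mul D).mono'
      hc.aestronglyMeasurable (Eventually.of_forall ha)
    rw [eLpNorm_eq_lintegral_rpow_enorm_toReal two_ne_zero (by norm_num)]
    simp only [ENNReal.toReal_ofNat]
    rw [ofReal_integral_eq_lintegral_ofReal hai.norm (Eventually.of_forall fun x => norm_nonneg _)]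
    congr 1
    refine lintegral_congr fun x => ?_
    rw [← ofReal_norm, hn, ENNReal.ofReal_rpow_of_nonneg (hpos x).le (by norm_num), Real.rpow_two,
      Real.sq_sqrt (norm_nonneg _)]
  obtain ⟨i1, m1, e1⟩ := hi b₁ c1 n1
  obtain ⟨i2, m2, e2⟩ := hi b₂ c2 n2
  refine ⟨b₁, b₂, i1, m1, i2, m2, fun x => mul_div_cancel₀ _ (hne x), ?_⟩
  rw [e1, e2, ← ENNReal.rpow_add_of_nonneg _ _ (by norm_num) (by norm_num)]
  norm_num

namespace IsExtremal

variable {θ s C : ℝ} {H : ℂ → ℂ}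

/-- The Poisson formula for the constant function 1. Since 1/H is holomorphic across both edges, the
residue theorem applies on the closed strip without a limit. -/
theorem integral_dualKernel (E : IsExtremal θ H s C) (hθ : θ ∈ Ioo (0 : ℝ) 1) (ω : ℝ) :
    (∫ x, onLine (dualKernel θ ω H) 0 x) - ∫ x, onLine (dualKernel θ ω H) (-1) x =
      Real.exp (ω * θ) / H (-θ * Complex.I) := by
  set Φ : ℂ → ℂ := fun z => Complex.exp (Complex.I * ω * z) / H z with hΦ
  have hΦd : DifferentiableOn ℂ Φ {z | z.im ∈ Icc (-1 : ℝ) 0} := by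
    intro z hz
    have hz' : |z.im| < s := E.abs_lt_of_mem hz
    have e2 : DifferentiableAt ℂ H z := E.diff.differentiableAt ((isOpen_abs_im_lt s).mem_nhds hz')
    exact (DifferentiableAt.div (by fun_prop) e2 (E.ne_zero hz')).differentiableWithinAt
  have hform : (fun z => Φ z * stripKernel θ z) = dualKernel θ ω H := by
    ext z
    simp only [hΦ, dualKernel]
    ring
  have hi : Integrable fun x : ℝ => 2 * C * Real.exp |ω| * Real.exp (-(Real.pi / 2) * |x|) :=
    (integrable_exp_neg_mul_abs (by have := Real.pi_pos; positivity)).const_mul _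
  have key := integral_mul_stripKernel hθ le_rfl (by linarith [hθ.2]) (by linarith [hθ.1]) le_rfl
    hΦd.continuousOn (hΦd.mono fun z hz => ⟨hz.1.le, hz.2.le⟩) hi.2.ne fun y hy =>
      lintegral_tail_le fun x hx => by
        rw [hform]
        exact E.norm_dualKernel_le_of_one_lt hθ ω hy hx
  rw [hform] at key
  rw [key, hΦ]
  simp only
  congr 1
  rw [Complex.ofReal_exp]
  congr 1
  push_cast
  linear_combination (-(ω : ℂ) * θ) * Complex.I_sq

theorem integral_dualKernel_neg_one (E : IsExtremal θ H s C) (hθ : θ ∈ Ioo (0 : ℝ) 1) (u : ℝ) :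
    ∫ x, onLine (dualKernel θ (2 * Real.pi * u) H) (-1) x =
      -(θ * Real.exp (2 * Real.pi * u)) * conj (𝓕 (onLine H (-1)) u) := by
  rw [conj_fourier, ← integral_const_mul]
  congr 1; ext x
  rw [E.dualKernel_neg_one hθ]

theorem onLine_dualKernel_zero (u x : ℝ) :
    onLine (dualKernel θ (2 * Real.pi * u) H) 0 x =
      Complex.exp (Complex.I * (2 * Real.pi * u : ℝ) * x) * onLine (dualKernel θ 0 H) 0 x := by
  simp only [onLine_apply, dualKernel]
  simp [mul_div_assoc]

theorem integrable_onLine_neg_one (E : IsExtremal θ H s C) : Integrable (onLine H (-1)) := by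
  refine ((integrable_exp_neg_mul_abs (a := Real.pi / 2)
    (by have := Real.pi_pos; positivity)).const_mul C).mono'
    E.continuous_onLine_neg_one.aestronglyMeasurable (Eventually.of_forall fun x => ?_)
  have := E.le ((x : ℂ) + ((-1 : ℝ) : ℂ) * Complex.I)
    (by rw [im_ofReal_add]; exact E.abs_lt_of_mem (by simp))
  rw [im_ofReal_add, re_ofReal_add] at this
  rw [onLine_apply]
  refine this.trans (le_of_eq ?_)
  congr 2
  ring

/-- The competitors built from the extremal function. -/
theorem exists_competitors (E : IsExtremal θ H s C) (hθ : θ ∈ Ioo (0 : ℝ) 1) :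
    ∃ n₁ n₂ : ℝ → ℂ, MemLp n₁ 2 ∧ MemLp n₂ 2 ∧
      ENNReal.ofReal (2 * Real.pi * θ) * (eLpNorm n₁ 2 volume * eLpNorm n₂ 2 volume) =
        ENNReal.ofReal (‖H (-θ * Complex.I)‖ * (1 - θ)) ∧
      lineError θ n₁ n₂ = ENNReal.ofReal (‖H (-θ * Complex.I)‖ ^ 2 * θ ^ 2) := by
  have hπ := Real.pi_pos
  have h0 := hθ.1
  have hθ' := one_sub_mem_Ioo hθ
  have hw : |(-θ * Complex.I : ℂ).im| < s := by
    have : (-θ * Complex.I : ℂ).im = -θ := by simp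
    rw [this]
    exact E.abs_lt_of_mem ⟨by linarith [hθ.2], by linarith [hθ.1]⟩
  have hH0 := E.ne_zero hw
  set K := H (-θ * Complex.I) with hK
  set c : ℝ := 2 * Real.pi * θ with hc
  have hc0 : 0 < c := by positivity
  have hcC : (c : ℂ) ≠ 0 := by exact_mod_cast hc0.ne'
  -- Chosen so that 2πθ times its inverse Fourier transform is the integral over ℝ in the residue
  -- identity, multiplied by H(−iθ).
  set a : ℝ → ℂ := fun x => K / c * onLine (dualKernel θ 0 H) 0 x with ha
  have han : ∀ x, ‖a x‖ = ‖K‖ / c * stripDensity (1 - θ) x := fun x => by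
    rw [ha, norm_mul, E.norm_dualKernel_zero hθ, norm_div, Complex.norm_real,
      Real.norm_of_nonneg hc0.le]
  have hac : Continuous a :=
    continuous_const.mul (E.continuous_onLine_dualKernel hθ 0 (by simp) (by linarith))
  have hKpos : 0 < ‖K‖ := norm_pos_iff.2 hH0
  have ha0 : ∀ x, a x ≠ 0 := fun x => by
    rw [← norm_pos_iff, han]
    have := stripDensity_pos hθ' x
    positivity
  obtain ⟨D, -, hDle⟩ := stripDensity_le hθ'
  obtain ⟨b₁, b₂, i1, m1, i2, m2, hb, hn⟩ := exists_factorization hac ha0 (D := ‖K‖ / c * D)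
    (δ := Real.pi / 2) (by positivity) (fun x => by
      rw [han, mul_assoc, mul_div_cancel₀ _ two_ne_zero]
      gcongr
      exact hDle x)
  -- The residue identity with ω = 2πu, multiplied by K: its right side is e^{2πθu}, so the integral
  -- over ℝ − i is precisely the approximation error. The factor e^{2πu} cancels against the weight,
  -- and Plancherel evaluates the rest.
  have hconv : ∀ u, (c : ℂ) * lineConv (𝓕⁻ b₁) (𝓕⁻ b₂) u - Real.exp (2 * Real.pi * θ * u) =
      -(K * θ * Real.exp (2 * Real.pi * u)) * conj (𝓕 (onLine H (-1)) u) := by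
    intro u
    have e1 : (c : ℂ) * lineConv (𝓕⁻ b₁) (𝓕⁻ b₂) u =
        K * ∫ x, onLine (dualKernel θ (2 * Real.pi * u) H) 0 x := by
      rw [lineConv_fourierInv i1 m1 i2 m2, ← integral_const_mul, ← integral_const_mul]
      congr 1; ext x
      rw [hb, onLine_dualKernel_zero, ha]
      field_simp
    have e2 := E.integral_dualKernel hθ (2 * Real.pi * u)
    rw [E.integral_dualKernel_neg_one hθ, ← hK, eq_div_iff hH0] at e2
    rw [e1, show 2 * Real.pi * θ * u = 2 * Real.pi * u * θ by ring]
    linear_combination e2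
  refine ⟨𝓕⁻ b₁, 𝓕⁻ b₂, memLp_fourierInv i1 m1, memLp_fourierInv i2 m2, ?_, ?_⟩
  · rw [eLpNorm_fourierInv i1 m1, eLpNorm_fourierInv i2 m2, hn, ← ENNReal.ofReal_mul hc0.le]
    congr 1
    simp_rw [han]
    rw [integral_const_mul, integral_stripDensity hθ']
    field_simp
  · have hm : MemLp (onLine H (-1)) 2 :=
      ⟨E.continuous_onLine_neg_one.aestronglyMeasurable,
        by rw [E.eLpNorm_onLine_neg_one hθ]; exact ENNReal.one_lt_top⟩
    have hF := eLpNorm_fourier E.integrable_onLine_neg_one hm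
    rw [E.eLpNorm_onLine_neg_one hθ, eLpNorm_eq_lintegral_rpow_enorm_toReal two_ne_zero
      (by norm_num)] at hF
    simp only [ENNReal.toReal_ofNat] at hF
    have hF2 : ∫⁻ u, ‖𝓕 (onLine H (-1)) u‖ₑ ^ (2 : ℝ) = 1 := by
      have := congrArg (fun t : ℝ≥0∞ => t ^ (2 : ℝ)) hF
      simp only [← ENNReal.rpow_mul, ENNReal.one_rpow] at this
      simpa using this
    have e : ∀ u, ‖(c : ℂ) * lineConv (𝓕⁻ b₁) (𝓕⁻ b₂) u - Real.exp (2 * Real.pi * θ * u)‖ₑ ^ 2 *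
        ENNReal.ofReal (Real.exp (-(4 * Real.pi * u))) =
        ENNReal.ofReal (‖K‖ ^ 2 * θ ^ 2) * ‖𝓕 (onLine H (-1)) u‖ₑ ^ (2 : ℝ) := by
      intro u
      rw [hconv, ← ofReal_norm, ← ofReal_norm,
        ENNReal.ofReal_rpow_of_nonneg (norm_nonneg _) (by norm_num), Real.rpow_two,
        ← ENNReal.ofReal_pow (norm_nonneg _), ← ENNReal.ofReal_mul (by positivity),
        ← ENNReal.ofReal_mul (by positivity)]
      congr 1
      rw [norm_mul, norm_neg, norm_mul, norm_mul, RCLike.norm_conj, Complex.norm_real,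
        Complex.norm_real, Real.norm_of_nonneg h0.le, Real.norm_of_nonneg (Real.exp_pos _).le]
      have : Real.exp (2 * Real.pi * u) ^ 2 * Real.exp (-(4 * Real.pi * u)) = 1 := by
        rw [← Real.exp_nat_mul, ← Real.exp_add]
        push_cast
        ring_nf
        simp
      linear_combination (‖K‖ ^ 2 * θ ^ 2 * ‖𝓕 (onLine H (-1)) u‖ ^ 2) * this
    rw [lineError]
    simp_rw [← hc]
    simp_rw [hc] at e ⊢
    simp_rw [e]
    rw [lintegral_const_mul' _ _ ENNReal.ofReal_ne_top, hF2, mul_one]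

theorem primalConst_le {γ : ℝ} (hγ : 2 < γ) (E : IsExtremal (2 / γ) H s C) :
    primalConst γ ≤ ENNReal.ofReal (primalValue γ ‖H (-((2 / γ : ℝ) : ℂ) * Complex.I)‖) := by
  have hθ : 2 / γ ∈ Ioo (0 : ℝ) 1 := ⟨by positivity, (div_lt_one (by linarith)).2 hγ⟩
  obtain ⟨n₁, n₂, h1, h2, hn, he⟩ := E.exists_competitors hθ
  have h := _root_.primalConst_le (by linarith) h1 h2 (he ▸ ENNReal.ofReal_ne_top)
  have hπ := Real.pi_pos
  have h0 := hθ.1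
  have h1' : 0 ≤ 1 - 2 / γ := by linarith [hθ.2]
  set K := ‖H (-((2 / γ : ℝ) : ℂ) * Complex.I)‖ with hK
  have hKpos : 0 < K := by
    refine norm_pos_iff.2 (E.ne_zero ?_)
    have : (-((2 / γ : ℝ) : ℂ) * Complex.I).im = -(2 / γ) := by simp
    rw [this]
    exact E.abs_lt_of_mem ⟨by linarith [hθ.2], by linarith [hθ.1]⟩
  rw [hn, he, ENNReal.ofReal_rpow_of_nonneg (by positivity) (by linarith),
    ← ENNReal.ofReal_mul (by positivity), ← ENNReal.ofReal_mul (by positivity)] at h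
  refine h.trans (le_of_eq ?_)
  congr 1
  rw [primalValue, Real.mul_rpow hKpos.le h1']
  have : K ^ γ = K ^ (γ - 2) * K ^ 2 := by
    rw [← Real.rpow_two, ← Real.rpow_add hKpos]; congr 1; ring
  rw [this]
  ring

end IsExtremal

theorem primalValue_eq {γ : ℝ} (hγ : 2 < γ) (K : ℝ) : primalValue γ K =
    16 * Real.pi * ((γ - 2) ^ (γ - 2) / γ ^ (γ + 1)) * K ^ γ := by
  have h0 : 0 < γ := by linarith
  have e : 1 - 2 / γ = (γ - 2) / γ := by field_simp
  have e2 : γ ^ (γ + 1) = γ ^ (γ - 2) * γ ^ 3 := by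
    rw [← Real.rpow_natCast, ← Real.rpow_add h0]; congr 1; push_cast; ring
  have : 0 < γ ^ (γ - 2) := by positivity
  rw [primalValue, e, Real.div_rpow (by linarith) h0.le, e2]
  field_simp
  ring

theorem theorem1p1 (γ : ℝ) (hγ : 2 < γ) :
    -- the boundary values `h_0 ∈ L^∞` and `h_{-1} ∈ L²` exist
    (∀ h ∈ hardyLower ∞ 2,
      (∃ v, IsBoundaryValue ∞ h (𝓝[<] (0 : ℝ)) v) ∧
      (∃ v, IsBoundaryValue 2 h (𝓝[>] (-1 : ℝ)) v)) ∧
    -- the maximum is attained, is finite, and yields `M_γ`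
    (∃ K : ℝ≥0, IsGreatest (threeLinesRatio γ '' threeLinesDomain) (K : ℝ≥0∞) ∧
      primalConst γ =
        ENNReal.ofReal
          (16 * Real.pi * ((γ - 2) ^ (γ - 2) / γ ^ (γ + 1)) * (K : ℝ) ^ γ)) ∧
    -- a maximizer exists, and the maximizers are exactly its transforms
    (∃ h, IsThreeLinesMaximizer γ h) ∧
    (∀ h, IsThreeLinesMaximizer γ h → ∀ h' : ℂ → ℂ,
      (IsThreeLinesMaximizer γ h' ↔
        ∃ (α ω : ℝ) (β : ℂ), β ≠ 0 ∧
          EqOn h' (fun z => β * h (z - α) * Complex.exp (Complex.I * ω * z)) lowerStrip)) := by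
  have hθ : 2 / γ ∈ Ioo (0 : ℝ) 1 := ⟨by positivity, (div_lt_one (by linarith)).2 hγ⟩
  obtain ⟨H, s, C, E⟩ := exists_isExtremal hθ
  refine ⟨fun h hh => ?_, ⟨_, isGreatest_threeLinesRatio hγ E, ?_⟩,
    ⟨orbitMap 0 0 1 H, (isThreeLinesMaximizer_iff hγ E).2
      ⟨0, 0, 1, one_ne_zero, fun z _ => rfl⟩⟩,
    fun h hh h' => isThreeLinesMaximizer_iff_orbitMap hγ hh h'⟩
  · obtain ⟨v₀, v₁, hb⟩ := exists_hasBoundary hh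
    exact ⟨⟨v₀, hb.isBoundaryValue_zero⟩, ⟨v₁, hb.isBoundaryValue_neg_one⟩⟩
  · rw [coe_nnnorm, ← primalValue_eq hγ]
    exact le_antisymm (E.primalConst_le hγ) (E.primalValue_le hγ)
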